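/- Let $f\neq 0$ be a Hecke eigencuspform of weight $\kappa$ for $\mathrm{SL}(2,\mathbb Z)$, $f(z)=\sum_{n\ge1}a_f(n)n^{(\kappa-1)/2}e^{2\pi i nz}$, and let $k,M\ge 1$ be integers. For a positive fundamental discriminant $d$ (including $d=1$) let $\chi_d=\left(\frac d\cdot\right)$ be the Kronecker symbol, and let $L(s,f\otimes\chi_d)$ be the entire continuation of $\sum_{n\ge1} a_f(n)\chi_d(n)n^{-s}$ from $\mathrm{Re}(s)>1$. Write $\sum^*$ for a sum over positive fundamental discriminants, and put $$A_{f,M}(s_1,\dots,s_k;w)=\sum_{d\ge1}{}^{*}\ \frac{\chi_d(M)L(s_1,f\otimes\chi_d)\cdots L(s_k,f\otimes\chi_d)}{d^w},\qquad \sigma_J(w)=w+2\sum_{j\in J}s_j-|J|\quad (J\subseteq\{1,\dots,k\}),$$ $$\mathcal X_f(s)=i^\kappa(2\pi)^{2s-1}\frac{\Gamma\left(1-s+\frac{\kappa-1}2\right)}{\Gamma\left(s+\frac{\kappa-1}2\right)},\qquad a(n)=\prod_{p\mid n}\frac p{p+1},$$ $$H_{f,M}(s_1,\dots,s_k)=\frac1{2\zeta(2)}\sum_{\substack{n_1,\dots,n_k\ge1\\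 Mn_1\cdots n_k=\square}}\frac{a_f(n_1)\cdots a_f(n_k)\,a(Mn_1\cdots n_k)}{n_1^{s_1}\cdots n_k^{s_k}}\qquad(\mathrm{Re}(s_j)>1).$$ Assume that the function $\prod_{J\subseteq\{1,\dots,k\}}(\sigma_J(w)-1)\cdot A_{f,M}(s_1,\dots,s_k;w)$ has a holomorphic continuation, from the region $\mathrm{Re}(w)>1$, $\mathrm{Re}(s_j)>1$ of absolute convergence, to a tube domain $V+i\mathbb R^{k+1}$ (with $V\subseteq\mathbb R^{k+1}$ open and connected) that contains $(s_1,\dots,s_k,w)=(\frac12,\dots,\frac12,1)$, and that the continuation $F$ is polynomially bounded in vertical strips there: for every closed box $B\subseteq V$ there is a real polynomial $P$ with $|F(\sigma+it)|\le|P(t)|$ for all $\sigma\in B$, $t\in\mathbb R^{k+1}$. Then the recipe prediction holds with a power-saving error term. That is, there are $\varepsilon>0$ and $\delta>0$ such that $H_{f,M}$ has a meromorphic continuation to $\{\mathrm{Re}(s_j)>\frac12-\varepsilon \text{ for all } j\}$ and, for every smooth compactly supported $g:\mathbb R\to\mathbb C$ with Mellin transform $\tilde g(s)=\int_0^\infty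 g(x)x^{s-1}\,dx$, the following holds. For each $X>0$ the sum $$R_X(s_1,\dots,s_k)=\sum_{J\subseteq\{1,\dots,k\}}\ \prod_{j\in J}\mathcal X_f(s_j)\cdot X^{1+|J|-2\sum_{j\in J}s_j}\ \tilde g\Big(1+|J|-2\sum_{j\in J}s_j\Big)\,H_{f,M}(s_1^J,\dots,s_k^J),\qquad s_j^J=\begin{cases}1-s_j& j\in J\\ s_j& j\notin J,\end{cases}$$ (whose individual terms may have poles) extends holomorphically to $\{|\mathrm{Re}(s_j)-\frac12|<\varepsilon\text{ for all }j\}$; and for all $C,B>0$, as $X\to\infty$, $$\sum_{d\ge1}{}^{*}\ g\Big(\frac dX\Big)\chi_d(M)L(s_1,f\otimes\chi_d)\cdots L(s_k,f\otimes\chi_d)=R_X(s_1,\dots,s_k)+O\big(X^{1-\delta}\big)$$ uniformly for $|\mathrm{Re}(s_j)-\frac12|\le C/\log X$ and $|\mathrm{Im}(s_j)|\le B$. The implied constant may depend on $f,k,M,g,C,B$, while $\delta$ and $\varepsilon$ depend only on $f,k,M$ and the assumed continuation. -/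

import Mathlib

open scoped MatrixGroups ContDiff BigOperators UpperHalfPlane

noncomputable section

namespace QuadTwist

/-! ### Fundamental discriminants and the Kronecker symbol -/

/-- `d` is a positive fundamental discriminant (`d = 1` included). -/
def IsPosFundDisc (d : ℕ) : Prop :=
  (d % 4 = 1 ∧ Squarefree d) ∨
    ∃ m : ℕ, d = 4 * m ∧ (m % 4 = 2 ∨ m % 4 = 3) ∧ Squarefree m

/-- The Kronecker symbol `(d / n)` for `n ≥ 0`: completely multiplicative in `n`, equal to the
Legendre symbol at odd primes, and at `2` equal to `1`, `-1`, `0` according as `d ≡ ±1 mod 8`,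
`d ≡ ±3 mod 8` or `d` is even (which is the value `χ₈ d`). -/
def kronecker (d : ℤ) (n : ℕ) : ℤ :=
  if n = 0 then (if d.natAbs = 1 then 1 else 0)
  else ZMod.χ₈ (d : ZMod 8) ^ n.factorization 2 * jacobiSym d (n / 2 ^ n.factorization 2)

/-- The quadratic character `χ_d = (d / ·)`, with complex values. -/
def chi (d n : ℕ) : ℂ := (kronecker (d : ℤ) n : ℂ)

/-! ### Level one Hecke eigenforms and their quadratic twists -/

/-- The `n`-th Hecke operator of weight `κ` and level one,
`(T_n f)(z) = n^(κ-1) ∑_{ad = n} d^(-κ) ∑_{0 ≤ b < d} f((a z + b) / d)`. -/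
def heckeT (κ : ℤ) (n : ℕ) (f : ℍ → ℂ) (z : ℍ) : ℂ :=
  (n : ℂ) ^ (κ - 1) * ∑ d ∈ n.divisors, (d : ℂ) ^ (-κ) *
    ∑ b ∈ Finset.range d,
      f (UpperHalfPlane.ofComplex ((((n / d : ℕ) : ℂ) * (z : ℂ) + (b : ℂ)) / (d : ℂ)))

/-- `f` is a (nonzero) Hecke eigenform: an eigenfunction of every `T_n`, `n ≥ 1`. -/
def IsHeckeEigenform {κ : ℤ} (f : CuspForm 𝒮ℒ κ) : Prop :=
  f ≠ 0 ∧ ∀ n : ℕ, 1 ≤ n → ∃ c : ℂ, ∀ z : ℍ, heckeT κ n f z = c * f z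

/-- The normalized Fourier coefficients `a_f(n)`:
`f(z) = ∑_{n ≥ 1} a_f(n) n^((κ-1)/2) e^(2πinz)`. -/
def coeffA {κ : ℤ} (f : CuspForm 𝒮ℒ κ) (n : ℕ) : ℂ :=
  (UpperHalfPlane.qExpansion 1 (f : ℍ → ℂ)).coeff n / (n : ℂ) ^ (((κ : ℂ) - 1) / 2)

open Classical in
/-- The continuation to an entire function of a function given on `Re s > 1` (it is unique if it
exists; if there is none, the given function is returned). -/
def entireContinuation (F : ℂ → ℂ) : ℂ → ℂ :=
  if h : ∃ G : ℂ → ℂ, Differentiable ℂ G ∧ ∀ s : ℂ, 1 < s.re → G s = F s then h.choose else F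

/-- `L(s, f ⊗ χ_d)`: the continuation of `∑_{n ≥ 1} a_f(n) χ_d(n) n^(-s)` from `Re s > 1`. -/
def twistedL {κ : ℤ} (f : CuspForm 𝒮ℒ κ) (d : ℕ) : ℂ → ℂ :=
  entireContinuation (LSeries fun n => coeffA f n * chi d n)

/-- The factor `𝒳_f(s) = i^κ (2π)^(2s-1) Γ(1 - s + (κ-1)/2) / Γ(s + (κ-1)/2)`. -/
def gammaX (κ : ℤ) (s : ℂ) : ℂ :=
  Complex.I ^ κ * (2 * (Real.pi : ℂ)) ^ (2 * s - 1) *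
    Complex.Gamma (1 - s + ((κ : ℂ) - 1) / 2) / Complex.Gamma (s + ((κ : ℂ) - 1) / 2)

/-! ### The moment and the multiple Dirichlet series -/

open Classical in
/-- The twisted shifted moment
`𝒪_{f,k}(X; S; M) = ∑*_{d ≥ 1} g(d/X) χ_d(M) L(s_1, f ⊗ χ_d) ⋯ L(s_k, f ⊗ χ_d)`, the sum running
over positive fundamental discriminants. -/
def moment {κ : ℤ} (f : CuspForm 𝒮ℒ κ) {k : ℕ} (M : ℕ) (g : ℝ → ℂ) (X : ℝ)
    (s : Fin k → ℂ) : ℂ :=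
  ∑' d : ℕ, if IsPosFundDisc d then
    g ((d : ℝ) / X) * chi d M * ∏ j, twistedL f d (s j) else 0

open Classical in
/-- The multiple Dirichlet series
`A_{f,M}(s_1, …, s_k; w) = ∑*_{d ≥ 1} χ_d(M) L(s_1, f ⊗ χ_d) ⋯ L(s_k, f ⊗ χ_d) / d^w`. -/
def mds {κ : ℤ} (f : CuspForm 𝒮ℒ κ) {k : ℕ} (M : ℕ) (s : Fin k → ℂ) (w : ℂ) : ℂ :=
  ∑' d : ℕ, if IsPosFundDisc d then
    chi d M * (∏ j, twistedL f d (s j)) / (d : ℂ) ^ w else 0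

/-- `σ_J(w) = w + 2 ∑_{j ∈ J} s_j - |J|`. -/
def sigma {k : ℕ} (J : Finset (Fin k)) (s : Fin k → ℂ) (w : ℂ) : ℂ :=
  w + 2 * ∑ j ∈ J, s j - (J.card : ℂ)

/-- `s^J`: the tuple `s` with `s_j` replaced by `1 - s_j` for `j ∈ J`, i.e. `S ∖ S_J ∪ S_J⁻`. -/
def reflect {k : ℕ} (J : Finset (Fin k)) (s : Fin k → ℂ) : Fin k → ℂ :=
  fun j => if j ∈ J then 1 - s j else s j

/-- `∏_{J ⊆ {1,…,k}} (σ_J(w) - 1) · A_{f,M}(s_1, …, s_k; w)` as a function of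
`z = (s_1, …, s_k, w)`. -/
def clearedMds {κ : ℤ} (f : CuspForm 𝒮ℒ κ) (k M : ℕ) (z : Fin (k + 1) → ℂ) : ℂ :=
  (∏ J : Finset (Fin k), (sigma J (fun j => z j.castSucc) (z (Fin.last k)) - 1)) *
    mds f M (fun j => z j.castSucc) (z (Fin.last k))

/-! ### Tube domains and the conjecture on the multiple Dirichlet series -/

/-- The tube `V + iℝⁿ` over a set `V ⊆ ℝⁿ`. -/
def tube {n : ℕ} (V : Set (Fin n → ℝ)) : Set (Fin n → ℂ) := {z | (fun i => (z i).re) ∈ V}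

/-- Polynomial boundedness in vertical strips of a function on the tube over `V`: for every box
`[a_1, b_1] × ⋯ × [a_n, b_n]` contained in `V` there is a polynomial `P` with
`|F(σ + it)| ≤ |P(t)|` for all `σ` in the box and all real `t`. -/
def PolyBoundedInStrips {n : ℕ} (V : Set (Fin n → ℝ)) (F : (Fin n → ℂ) → ℂ) : Prop :=
  ∀ a b : Fin n → ℝ, Set.Icc a b ⊆ V → ∃ P : MvPolynomial (Fin n) ℝ,
    ∀ z : Fin n → ℂ, (fun i => (z i).re) ∈ Set.Icc a b →
      ‖F z‖ ≤ |MvPolynomial.eval (fun i => (z i).im) P|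

/-- The region `Re s_1 > 1, …, Re s_k > 1, Re w > 1` in which the multiple Dirichlet series
converges absolutely. -/
def convergenceRegion (n : ℕ) : Set (Fin n → ℂ) := {z | ∀ i, 1 < (z i).re}

/-- The conjecture on the multiple Dirichlet series: `∏_J (σ_J(w) - 1) · A_{f,M}(s; w)` has a
holomorphic continuation (from the region of absolute convergence) to a tube domain, that is, a
tube over a connected open set, which contains `(1/2, …, 1/2, 1)`, and this continuation is
polynomially bounded in vertical strips there. -/
def MDSConjecture {κ : ℤ} (f : CuspForm 𝒮ℒ κ) (k M : ℕ) : Prop :=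
  ∃ (V : Set (Fin (k + 1) → ℝ)) (F : (Fin (k + 1) → ℂ) → ℂ),
    IsOpen V ∧ IsConnected V ∧
    (Fin.snoc (fun _ => 1 / 2) 1 : Fin (k + 1) → ℝ) ∈ V ∧
    (tube V ∩ convergenceRegion (k + 1)).Nonempty ∧
    DifferentiableOn ℂ F (tube V) ∧
    Set.EqOn F (clearedMds f k M) (tube V ∩ convergenceRegion (k + 1)) ∧
    PolyBoundedInStrips V F

/-! ### The recipe prediction -/

/-- `a(n) = ∏_{p ∣ n} p / (p + 1)`. -/
def arithA (n : ℕ) : ℂ := ∏ p ∈ n.primeFactors, (p : ℂ) / ((p : ℂ) + 1)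

open Classical in
/-- The series
`H_{f,M}(S) = 1/(2ζ(2)) ∑_{M n_1 ⋯ n_k = □} a_f(n_1) ⋯ a_f(n_k) a(M n_1 ⋯ n_k) / (n_1^{s_1} ⋯ n_k^{s_k})`
over positive integers `n_1, …, n_k`. -/
def seriesH {κ : ℤ} (f : CuspForm 𝒮ℒ κ) {k : ℕ} (M : ℕ) (s : Fin k → ℂ) : ℂ :=
  1 / (2 * riemannZeta 2) * ∑' n : Fin k → ℕ+,
    if IsSquare (M * ∏ j, (n j : ℕ)) then
      (∏ j, coeffA f (n j)) * arithA (M * ∏ j, (n j : ℕ)) / ∏ j, ((n j : ℕ) : ℂ) ^ s j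
    else 0

/-- `h` is meromorphic on `U`: near every point of `U` it is a quotient `p / q` of analytic
functions with `q` not identically zero near the point (where `q` vanishes, the value of `h` is
not constrained). -/
def IsMeromorphicOn {n : ℕ} (h : (Fin n → ℂ) → ℂ) (U : Set (Fin n → ℂ)) : Prop :=
  ∀ z ∈ U, ∃ p q : (Fin n → ℂ) → ℂ, AnalyticAt ℂ p z ∧ AnalyticAt ℂ q z ∧
    (¬ ∀ᶠ x in nhds z, q x = 0) ∧ ∀ᶠ x in nhds z, q x ≠ 0 → h x = p x / q x

/-- The sum over `J ⊆ {1,…,k}` of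
`∏_{j ∈ J} 𝒳_f(s_j) · X^{1+|J|-2∑_J s_j} · g̃(1+|J|-2∑_J s_j) · h(S ∖ S_J ∪ S_J⁻)`, where `g̃` is the
Mellin transform of `g`. -/
def recipeSum (κ : ℤ) {k : ℕ} (h : (Fin k → ℂ) → ℂ) (g : ℝ → ℂ) (X : ℝ) (s : Fin k → ℂ) : ℂ :=
  ∑ J : Finset (Fin k), (∏ j ∈ J, gammaX κ (s j)) *
    (X : ℂ) ^ (1 + (J.card : ℂ) - 2 * ∑ j ∈ J, s j) *
    mellin g (1 + (J.card : ℂ) - 2 * ∑ j ∈ J, s j) * h (reflect J s)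

/-- The recipe prediction with a power-saving error term.

* `h` is the meromorphic continuation of `H_{f,M}` from `Re s_j > 1` to `Re s_j > 1/2 - ε`.
* The individual terms of the prediction may have poles which cancel in the sum; `R X` is the sum as
  a holomorphic function on `|Re s_j - 1/2| < ε`, equal to the sum of the terms at every point at
  which `h` is analytic at all the arguments `s^J` (a dense set).
* The asymptotic formula holds for `|Re s_j - 1/2| ≤ C / log X`, uniformly for imaginary parts in a
  bounded set, with an exponent `1 - δ` that depends neither on `g` nor on `C` and `B`. -/
def RecipeWithPowerSaving {κ : ℤ} (f : CuspForm 𝒮ℒ κ) (k M : ℕ) : Prop :=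
  ∃ (ε : ℝ) (h : (Fin k → ℂ) → ℂ), 0 < ε ∧
    IsMeromorphicOn h {s | ∀ j, 1 / 2 - ε < (s j).re} ∧
    (∀ s : Fin k → ℂ, (∀ j, 1 < (s j).re) → h s = seriesH f M s) ∧
    ∃ δ : ℝ, 0 < δ ∧ ∀ g : ℝ → ℂ, ContDiff ℝ ∞ g → HasCompactSupport g →
      ∃ R : ℝ → (Fin k → ℂ) → ℂ,
        (∀ X : ℝ, 0 < X →
          DifferentiableOn ℂ (R X) {s | ∀ j, |(s j).re - 1 / 2| < ε} ∧
          ∀ s : Fin k → ℂ, (∀ j, |(s j).re - 1 / 2| < ε) →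
            (∀ J : Finset (Fin k), AnalyticAt ℂ h (reflect J s)) →
              R X s = recipeSum κ h g X s) ∧
        ∀ C B : ℝ, ∃ K X₀ : ℝ, ∀ X : ℝ, X₀ ≤ X → ∀ s : Fin k → ℂ,
          (∀ j, |(s j).re - 1 / 2| ≤ C / Real.log X) → (∀ j, |(s j).im| ≤ B) →
            ‖moment f M g X s - R X s‖ ≤ K * X ^ (1 - δ)

end QuadTwist

end

/-! The moment is a Perron-type integral of `A(s; w) X^w g̃(w)` over a vertical line far to the
right. Moving the line to the left of `Re w = 1` picks up one residue for each `J`, at `σ_J(w) = 1`.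
These residues are the terms of the recipe, and the integral that remains is `O(X^(1-δ))`. The work
lies in reaching a neighbourhood of `(1/2, …, 1/2, 1)` with growth control, and in identifying the
residues.

Continuation. The twisted functional equations relate values of `A` with `s` near `1/2`, where the
Dirichlet series converges only for `Re w` large (`exists_norm_twistedL_le`,
`exists_mdsMajorized_farDomain`). The hypothesis gives a continuation over some connected base,
whose relation to that far region is unknown. Bochner's tube theorem joins the two, in a
quantitative form. After multiplication by a decaying weight, the function is the Laplace transform
of a single `u`, computed on any vertical space over the base (`TubeDecay.invLaplace_eq`,
`TubeDecay.laplace_invLaplace`). The set of real parts where that Laplace transform converges with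
exponential room is convex (`convex_laplaceDomain`), and the transform is bounded over compact sets
of real parts. Dividing the weight out gives `exists_isContinuation`: a continuation over a convex
base containing the base point, the region of convergence and the far region, with only polynomial
growth in `Im w`. Convexity then yields a whole quadrant `Re s_j > 1/2 - ε`, `Re w > 1 - ε`
(`IsContinuation.exists_quadrant`).

Residues. For `Re s_j > 1` the residue at `w = 1` is `H`, because `χ_d(N)` has mean value
`a(N)/(2ζ(2))` over fundamental discriminants when `N` is a square and `0` otherwise
(`tendsto_discSeries`, `tendsto_mds`). The functional equation of `L(s, f ⊗ χ_d)` has conductor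
`d²`, so reflecting the variables in `J` changes `w` to `σ_J(w)` and permutes the polar divisors by
symmetric difference (`sigma_reflect`, `mds_reflect`). By the identity theorem this persists near
the base point (`IsQuadrantContinuation.functional`), so the residue at `σ_J(w) = 1` is `∏ 𝒳_f(s_j)
· H(s^J)` up to the Mellin factor.

Conclusion. `R_X` is defined as the difference of the integrals over the two lines. Neither line
meets a pole, so `R_X` is holomorphic in `s` even where the individual residues blow up. Where the
poles are distinct, partial fractions and the residue theorem identify it with the recipe
(`IsQuadrantContinuation.perron_sub_eq_recipeSum`). Coinciding poles are reached by continuity along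
a generic line. The error term is the left-hand integral (`IsQuadrantContinuation.norm_perron_le`).
-/

noncomputable section

namespace QuadTwist

open MeasureTheory Filter Set Metric Topology

/-! ### Integrals depending holomorphically on a parameter -/

/-- A family of functions is locally dominated on `U` if near every point of `U` it is bounded by a
fixed integrable function. -/
def LocallyDominated {E α : Type*} [PseudoMetricSpace E] [MeasurableSpace α] (μ : Measure α)
    (U : Set E) (Φ : E → α → ℂ) : Prop :=
  ∀ z ∈ U, ∃ r > 0, ∃ b : α → ℝ, Integrable b μ ∧ ∀ x ∈ ball z r, x ∈ U → ∀ a, ‖Φ x a‖ ≤ b a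

/-- In finite dimension `L a` is a fixed linear combination of dual basis vectors with coefficients
`L a (b i)`, so measurability can be tested on vectors. -/
theorem aestronglyMeasurable_clm_of_apply {E α : Type*} [NormedAddCommGroup E] [NormedSpace ℂ E]
    [FiniteDimensional ℂ E] [MeasurableSpace α] {μ : Measure α} {L : α → E →L[ℂ] ℂ}
    (h : ∀ v, AEStronglyMeasurable (fun a => L a v) μ) : AEStronglyMeasurable L μ := by
  let b := Module.finBasis ℂ E
  have hL : L = fun a => ∑ i, (L a (b i)) • (LinearMap.toContinuousLinearMap (b.coord i)) := by
    funext a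
    ext v
    have hv : L a v = L a (∑ i, b.repr v i • b i) := by rw [b.sum_repr]
    rw [hv, map_sum]
    simp [mul_comm]
  rw [hL]
  refine Finset.aestronglyMeasurable_fun_sum _ fun i _ => ?_
  exact (h (b i)).smul_const (LinearMap.toContinuousLinearMap (b.coord i))

/-- No bound on the derivative has to be assumed: the Schwarz lemma turns the bound `b a` on a ball
of radius `r` into the Lipschitz bound `2 b a / r` at the centre, which is what differentiation
under the integral needs. It serves integrals over vertical spaces and, with counting measure,
Dirichlet series. -/
theorem differentiableOn_integral {E α : Type*} [NormedAddCommGroup E] [NormedSpace ℂ E]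
    [FiniteDimensional ℂ E] [MeasurableSpace α] {μ : Measure α} {U : Set E} (hU : IsOpen U)
    {Φ : E → α → ℂ} (hd : ∀ a, DifferentiableOn ℂ (fun z => Φ z a) U)
    (hm : ∀ z ∈ U, AEStronglyMeasurable (Φ z) μ) (hdom : LocallyDominated μ U Φ) :
    DifferentiableOn ℂ (fun z => ∫ a, Φ z a ∂μ) U := by
  intro z hz
  obtain ⟨r₁, hr₁, b, hb, hbound⟩ := hdom z hz
  obtain ⟨r₂, hr₂, hball⟩ := Metric.isOpen_iff.1 hU z hz
  set r := min r₁ r₂ with hr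
  have hr0 : 0 < r := lt_min hr₁ hr₂
  have hsub : ball z r ⊆ U := (ball_subset_ball (min_le_right _ _)).trans hball
  have hbd : ∀ x ∈ ball z r, ∀ a, ‖Φ x a‖ ≤ b a := fun x hx a =>
    hbound x (ball_subset_ball (min_le_left _ _) hx) (hsub hx) a
  have hzr : z ∈ ball z r := mem_ball_self hr0
  have hda : ∀ a, HasFDerivAt (fun x => Φ x a) (fderiv ℂ (fun x => Φ x a) z) z := fun a =>
    ((hd a).differentiableAt (hU.mem_nhds hz)).hasFDerivAt
  have hmeas : AEStronglyMeasurable (fun a => fderiv ℂ (fun x => Φ x a) z) μ := by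
    refine aestronglyMeasurable_clm_of_apply fun v => ?_
    -- The derivative is a pointwise limit of difference quotients, hence measurable. The increments
    -- `v / ((n+1)K)` with `K > ‖v‖/r` all stay in the ball.
    obtain ⟨K, hK⟩ := exists_nat_gt (‖v‖ / r)
    have hK0 : (0 : ℝ) < K := lt_of_le_of_lt (by positivity) hK
    let c : ℕ → ℂ := fun n => ((n : ℂ) + 1) * K
    have hcn : ∀ n, ‖c n‖ = ((n : ℝ) + 1) * K := fun n => by
      have : c n = (((n : ℝ) + 1) * K : ℝ) := by push_cast; rfl
      rw [this, Complex.norm_real, Real.norm_of_nonneg (by positivity)]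
    have hc : Tendsto (fun n => ‖c n‖) atTop atTop := by
      simp only [hcn]
      exact (tendsto_atTop_add_const_right _ _ tendsto_natCast_atTop_atTop).atTop_mul_const hK0
    refine aestronglyMeasurable_of_tendsto_ae atTop
      (f := fun n a => c n • (Φ (z + (c n)⁻¹ • v) a - Φ z a)) (fun n => ?_)
      (Eventually.of_forall fun a => (hda a).lim v hc)
    suffices hx : z + (c n)⁻¹ • v ∈ ball z r from
      ((hm _ (hsub hx)).sub (hm z hz)).const_smul (c n)
    rw [mem_ball, dist_eq_norm, add_sub_cancel_left, norm_smul, norm_inv, hcn, inv_mul_lt_iff₀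
      (by positivity)]
    rw [div_lt_iff₀ hr0] at hK
    have : (K : ℝ) * r ≤ ((n : ℝ) + 1) * K * r := by
      have : (0 : ℝ) ≤ n * (K * r) := by positivity
      nlinarith
    linarith
  refine (hasFDerivAt_integral_of_dominated_loc_of_lip' (bound := fun a => 2 * b a / r)
    (F := Φ) (F' := fun a => fderiv ℂ (fun x => Φ x a) z) (ball_mem_nhds z hr0)
    (fun x hx => hm x (hsub hx)) ?_ hmeas ?_ ?_
    (Eventually.of_forall hda)).2.differentiableAt.differentiableWithinAt
  · exact hb.mono' (hm z hz) (Eventually.of_forall fun a => hbd z hzr a)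
  · refine Eventually.of_forall fun a x hx => ?_
    have := Complex.dist_le_div_mul_dist_of_mapsTo_ball (f := fun x => Φ x a) (c := z) (R₁ := r)
      (R₂ := 2 * b a) ((hd a).mono hsub) (fun y hy => ?_) hx
    · simpa only [dist_eq_norm] using this
    · rw [mem_closedBall, dist_eq_norm]
      refine (norm_sub_le _ _).trans ?_
      linarith [hbd y hy a, hbd z hzr a]
  · exact (hb.const_mul 2).div_const r

/-- Cauchy's theorem without contours: the integral is holomorphic in `z`, and moving `z` vertically
only translates the integration variable, so its derivative in the direction `i` vanishes and with
it the complex derivative. The group `α` is left general so that the same argument moves lines in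
`ℂ` and vertical spaces in `ℂⁿ`. -/
theorem integral_eq_of_vertical_translation {α : Type*} [MeasurableSpace α] [AddGroup α]
    [MeasurableAdd α] {μ : Measure α} [μ.IsAddRightInvariant] {p q : ℝ} {Φ : ℂ → α → ℂ}
    {τ : ℝ → α}
    (hd : ∀ a, DifferentiableOn ℂ (fun z => Φ z a) {z | p < z.re ∧ z.re < q})
    (hm : ∀ z, p < z.re → z.re < q → AEStronglyMeasurable (Φ z) μ)
    (hdom : LocallyDominated μ {z : ℂ | p < z.re ∧ z.re < q} Φ)
    (htr : ∀ z, ∀ η : ℝ, ∀ a, Φ (z + η * Complex.I) a = Φ z (a + τ η))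
    {z₁ z₂ : ℂ} (h₁ : p < z₁.re ∧ z₁.re < q) (h₂ : p < z₂.re ∧ z₂.re < q) :
    ∫ a, Φ z₁ a ∂μ = ∫ a, Φ z₂ a ∂μ := by
  set S : Set ℂ := {z | p < z.re ∧ z.re < q} with hS
  have hSo : IsOpen S :=
    (isOpen_lt continuous_const Complex.continuous_re).inter
      (isOpen_lt Complex.continuous_re continuous_const)
  have hSc : Convex ℝ S :=
    (convex_halfSpace_re_gt p).inter (convex_halfSpace_re_lt q)
  have hdiff := differentiableOn_integral hSo hd (fun z hz => hm z hz.1 hz.2) hdom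
  refine hSo.is_const_of_deriv_eq_zero hSc.isPreconnected hdiff (fun z hz => ?_) h₁ h₂
  have hz' := (hdiff.differentiableAt (hSo.mem_nhds hz)).hasDerivAt
  set φ := fun z => ∫ a, Φ z a ∂μ with hφ
  have hconst : ∀ η : ℝ, φ (z + η * Complex.I) = φ z := fun η => by
    simp only [hφ, htr]
    exact integral_add_right_eq_self (fun a => Φ z a) (τ η)
  have hline : HasDerivAt (fun η : ℝ => z + η * Complex.I) Complex.I 0 := by
    simpa using ((Complex.ofRealCLM.hasDerivAt (x := (0 : ℝ))).mul_const Complex.I).const_add z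
  have hz0 : HasDerivAt φ (deriv φ z) (z + ((0 : ℝ) : ℂ) * Complex.I) := by simpa using hz'
  have h1 : HasDerivAt (φ ∘ fun η : ℝ => z + η * Complex.I) (deriv φ z * Complex.I) 0 :=
    hz0.comp (0 : ℝ) hline
  have h2 : HasDerivAt (φ ∘ fun η : ℝ => z + η * Complex.I) 0 (0 : ℝ) := by
    have : (φ ∘ fun η : ℝ => z + η * Complex.I) = fun _ => φ z := funext fun η => hconst η
    rw [this]
    exact hasDerivAt_const _ _
  have := h1.unique h2
  simpa using this

/-! ### Shifting vertical lines of integration -/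

/-- A bounded shift of the imaginary part costs only a constant factor, so decay at one point gives
a majorant valid nearby. -/
theorem one_add_sq_le_mul (t τ A : ℝ) (h : |τ| ≤ A) :
    1 / (1 + (t + τ) ^ 2) ≤ 2 * (1 + A ^ 2) * (1 / (1 + t ^ 2)) := by
  rw [mul_one_div, div_le_div_iff₀ (by positivity) (by positivity)]
  have hA : τ ^ 2 ≤ A ^ 2 := by
    rw [← sq_abs τ]; exact pow_le_pow_left₀ (abs_nonneg _) h 2
  nlinarith [sq_nonneg (t + 2 * τ), mul_nonneg (sq_nonneg A) (sq_nonneg (t + τ)),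
    sq_nonneg (t + τ)]

/-- Decay like `1 / (1 + t²)` on vertical lines, locally uniformly in the open strip
`p < Re w < q`. -/
def StripDecay (p q : ℝ) (Q : ℂ → ℂ) : Prop :=
  ∀ x y : ℝ, p < x → y < q → ∃ C, ∀ w : ℂ, x ≤ w.re → w.re ≤ y → ‖Q w‖ ≤ C * (1 / (1 + w.im ^ 2))

theorem isOpen_strip (p q : ℝ) : IsOpen {w : ℂ | p < w.re ∧ w.re < q} :=
  (isOpen_lt continuous_const Complex.continuous_re).inter
    (isOpen_lt Complex.continuous_re continuous_const)

theorem integrable_one_div_one_add_sq : Integrable fun t : ℝ => 1 / (1 + t ^ 2) := by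
  simpa only [one_div] using integrable_inv_one_add_sq

theorem continuous_vertical {p q : ℝ} {Q : ℂ → ℂ}
    (hQ : DifferentiableOn ℂ Q {w | p < w.re ∧ w.re < q}) {z : ℂ} (h : p < z.re ∧ z.re < q) :
    Continuous fun t : ℝ => Q (z + t * Complex.I) := by
  refine hQ.continuousOn.comp_continuous (by fun_prop) fun t => ?_
  simpa using h

theorem StripDecay.integrable {p q : ℝ} {Q : ℂ → ℂ} (hQ : DifferentiableOn ℂ Q {w | p < w.re ∧ w.re < q})
    (hdec : StripDecay p q Q) {x : ℝ} (hx : p < x) (hx' : x < q) :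
    Integrable fun t : ℝ => Q (x + t * Complex.I) := by
  obtain ⟨C, hC⟩ := hdec x x hx hx'
  refine (integrable_one_div_one_add_sq.const_mul C).mono'
    (continuous_vertical hQ (by simpa using ⟨hx, hx'⟩)).aestronglyMeasurable
    (Eventually.of_forall fun t => ?_)
  simpa using hC (x + t * Complex.I) (by simp) (by simp)

theorem StripDecay.integral_eq {p q : ℝ} {Q : ℂ → ℂ}
    (hQ : DifferentiableOn ℂ Q {w | p < w.re ∧ w.re < q})
    (hdec : StripDecay p q Q) {x y : ℝ} (hx : p < x ∧ x < q) (hy : p < y ∧ y < q) :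
    ∫ t : ℝ, Q (x + t * Complex.I) = ∫ t : ℝ, Q (y + t * Complex.I) := by
  refine integral_eq_of_vertical_translation (α := ℝ) (μ := volume) (p := p) (q := q)
    (Φ := fun z t => Q (z + t * Complex.I)) (τ := fun η => η) (z₁ := (x : ℂ)) (z₂ := (y : ℂ)) (fun t => ?_) (fun z hz hz' => ?_)
    (fun z hz => ?_) (fun z η t => ?_) (by simpa using hx) (by simpa using hy)
  · refine hQ.comp (by fun_prop) fun z hz => ?_
    simpa using hz
  · exact (continuous_vertical hQ ⟨hz, hz'⟩).aestronglyMeasurable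
  · obtain ⟨hz1, hz2⟩ := hz
    obtain ⟨C, hC⟩ := hdec ((p + z.re) / 2) ((z.re + q) / 2) (by linarith) (by linarith)
    refine ⟨min ((z.re - p) / 2) ((q - z.re) / 2), lt_min (by linarith) (by linarith),
      fun t => |C| * (2 * (1 + (|z.im| + (q - p)) ^ 2) * (1 / (1 + t ^ 2))),
      (integrable_one_div_one_add_sq.const_mul _).const_mul _, fun w hw _ t => ?_⟩
    rw [mem_ball, dist_eq_norm] at hw
    have hre := (Complex.abs_re_le_norm (w - z)).trans_lt hw
    have him := (Complex.abs_im_le_norm (w - z)).trans_lt hw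
    rw [lt_min_iff, Complex.sub_re, abs_lt] at hre
    rw [lt_min_iff, Complex.sub_im] at him
    refine (hC _ ?_ ?_).trans ?_
    · simp; linarith [hre.1.1]
    · simp; rw [abs_lt] at hre; linarith [hre.2.2]
    · simp only [Complex.add_im, Complex.mul_im, Complex.ofReal_re, Complex.I_im, mul_one,
        Complex.ofReal_im, Complex.I_re, mul_zero, add_zero]
      rw [add_comm w.im t]
      refine mul_le_mul (le_abs_self C) (one_add_sq_le_mul t w.im _ ?_) (by positivity)
        (abs_nonneg _)
      have : |w.im| ≤ |w.im - z.im| + |z.im| := by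
        simpa using abs_add_le (w.im - z.im) z.im
      linarith [him.1]
  · congr 1
    push_cast
    ring

/-! ### The residue of a simple pole -/

/-- Write `1/(a+it) = ∫₀^∞ e^{-(a+it)y} dy` and exchange the integrals. The inner Gaussian integral
is `√π e^{-y²/4}`, whose integral over the half-line is `π`. -/
theorem integral_exp_sq_div {a : ℝ} (ha : 0 < a) :
    ∫ t : ℝ, Complex.exp ((a + t * Complex.I) ^ 2) / (a + t * Complex.I) = Real.pi := by
  have hre : ∀ t : ℝ, (-((a : ℂ) + t * Complex.I)).re < 0 := fun t => by simpa using ha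
  have h1 : ∀ t : ℝ, Complex.exp ((a + t * Complex.I) ^ 2) / (a + t * Complex.I) =
      ∫ y : ℝ in Ioi 0, Complex.exp ((a + t * Complex.I) ^ 2) *
        Complex.exp (-(a + t * Complex.I) * y) := fun t => by
    rw [integral_const_mul, integral_exp_mul_complex_Ioi (hre t)]
    simp only [Complex.ofReal_zero, mul_zero, Complex.exp_zero]
    rw [neg_div_neg_eq, mul_one_div]
  simp_rw [h1]
  rw [integral_integral_swap]
  · have h2 : ∀ y : ℝ, ∫ t : ℝ, Complex.exp ((a + t * Complex.I) ^ 2) *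
        Complex.exp (-(a + t * Complex.I) * y) =
        ((Real.sqrt Real.pi * Real.exp (-(1 / 4) * y ^ 2) : ℝ) : ℂ) := fun y => by
      have := integral_cexp_quadratic (b := -1) (by simp) (Complex.I * (2 * a - y))
        ((a : ℂ) ^ 2 - a * y)
      have e : ∀ t : ℝ, Complex.exp ((a + t * Complex.I) ^ 2) *
          Complex.exp (-(a + t * Complex.I) * y) =
          Complex.exp (-1 * (t : ℂ) ^ 2 + Complex.I * (2 * a - y) * t + ((a : ℂ) ^ 2 - a * y)) :=
        fun t => by
        rw [← Complex.exp_add]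
        congr 1
        linear_combination (t : ℂ) ^ 2 * Complex.I_sq
      simp_rw [e]
      rw [this]
      push_cast
      congr 1
      · rw [Real.sqrt_eq_rpow, neg_neg, div_one, Complex.ofReal_cpow Real.pi_pos.le]
        norm_num
      · congr 1
        linear_combination (1 / 4 : ℂ) * (2 * a - y) ^ 2 * Complex.I_sq
    simp_rw [h2]
    rw [integral_complex_ofReal, integral_const_mul, integral_gaussian_Ioi]
    congr 1
    rw [show Real.pi / (1 / 4) = 2 ^ 2 * Real.pi by ring, Real.sqrt_mul (by positivity),
      Real.sqrt_sq (by norm_num)]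
    rw [mul_div_assoc', mul_left_comm, Real.mul_self_sqrt Real.pi_pos.le]
    ring
  · have hA : Integrable (fun t : ℝ => Real.exp (a ^ 2) * Real.exp (-1 * t ^ 2)) :=
      (integrable_exp_neg_mul_sq one_pos).const_mul _
    have hB : Integrable (fun y : ℝ => Real.exp (-a * y)) (volume.restrict (Ioi 0)) :=
      integrableOn_exp_mul_Ioi (by linarith) 0
    refine (hA.mul_prod hB).mono' (by fun_prop) (Eventually.of_forall fun x => ?_)
    simp only [Function.uncurry, norm_mul, Complex.norm_exp]
    rw [← Real.exp_add, ← Real.exp_add, ← Real.exp_add]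
    refine (Real.exp_le_exp.2 (le_of_eq ?_))
    simp [pow_two]
    ring

theorem StripDecay.of_gaussian (p q : ℝ) (w₀ : ℂ) :
    StripDecay p q fun w => Complex.exp ((w - w₀) ^ 2) := by
  intro x y _ _
  refine ⟨Real.exp ((|x - w₀.re| + |y - w₀.re|) ^ 2) * (2 * (1 + |w₀.im| ^ 2)), fun w h₁ h₂ => ?_⟩
  rw [Complex.norm_exp]
  have hre : ((w - w₀) ^ 2).re = (w.re - w₀.re) ^ 2 - (w.im - w₀.im) ^ 2 := by
    simp [pow_two]
  rw [hre, sub_eq_add_neg, Real.exp_add, mul_assoc]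
  refine mul_le_mul (Real.exp_le_exp.2 ?_) ?_ (Real.exp_pos _).le (Real.exp_pos _).le
  · refine sq_le_sq' ?_ ?_
    · linarith [neg_abs_le (x - w₀.re), abs_nonneg (y - w₀.re)]
    · linarith [le_abs_self (y - w₀.re), abs_nonneg (x - w₀.re)]
  · refine le_trans ?_ (one_add_sq_le_mul w.im (-w₀.im) |w₀.im| (by rw [abs_neg]))
    rw [Real.exp_neg, one_div, ← sub_eq_add_neg]
    refine inv_anti₀ (by positivity) ?_
    linarith [Real.add_one_le_exp ((w.im - w₀.im) ^ 2)]

theorem norm_sub_ge_abs_re (w w₀ : ℂ) : |w.re - w₀.re| ≤ ‖w - w₀‖ := by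
  simpa using Complex.abs_re_le_norm (w - w₀)

/-- Within height `1` of `w₀` continuity on a compact rectangle bounds the quotient; beyond it the
denominator has modulus at least `1` and only helps. -/
theorem StripDecay.dslope {p q : ℝ} {N : ℂ → ℂ} (hN : DifferentiableOn ℂ N {w | p < w.re ∧ w.re < q})
    (hdec : StripDecay p q N) {w₀ : ℂ} (hw₀ : p < w₀.re ∧ w₀.re < q) (h0 : N w₀ = 0) :
    StripDecay p q (dslope N w₀) := by
  intro x y hx hy
  obtain ⟨C, hC⟩ := hdec x y hx hy
  have hcont : ContinuousOn (_root_.dslope N w₀) {w | p < w.re ∧ w.re < q} :=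
    ((Complex.differentiableOn_dslope ((isOpen_strip p q).mem_nhds hw₀)).2 hN).continuousOn
  have hK : IsCompact (Icc x y ×ℂ Icc (w₀.im - 1) (w₀.im + 1)) :=
    isCompact_Icc.reProdIm isCompact_Icc
  obtain ⟨D, hD⟩ := hK.exists_bound_of_continuousOn (hcont.mono fun w hw => by
    rw [Complex.mem_reProdIm] at hw
    exact ⟨hx.trans_le hw.1.1, hw.1.2.trans_lt hy⟩)
  refine ⟨|C| + |D| * (1 + (|w₀.im| + 1) ^ 2), fun w h₁ h₂ => ?_⟩
  have hpos : 0 < 1 + w.im ^ 2 := by positivity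
  rw [mul_one_div, le_div_iff₀ hpos]
  by_cases hw : |w.im - w₀.im| ≤ 1
  · rw [abs_le] at hw
    have hb := hD w (by
      rw [Complex.mem_reProdIm]; exact ⟨⟨h₁, h₂⟩, by linarith [hw.1], by linarith [hw.2]⟩)
    have him : |w.im| ≤ |w₀.im| + 1 := by
      have := abs_add_le (w.im - w₀.im) w₀.im
      rw [sub_add_cancel] at this
      linarith [abs_le.2 hw]
    have : w.im ^ 2 ≤ (|w₀.im| + 1) ^ 2 := by
      rw [← sq_abs w.im]; exact pow_le_pow_left₀ (abs_nonneg _) him 2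
    calc ‖_root_.dslope N w₀ w‖ * (1 + w.im ^ 2) ≤ |D| * (1 + (|w₀.im| + 1) ^ 2) :=
          mul_le_mul (hb.trans (le_abs_self D)) (by linarith) hpos.le (abs_nonneg _)
      _ ≤ _ := by linarith [abs_nonneg C]
  · push Not at hw
    have hnorm : 1 ≤ ‖w - w₀‖ := hw.le.trans (by simpa using Complex.abs_im_le_norm (w - w₀))
    have hne : w ≠ w₀ := by
      rintro rfl
      simp at hnorm
      linarith
    rw [dslope_of_ne _ hne, slope_def_field, h0, sub_zero, norm_div]
    have h3 := hC w h₁ h₂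
    rw [mul_one_div, le_div_iff₀ hpos] at h3
    calc ‖N w‖ / ‖w - w₀‖ * (1 + w.im ^ 2) ≤ ‖N w‖ * (1 + w.im ^ 2) := by
          gcongr
          exact div_le_self (norm_nonneg _) hnorm
      _ ≤ |C| := h3.trans (le_abs_self C)
      _ ≤ _ := by
        have : 0 ≤ |D| * (1 + (|w₀.im| + 1) ^ 2) := by positivity
        linarith

theorem integral_exp_sq_sub_div {w₀ : ℂ} {b : ℝ} (hb : w₀.re < b) :
    ∫ t : ℝ, Complex.exp ((b + t * Complex.I - w₀) ^ 2) / (b + t * Complex.I - w₀) = Real.pi := by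
  rw [← integral_exp_sq_div (sub_pos.2 hb), ← integral_add_right_eq_self _ w₀.im]
  congr 1
  funext t
  have : (b : ℂ) + ((t + w₀.im : ℝ) : ℂ) * Complex.I - w₀ =
      ((b - w₀.re : ℝ) : ℂ) + t * Complex.I := by
    apply Complex.ext <;> simp
  rw [this]

/-- The symmetry `w ↦ -w` exchanges the two sides of the pole and changes the sign of the odd
integrand. -/
theorem integral_exp_sq_sub_div_of_lt {w₀ : ℂ} {a : ℝ} (ha : a < w₀.re) :
    ∫ t : ℝ, Complex.exp ((a + t * Complex.I - w₀) ^ 2) / (a + t * Complex.I - w₀) = -Real.pi := by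
  have hlt : (-w₀).re < -a := by simpa using ha
  rw [← integral_exp_sq_sub_div hlt, ← integral_neg, ← integral_neg_eq_self]
  congr 1
  funext t
  have : (a : ℂ) + ((-t : ℝ) : ℂ) * Complex.I - w₀ =
      -(((-a : ℝ) : ℂ) + t * Complex.I - (-w₀)) := by
    push_cast; ring
  rw [this, neg_sq, div_neg]

/-- The residue theorem for a simple pole between two vertical lines. -/
theorem StripDecay.integral_div_sub {p q : ℝ} {Q : ℂ → ℂ}
    (hQ : DifferentiableOn ℂ Q {w | p < w.re ∧ w.re < q}) (hdec : StripDecay p q Q) {w₀ : ℂ}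
    {a b : ℝ} (hpa : p < a) (ha : a < w₀.re) (hb : w₀.re < b) (hbq : b < q) :
    (∫ t : ℝ, Q (b + t * Complex.I) / (b + t * Complex.I - w₀)) -
      ∫ t : ℝ, Q (a + t * Complex.I) / (a + t * Complex.I - w₀) = 2 * Real.pi * Q w₀ := by
  set E : ℂ → ℂ := fun w => Complex.exp ((w - w₀) ^ 2) with hE
  have hEd : Differentiable ℂ E := by fun_prop
  -- `E(w) / (w - w₀)` carries the whole pole with coefficient `Q w₀`. What is left, `N / (w - w₀)`,
  -- is holomorphic and decays, hence has equal integrals on the two lines, while the `E` part gives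
  -- `π` on the right and `-π` on the left.
  set N : ℂ → ℂ := fun w => Q w - Q w₀ * E w with hNdef
  have hNd : DifferentiableOn ℂ N {w | p < w.re ∧ w.re < q} :=
    hQ.sub (hEd.const_mul _).differentiableOn
  have hN0 : N w₀ = 0 := by simp [hNdef, hE]
  have hNdec : StripDecay p q N := by
    intro x y hx hy
    obtain ⟨C, hC⟩ := hdec x y hx hy
    obtain ⟨D, hD⟩ := StripDecay.of_gaussian p q w₀ x y hx hy
    refine ⟨C + ‖Q w₀‖ * D, fun w h₁ h₂ => (norm_sub_le _ _).trans ?_⟩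
    rw [add_mul, norm_mul, mul_assoc]
    exact add_le_add (hC w h₁ h₂) (mul_le_mul_of_nonneg_left (hD w h₁ h₂) (norm_nonneg _))
  have hw₀ : p < w₀.re ∧ w₀.re < q := ⟨hpa.trans ha, hb.trans hbq⟩
  have hGd : DifferentiableOn ℂ (_root_.dslope N w₀) {w | p < w.re ∧ w.re < q} :=
    (Complex.differentiableOn_dslope ((isOpen_strip p q).mem_nhds hw₀)).2 hNd
  have hGdec := hNdec.dslope hNd hw₀ hN0
  have key : ∀ x : ℝ, p < x → x < q → x ≠ w₀.re →
      ∫ t : ℝ, Q (x + t * Complex.I) / (x + t * Complex.I - w₀) =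
        (∫ t : ℝ, _root_.dslope N w₀ (x + t * Complex.I)) +
          Q w₀ * ∫ t : ℝ, E (x + t * Complex.I) / (x + t * Complex.I - w₀) := by
    intro x hx hx' hne
    have hne' : ∀ t : ℝ, (x : ℂ) + t * Complex.I - w₀ ≠ 0 := fun t h => by
      have := congrArg Complex.re h
      simp at this
      exact hne (by linarith)
    rw [← integral_const_mul, ← integral_add (hGdec.integrable hGd hx hx')]
    · congr 1
      funext t
      rw [dslope_of_ne _ (sub_ne_zero.1 (hne' t)), slope_def_field, hN0, sub_zero]
      have := hne' t
      simp only [hNdef]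
      field_simp
      ring
    · refine Integrable.const_mul ?_ _
      refine (((StripDecay.of_gaussian p q w₀).integrable hEd.differentiableOn hx hx').norm.div_const
        |x - w₀.re|).mono' ?_ (Eventually.of_forall fun t => ?_)
      · refine Continuous.aestronglyMeasurable ?_
        exact Continuous.div (hEd.continuous.comp (by fun_prop)) (by fun_prop) hne'
      · rw [norm_div]
        have h4 : |x - w₀.re| ≤ ‖(x : ℂ) + t * Complex.I - w₀‖ := by
          simpa using norm_sub_ge_abs_re ((x : ℂ) + t * Complex.I) w₀
        have : 0 < |x - w₀.re| := abs_pos.2 (sub_ne_zero.2 hne)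
        gcongr
  rw [key b (by linarith) hbq hb.ne', key a hpa (by linarith) ha.ne,
    hGdec.integral_eq hGd (x := b) (y := a) ⟨by linarith, hbq⟩ ⟨hpa, by linarith⟩]
  simp only [hE]
  rw [integral_exp_sq_sub_div hb, integral_exp_sq_sub_div_of_lt ha]
  ring

end QuadTwist
end

noncomputable section

namespace QuadTwist

open MeasureTheory Filter Set Metric Topology
open scoped FourierTransform

/-! ### Laplace transforms of functions on tubes -/

variable {n : ℕ}

theorem integrable_prod_euclidean {b : ℝ → ℝ} (hb : Integrable b) :
    Integrable fun t : EuclideanSpace ℝ (Fin n) => ∏ i, b (t i) := by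
  have h := Integrable.fintype_prod (ι := Fin n) (f := fun _ => b) (μ := fun _ => volume)
    (fun _ => hb)
  have hp := PiLp.volume_preserving_ofLp (Fin n)
  exact (hp.integrable_comp_emb (MeasurableEquiv.measurableEmbedding
    (MeasurableEquiv.toLp 2 (Fin n → ℝ)).symm)).2 h

/-- The point `σ + i t`. -/
def tubePoint (σ : Fin n → ℝ) (t : EuclideanSpace ℝ (Fin n)) : Fin n → ℂ :=
  fun i => (σ i : ℂ) + (t i : ℂ) * Complex.I

theorem tubePoint_re (σ : Fin n → ℝ) (t : EuclideanSpace ℝ (Fin n)) :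
    (fun i => (tubePoint σ t i).re) = σ := by
  funext i; simp [tubePoint]

theorem continuous_tubePoint (σ : Fin n → ℝ) : Continuous (tubePoint σ) := by
  unfold tubePoint; fun_prop

theorem isOpen_tube {V : Set (Fin n → ℝ)} (hV : IsOpen V) : IsOpen (tube V) :=
  hV.preimage (by fun_prop)

/-- Decay like `∏ 1 / (1 + t_i²)` in imaginary directions, locally uniformly in the tube over `U`. -/
def TubeDecay (U : Set (Fin n → ℝ)) (G : (Fin n → ℂ) → ℂ) : Prop :=
  ∀ σ ∈ U, ∃ r > 0, ∃ C, ∀ z : Fin n → ℂ, (fun i => (z i).re) ∈ ball σ r →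
    ‖G z‖ ≤ C * ∏ i, 1 / (1 + (z i).im ^ 2)

/-- The function whose Laplace transform is `G`, computed on the vertical space over `σ`. -/
def invLaplace (G : (Fin n → ℂ) → ℂ) (σ : Fin n → ℝ) (v : EuclideanSpace ℝ (Fin n)) : ℂ :=
  ∫ t : EuclideanSpace ℝ (Fin n),
    G (tubePoint σ t) * Complex.exp (2 * Real.pi * ∑ i, tubePoint σ t i * v i)

/-- The Laplace transform of `u`. -/
def laplace (u : EuclideanSpace ℝ (Fin n) → ℂ) (z : Fin n → ℂ) : ℂ :=
  ∫ v : EuclideanSpace ℝ (Fin n), u v * Complex.exp (-(2 * Real.pi * ∑ i, z i * v i))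

/-- The real parts `σ` for which `u v * exp (-2π σ·v)` decays exponentially. -/
def laplaceDomain (u : EuclideanSpace ℝ (Fin n) → ℂ) : Set (Fin n → ℝ) :=
  {σ | ∃ r > 0, ∃ C, 0 ≤ C ∧ ∀ v, ‖u v‖ ≤ C * Real.exp (2 * Real.pi * ∑ i, σ i * v i - r * ∑ i, |v i|)}

theorem continuous_tube_section {U : Set (Fin n → ℝ)} {G : (Fin n → ℂ) → ℂ}
    (hG : DifferentiableOn ℂ G (tube U)) {σ : Fin n → ℝ} (hσ : σ ∈ U) :
    Continuous fun t => G (tubePoint σ t) :=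
  hG.continuousOn.comp_continuous (continuous_tubePoint σ) fun t => by
    rw [tube, mem_ofPred_eq, tubePoint_re]; exact hσ

theorem prod_one_add_sq_le (t τ : Fin n → ℝ) (A : ℝ) (h : ∀ i, |τ i| ≤ A) :
    ∏ i, 1 / (1 + (t i + τ i) ^ 2) ≤ (2 * (1 + A ^ 2)) ^ n * ∏ i, 1 / (1 + t i ^ 2) := by
  have : (2 * (1 + A ^ 2)) ^ n = ∏ _i : Fin n, (2 * (1 + A ^ 2)) := by simp
  rw [this, ← Finset.prod_mul_distrib]
  exact Finset.prod_le_prod (fun i _ => by positivity) fun i _ => one_add_sq_le_mul _ _ _ (h i)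

theorem TubeDecay.integrable {U : Set (Fin n → ℝ)} {G : (Fin n → ℂ) → ℂ}
    (hG : DifferentiableOn ℂ G (tube U)) (hdec : TubeDecay U G) {σ : Fin n → ℝ} (hσ : σ ∈ U) :
    Integrable fun t => G (tubePoint σ t) := by
  obtain ⟨r, hr, C, hC⟩ := hdec σ hσ
  refine ((integrable_prod_euclidean integrable_one_div_one_add_sq).const_mul C).mono'
    (continuous_tube_section hG hσ).aestronglyMeasurable (Eventually.of_forall fun t => ?_)
  have := hC (tubePoint σ t) (by rw [tubePoint_re]; exact mem_ball_self hr)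
  simpa [tubePoint] using this

theorem norm_cexp_two_pi_sum (z : Fin n → ℂ) (v : EuclideanSpace ℝ (Fin n)) :
    ‖Complex.exp (2 * Real.pi * ∑ i, z i * v i)‖ =
      Real.exp (2 * Real.pi * ∑ i, (z i).re * v i) := by
  rw [Complex.norm_exp]
  congr 1
  have : (2 * (Real.pi : ℂ)) = ((2 * Real.pi : ℝ) : ℂ) := by push_cast; rfl
  rw [this, Complex.re_ofReal_mul, Complex.re_sum]
  simp

theorem norm_cexp_neg_two_pi_sum (z : Fin n → ℂ) (v : EuclideanSpace ℝ (Fin n)) :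
    ‖Complex.exp (-(2 * Real.pi * ∑ i, z i * v i))‖ =
      Real.exp (-(2 * Real.pi * ∑ i, (z i).re * v i)) := by
  rw [Complex.exp_neg, norm_inv, norm_cexp_two_pi_sum, Real.exp_neg]

/-- The segment from `σ` to `σ'` is complexified: the real part of the parameter moves along it, and
the imaginary part translates `t`. So the vertical translation principle applies. -/
theorem TubeDecay.invLaplace_eq_of_mem_ball {U : Set (Fin n → ℝ)}
    {G : (Fin n → ℂ) → ℂ} (hG : DifferentiableOn ℂ G (tube U)) {σ : Fin n → ℝ} {r C : ℝ}
    (hrU : ball σ r ⊆ U)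
    (hC : ∀ z : Fin n → ℂ, (fun i => (z i).re) ∈ ball σ r → ‖G z‖ ≤ C * ∏ i, 1 / (1 + (z i).im ^ 2))
    {σ' : Fin n → ℝ} (hσ' : σ' ∈ ball σ r) (v : EuclideanSpace ℝ (Fin n)) :
    invLaplace G σ' v = invLaplace G σ v := by
  have hr : 0 < r := pos_of_mem_ball hσ'
  rw [mem_ball, dist_eq_norm] at hσ'
  set δ := σ' - σ with hδ
  -- a strip in which the line through `σ` and `σ'` stays in the ball
  obtain ⟨η, hη, hηr⟩ : ∃ η > 0, (1 + η) * ‖δ‖ < r := by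
    refine ⟨(r - ‖δ‖) / (‖δ‖ + 1), by have := norm_nonneg δ; have := sub_pos.2 hσ'; positivity, ?_⟩
    have h1 : 0 ≤ ‖δ‖ := norm_nonneg δ
    rw [add_mul, one_mul, div_mul_eq_mul_div, ← lt_sub_iff_add_lt', div_lt_iff₀ (by positivity)]
    nlinarith [sub_pos.2 hσ']
  have hball : ∀ x : ℝ, -η < x → x < 1 + η → σ + x • δ ∈ ball σ r := fun x h1 h2 => by
    rw [mem_ball, dist_eq_norm, add_sub_cancel_left, norm_smul, Real.norm_eq_abs]
    refine lt_of_le_of_lt (mul_le_mul_of_nonneg_right ?_ (norm_nonneg _)) hηr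
    rw [abs_le]; constructor <;> linarith
  let P : ℂ → EuclideanSpace ℝ (Fin n) → Fin n → ℂ := fun ζ t i =>
    (σ i : ℂ) + ζ * δ i + (t i : ℂ) * Complex.I
  have hPre : ∀ ζ t, (fun i => (P ζ t i).re) = σ + ζ.re • δ := fun ζ t => by
    funext i; simp [P]
  have hPd : ∀ t, Differentiable ℂ fun ζ => P ζ t := fun t => by
    rw [differentiable_pi]; intro i; simp only [P]; fun_prop
  have hPc : ∀ ζ, Continuous (P ζ) := fun ζ => by
    simp only [P]; fun_prop
  let Ψ : (Fin n → ℂ) → ℂ := fun z => G z * Complex.exp (2 * Real.pi * ∑ i, z i * v i)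
  have hΨ : DifferentiableOn ℂ Ψ (tube U) := hG.mul (by fun_prop)
  have hmaps : ∀ t, MapsTo (fun ζ => P ζ t) {z : ℂ | -η < z.re ∧ z.re < 1 + η} (tube U) :=
    fun t ζ hζ => by
    rw [tube, mem_ofPred_eq, hPre]; exact hrU (hball _ hζ.1 hζ.2)
  have h0 : invLaplace G σ v = ∫ t, Ψ (P ((0 : ℝ) : ℂ) t) := by
    have hP : ∀ t, P ((0 : ℝ) : ℂ) t = tubePoint σ t := fun t => by
      funext i; simp [P, tubePoint]
    simp only [invLaplace, Ψ, hP]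
  have h1 : invLaplace G σ' v = ∫ t, Ψ (P ((1 : ℝ) : ℂ) t) := by
    have hP : ∀ t, P ((1 : ℝ) : ℂ) t = tubePoint σ' t := fun t => by
      funext i; simp [P, tubePoint, hδ]
    simp only [invLaplace, Ψ, hP]
  rw [h0, h1]
  refine integral_eq_of_vertical_translation (p := -η) (q := 1 + η)
    (Φ := fun ζ t => Ψ (P ζ t)) (τ := fun x => WithLp.toLp 2 (x • δ)) (fun t => ?_)
    (fun ζ h1 h2 => ?_) (fun ζ hζ => ?_) (fun ζ x t => ?_) (by simp; constructor <;> linarith)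
    (by simp; constructor <;> linarith)
  · exact hΨ.comp (hPd t).differentiableOn (hmaps t)
  · exact (hΨ.continuousOn.comp_continuous (hPc ζ)
      fun t => hmaps t ⟨h1, h2⟩).aestronglyMeasurable
  -- With `v` fixed the exponential factor depends only on the real part, which stays in a bounded
  -- set, so the decay of `G` alone gives the majorant.
  · obtain ⟨D, hD⟩ : ∃ D, ∀ τ ∈ ball σ r, Real.exp (2 * Real.pi * ∑ i, τ i * v i) ≤ D := by
      have hcont : Continuous fun τ : Fin n → ℝ => Real.exp (2 * Real.pi * ∑ i, τ i * v i) := by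
        fun_prop
      obtain ⟨D, hD⟩ := (isCompact_closedBall σ r).exists_bound_of_continuousOn hcont.continuousOn
      refine ⟨D, fun τ hτ => ?_⟩
      simpa [abs_of_pos (Real.exp_pos _)] using hD τ (ball_subset_closedBall hτ)
    have hD0 : 0 ≤ D := (Real.exp_pos _).le.trans (hD σ (mem_ball_self hr))
    set A := (‖ζ‖ + 1) * ‖δ‖ with hA
    refine ⟨1, one_pos, fun t => |C| * ((2 * (1 + A ^ 2)) ^ n * ∏ i, 1 / (1 + t i ^ 2)) * D,
      (((integrable_prod_euclidean integrable_one_div_one_add_sq).const_mul _).const_mul _).mul_const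
        _, fun w hw hwS t => ?_⟩
    have hmem : (fun i => (P w t i).re) ∈ ball σ r := by rw [hPre]; exact hball _ hwS.1 hwS.2
    have hw1 : ‖w‖ ≤ ‖ζ‖ + 1 := by
      have := norm_sub_norm_le w ζ
      rw [mem_ball, dist_eq_norm] at hw
      linarith
    simp only [Ψ]
    rw [norm_mul, norm_cexp_two_pi_sum]
    refine mul_le_mul ((hC _ hmem).trans ?_) (hD _ hmem) (Real.exp_pos _).le (by positivity)
    have him : ∀ i, (P w t i).im = t i + w.im * δ i := fun i => by simp [P, add_comm]
    simp_rw [him]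
    refine mul_le_mul (le_abs_self C) (prod_one_add_sq_le _ _ A fun i => ?_)
      (Finset.prod_nonneg fun i _ => by positivity) (abs_nonneg C)
    rw [abs_mul]
    exact mul_le_mul ((Complex.abs_im_le_norm w).trans hw1) (norm_le_pi_norm δ i) (abs_nonneg _)
      (by positivity)
  · congr 1
    funext i
    simp [P]
    ring

/-- Local constancy plus connectedness. Only the subset `K` has to be connected, since the sets
where uniform growth holds need not be. -/
theorem TubeDecay.invLaplace_eq {U : Set (Fin n → ℝ)} (hU : IsOpen U) {G : (Fin n → ℂ) → ℂ}
    (hG : DifferentiableOn ℂ G (tube U)) (hdec : TubeDecay U G) {K : Set (Fin n → ℝ)}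
    (hKU : K ⊆ U) (hK : IsPreconnected K) {σ σ' : Fin n → ℝ} (hσ : σ ∈ K) (hσ' : σ' ∈ K) :
    invLaplace G σ = invLaplace G σ' := by
  have : PreconnectedSpace K := isPreconnected_iff_preconnectedSpace.1 hK
  have hlc : IsLocallyConstant fun s : K => invLaplace G (s : Fin n → ℝ) := by
    rw [IsLocallyConstant.iff_eventually_eq]
    intro s
    obtain ⟨r, hr, C, hC⟩ := hdec s (hKU s.2)
    obtain ⟨r', hr', hball⟩ := Metric.isOpen_iff.1 hU s (hKU s.2)
    have hmem : ∀ᶠ y : K in 𝓝 s, (y : Fin n → ℝ) ∈ ball (s : Fin n → ℝ) (min r r') :=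
      continuous_subtype_val.continuousAt.eventually (ball_mem_nhds _ (lt_min hr hr'))
    filter_upwards [hmem] with y hy
    funext v
    exact TubeDecay.invLaplace_eq_of_mem_ball hG
      ((ball_subset_ball (min_le_right _ _)).trans hball)
      (fun z hz => hC z (ball_subset_ball (min_le_left _ _) hz)) hy v
  exact hlc.apply_eq_of_isPreconnected isPreconnected_univ (x := ⟨σ, hσ⟩) (y := ⟨σ', hσ'⟩)
    (mem_univ _) (mem_univ _)

/-- Up to an explicit exponential this is an inverse Fourier transform, which gives continuity in
`v` and access to Fourier inversion. -/
theorem invLaplace_eq_fourierInv (G : (Fin n → ℂ) → ℂ) (σ : Fin n → ℝ)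
    (v : EuclideanSpace ℝ (Fin n)) :
    invLaplace G σ v =
      Complex.exp (2 * Real.pi * ∑ i, σ i * v i) * 𝓕⁻ (fun t => G (tubePoint σ t)) v := by
  rw [Real.fourierInv_eq', ← integral_const_mul]
  unfold invLaplace
  congr 1
  funext t
  have : (2 * Real.pi * ∑ i, tubePoint σ t i * v i : ℂ) =
      2 * Real.pi * ∑ i, (σ i : ℂ) * v i + ((2 * Real.pi * inner ℝ t v : ℝ) : ℂ) * Complex.I := by
    simp only [tubePoint, add_mul, Finset.sum_add_distrib, PiLp.inner_apply]
    push_cast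
    rw [mul_add, mul_assoc _ _ Complex.I, Finset.sum_mul]
    congr 2
    refine Finset.sum_congr rfl fun i _ => ?_
    simp
    ring
  rw [this, Complex.exp_add, smul_eq_mul]
  push_cast
  ring

theorem continuous_invLaplace {U : Set (Fin n → ℝ)} {G : (Fin n → ℂ) → ℂ}
    (hG : DifferentiableOn ℂ G (tube U)) (hdec : TubeDecay U G) {σ : Fin n → ℝ} (hσ : σ ∈ U) :
    Continuous (invLaplace G σ) := by
  have h1 : invLaplace G σ = fun v =>
      Complex.exp (2 * Real.pi * ∑ i, σ i * v i) * 𝓕⁻ (fun t => G (tubePoint σ t)) v :=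
    funext fun v => invLaplace_eq_fourierInv G σ v
  rw [h1]
  refine Continuous.mul (by fun_prop) ?_
  have h2 : Continuous (𝓕 fun t => G (tubePoint σ t)) :=
    VectorFourier.fourierIntegral_continuous Real.continuous_fourierChar
      (by exact continuous_inner) (hdec.integrable hG hσ)
  have h3 : (𝓕⁻ fun t => G (tubePoint σ t)) = fun v => 𝓕 (fun t => G (tubePoint σ t)) (-v) :=
    funext fun v => Real.fourierInv_eq_fourier_neg _ v
  rw [h3]
  exact h2.comp continuous_neg

/-- The real part may be moved by `r/2` in each coordinate against the sign of `v i` without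
changing the integral. This gains the factor `e^{-πr ∑|v i|}`. -/
theorem TubeDecay.mem_laplaceDomain {U : Set (Fin n → ℝ)} (hU : IsOpen U) {G : (Fin n → ℂ) → ℂ}
    (hG : DifferentiableOn ℂ G (tube U)) (hdec : TubeDecay U G) {σ : Fin n → ℝ} (hσ : σ ∈ U) :
    σ ∈ laplaceDomain (invLaplace G σ) := by
  obtain ⟨r₁, hr₁, C, hC⟩ := hdec σ hσ
  obtain ⟨r₂, hr₂, hball⟩ := Metric.isOpen_iff.1 hU σ hσ
  set r := min r₁ r₂ with hr
  have hr0 : 0 < r := lt_min hr₁ hr₂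
  have hC' : ∀ z : Fin n → ℂ, (fun i => (z i).re) ∈ ball σ r →
      ‖G z‖ ≤ C * ∏ i, 1 / (1 + (z i).im ^ 2) :=
    fun z hz => hC z (ball_subset_ball (min_le_left _ _) hz)
  set J : ℝ := ∫ t : EuclideanSpace ℝ (Fin n), ∏ i, 1 / (1 + t i ^ 2) with hJ
  have hJ0 : 0 ≤ J := integral_nonneg fun t => Finset.prod_nonneg fun i _ => by positivity
  refine ⟨2 * Real.pi * (r / 2), by positivity, |C| * J, by positivity, fun v => ?_⟩
  -- The shift depends on `v`; all these shifts stay in the one ball where `G` is controlled, so the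
  -- constants do not depend on `v`.
  let s : Fin n → ℝ := fun i => if 0 ≤ v i then -(r / 2) else r / 2
  have hs : ∀ i, s i * v i = -(r / 2 * |v i|) := fun i => by
    by_cases h : 0 ≤ v i
    · simp [s, h, abs_of_nonneg h]
    · simp [s, h, abs_of_neg (not_le.1 h)]
  have hmem : σ + s ∈ ball σ r := by
    rw [mem_ball, dist_eq_norm, add_sub_cancel_left]
    refine lt_of_le_of_lt ((pi_norm_le_iff_of_nonneg (by positivity)).2 fun i => ?_)
      (half_lt_self hr0)
    by_cases h : 0 ≤ v i <;> simp [s, h, abs_of_pos hr0]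
  rw [← TubeDecay.invLaplace_eq_of_mem_ball hG
    ((ball_subset_ball (min_le_right _ _)).trans hball) hC' hmem v]
  have hexp : 2 * Real.pi * ∑ i, (σ i) * v i - 2 * Real.pi * (r / 2) * ∑ i, |v i| =
      2 * Real.pi * ∑ i, (σ + s) i * v i := by
    simp only [Pi.add_apply, add_mul, hs, Finset.sum_add_distrib, Finset.sum_neg_distrib,
      ← Finset.mul_sum]
    ring
  rw [hexp]
  unfold invLaplace
  refine (norm_integral_le_of_norm_le (((integrable_prod_euclidean
    integrable_one_div_one_add_sq).const_mul |C|).mul_const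
    (Real.exp (2 * Real.pi * ∑ i, (σ + s) i * v i))) (Eventually.of_forall fun t => ?_)).trans_eq ?_
  · rw [norm_mul, norm_cexp_two_pi_sum]
    have h1 := hC' (tubePoint (σ + s) t) (by rw [tubePoint_re]; exact hmem)
    have h2 : ∀ i, (tubePoint (σ + s) t i).re = (σ + s) i := fun i => by simp [tubePoint]
    have h3 : ∀ i, (tubePoint (σ + s) t i).im = t i := fun i => by simp [tubePoint]
    simp_rw [h3] at h1
    simp_rw [h2]
    refine mul_le_mul_of_nonneg_right (h1.trans ?_) (Real.exp_pos _).le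
    exact mul_le_mul_of_nonneg_right (le_abs_self C)
      (Finset.prod_nonneg fun i _ => by positivity)
  · rw [integral_mul_const, integral_const_mul]

theorem exp_neg_mul_sum (r : ℝ) (v : EuclideanSpace ℝ (Fin n)) :
    Real.exp (-(r * ∑ i, |v i|)) = ∏ i, Real.exp (-r * |v i|) := by
  rw [← Real.exp_sum, Finset.mul_sum, ← Finset.sum_neg_distrib]
  simp

theorem integrable_exp_neg_mul_abs {r : ℝ} (hr : 0 < r) :
    Integrable fun x : ℝ => Real.exp (-r * |x|) := by
  have h₁ : IntegrableOn (fun x : ℝ => Real.exp (-r * |x|)) (Ioi 0) :=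
    (integrableOn_exp_mul_Ioi (by linarith : -r < 0) 0).congr_fun
      (fun x hx => by simp only [abs_of_pos (mem_Ioi.1 hx)]) measurableSet_Ioi
  have h₂ : IntegrableOn (fun x : ℝ => Real.exp (-r * |x|)) (Iic 0) :=
    (integrableOn_exp_mul_Iic hr 0).congr_fun
      (fun x hx => by simp [abs_of_nonpos (mem_Iic.1 hx)]) measurableSet_Iic
  have := h₂.union h₁
  rwa [Iic_union_Ioi, integrableOn_univ] at this

theorem integrable_exp_neg_mul_sum {r : ℝ} (hr : 0 < r) :
    Integrable fun v : EuclideanSpace ℝ (Fin n) => Real.exp (-(r * ∑ i, |v i|)) := by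
  simp_rw [exp_neg_mul_sum]
  exact integrable_prod_euclidean (integrable_exp_neg_mul_abs hr)

theorem laplaceDomain_ball {u : EuclideanSpace ℝ (Fin n) → ℂ} {σ : Fin n → ℝ}
    (hσ : σ ∈ laplaceDomain u) : ∃ r > 0, ∃ C, 0 ≤ C ∧ ∀ z : Fin n → ℂ,
      (fun i => (z i).re) ∈ ball σ r → ∀ v,
        ‖u v * Complex.exp (-(2 * Real.pi * ∑ i, z i * v i))‖ ≤
          C * Real.exp (-(r * ∑ i, |v i|)) := by
  obtain ⟨r, hr, C, hC0, hC⟩ := hσ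
  -- A change of the real part by less than `r/(4π)` in each coordinate costs at most half of the
  -- exponential margin `r`; the other half remains.
  refine ⟨min (r / 2) (r / (4 * Real.pi)), by positivity, C, hC0, fun z hz v => ?_⟩
  rw [norm_mul, norm_cexp_neg_two_pi_sum]
  refine (mul_le_mul_of_nonneg_right (hC v) (Real.exp_pos _).le).trans ?_
  rw [mul_assoc, ← Real.exp_add]
  refine mul_le_mul_of_nonneg_left (Real.exp_le_exp.2 ?_) hC0
  have hnn : 0 ≤ ∑ i, |v i| := Finset.sum_nonneg fun i _ => abs_nonneg _
  have h1 : ∑ i, σ i * v i - ∑ i, (z i).re * v i ≤ r / (4 * Real.pi) * ∑ i, |v i| := by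
    rw [← Finset.sum_sub_distrib, Finset.mul_sum]
    refine Finset.sum_le_sum fun i _ => ?_
    rw [← sub_mul]
    refine (le_abs_self _).trans ?_
    rw [abs_mul]
    refine mul_le_mul_of_nonneg_right ?_ (abs_nonneg _)
    have h2 := (dist_le_pi_dist (fun i => (z i).re) σ i).trans (mem_ball.1 hz).le
    rw [Real.dist_eq, abs_sub_comm] at h2
    exact h2.trans (min_le_right _ _)
  have h3 : 2 * Real.pi * (∑ i, σ i * v i - ∑ i, (z i).re * v i) ≤ r / 2 * ∑ i, |v i| := by
    refine (mul_le_mul_of_nonneg_left h1 (by positivity)).trans_eq ?_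
    field_simp
    ring
  have h4 : min (r / 2) (r / (4 * Real.pi)) * ∑ i, |v i| ≤ r / 2 * ∑ i, |v i| :=
    mul_le_mul_of_nonneg_right (min_le_left _ _) hnn
  linarith

theorem isOpen_laplaceDomain (u : EuclideanSpace ℝ (Fin n) → ℂ) : IsOpen (laplaceDomain u) := by
  rw [Metric.isOpen_iff]
  intro σ hσ
  obtain ⟨r, hr, C, hC0, hC⟩ := laplaceDomain_ball hσ
  refine ⟨r, hr, fun σ' hσ' => ⟨r, hr, C, hC0, fun v => ?_⟩⟩
  have h := hC (fun i => (σ' i : ℂ)) (by simpa using hσ') v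
  rw [norm_mul, norm_cexp_neg_two_pi_sum, Real.exp_neg, mul_inv_le_iff₀ (Real.exp_pos _)] at h
  refine h.trans_eq ?_
  simp only [Complex.ofReal_re]
  rw [mul_assoc, ← Real.exp_add]
  congr 2
  ring

/-- This is the heart of the tube theorem: two exponential bounds for `u` imply the bound with the
smaller exponent, and a minimum is at most any convex combination. -/
theorem convex_laplaceDomain (u : EuclideanSpace ℝ (Fin n) → ℂ) : Convex ℝ (laplaceDomain u) := by
  rintro σ ⟨r, hr, C, hC0, hC⟩ σ' ⟨r', hr', C', hC0', hC'⟩ a b ha hb hab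
  refine ⟨min r r', lt_min hr hr', max C C', le_max_of_le_left hC0, fun v => ?_⟩
  have hnn : 0 ≤ ∑ i, |v i| := Finset.sum_nonneg fun i _ => abs_nonneg _
  set x := 2 * Real.pi * ∑ i, σ i * v i - r * ∑ i, |v i| with hx
  set y := 2 * Real.pi * ∑ i, σ' i * v i - r' * ∑ i, |v i| with hy
  have h1 : ‖u v‖ ≤ max C C' * Real.exp (min x y) := by
    rcases le_total x y with h | h
    · rw [min_eq_left h]
      exact (hC v).trans (mul_le_mul_of_nonneg_right (le_max_left _ _) (Real.exp_pos _).le)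
    · rw [min_eq_right h]
      exact (hC' v).trans (mul_le_mul_of_nonneg_right (le_max_right _ _) (Real.exp_pos _).le)
  refine h1.trans (mul_le_mul_of_nonneg_left (Real.exp_le_exp.2 ?_) (le_max_of_le_left hC0))
  have h2 : min x y ≤ a * x + b * y := by
    have := mul_le_mul_of_nonneg_left (min_le_left x y) ha
    have := mul_le_mul_of_nonneg_left (min_le_right x y) hb
    have : min x y = a * min x y + b * min x y := by rw [← add_mul, hab, one_mul]
    linarith
  refine h2.trans ?_
  have h3 : ∑ i, (a • σ + b • σ') i * v i = a * ∑ i, σ i * v i + b * ∑ i, σ' i * v i := by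
    rw [Finset.mul_sum, Finset.mul_sum, ← Finset.sum_add_distrib]
    refine Finset.sum_congr rfl fun i _ => ?_
    simp
    ring
  rw [h3, hx, hy]
  have h4 : min r r' * ∑ i, |v i| ≤ (a * r + b * r') * ∑ i, |v i| := by
    refine mul_le_mul_of_nonneg_right ?_ hnn
    have := mul_le_mul_of_nonneg_left (min_le_left r r') ha
    have := mul_le_mul_of_nonneg_left (min_le_right r r') hb
    have : min r r' = a * min r r' + b * min r r' := by rw [← add_mul, hab, one_mul]
    linarith
  nlinarith

theorem laplace_locally_bounded (u : EuclideanSpace ℝ (Fin n) → ℂ) {σ : Fin n → ℝ}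
    (hσ : σ ∈ laplaceDomain u) : ∃ r > 0, ∃ C, ∀ z : Fin n → ℂ,
      (fun i => (z i).re) ∈ ball σ r → ‖laplace u z‖ ≤ C := by
  obtain ⟨r, hr, C, hC0, hC⟩ := laplaceDomain_ball hσ
  exact ⟨r, hr, _, fun z hz => norm_integral_le_of_norm_le
    ((integrable_exp_neg_mul_sum hr).const_mul C) (Eventually.of_forall fun v => hC z hz v)⟩

theorem laplace_bounded_on_compact (u : EuclideanSpace ℝ (Fin n) → ℂ) {K : Set (Fin n → ℝ)}
    (hK : IsCompact K) (hKT : K ⊆ laplaceDomain u) :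
    ∃ C, ∀ z : Fin n → ℂ, (fun i => (z i).re) ∈ K → ‖laplace u z‖ ≤ C := by
  choose! r hr C hC using fun σ (hσ : σ ∈ laplaceDomain u) => laplace_locally_bounded u hσ
  obtain ⟨S, hSK, hS⟩ := hK.elim_nhds_subcover (fun σ => ball σ (r σ))
    fun σ hσ => ball_mem_nhds σ (hr σ (hKT hσ))
  refine ⟨∑ σ ∈ S, |C σ|, fun z hz => ?_⟩
  obtain ⟨σ, hσS, hσ⟩ := mem_iUnion₂.1 (hS hz)
  exact (hC σ (hKT (hSK σ hσS)) z hσ).trans ((le_abs_self _).trans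
    (Finset.single_le_sum (f := fun σ => |C σ|) (fun _ _ => abs_nonneg _) hσS))

/-- Fourier inversion on the vertical space over `Re z`. The transform is integrable because
membership in `laplaceDomain` gives exponential decay. -/
theorem TubeDecay.laplace_invLaplace {U : Set (Fin n → ℝ)} (hU : IsOpen U)
    {G : (Fin n → ℂ) → ℂ} (hG : DifferentiableOn ℂ G (tube U)) (hdec : TubeDecay U G)
    {z : Fin n → ℂ} (hz : z ∈ tube U) :
    laplace (invLaplace G fun i => (z i).re) z = G z := by
  set σ : Fin n → ℝ := fun i => (z i).re with hσdef
  have hσ : σ ∈ U := hz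
  set g : EuclideanSpace ℝ (Fin n) → ℂ := fun t => G (tubePoint σ t) with hg
  have hgc : Continuous g := continuous_tube_section hG hσ
  have hgi : Integrable g := hdec.integrable hG hσ
  set t₀ : EuclideanSpace ℝ (Fin n) := WithLp.toLp 2 fun i => (z i).im with ht₀
  have hzt : tubePoint σ t₀ = z := by
    funext i
    simp [tubePoint, hσdef, ht₀]
  have hF : ∀ v, 𝓕⁻ g v = invLaplace G σ v * Complex.exp (-(2 * Real.pi * ∑ i, σ i * v i)) :=
    fun v => by
    rw [invLaplace_eq_fourierInv, mul_right_comm, ← Complex.exp_add, add_neg_cancel,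
      Complex.exp_zero, one_mul]
  have hFi : Integrable (𝓕 g) := by
    obtain ⟨r, hr, C, hC0, hC⟩ := laplaceDomain_ball (hdec.mem_laplaceDomain hU hG hσ)
    have h1 : Integrable (𝓕⁻ g) := by
      refine ((integrable_exp_neg_mul_sum hr).const_mul C).mono' ?_
        (Eventually.of_forall fun v => ?_)
      · have : 𝓕⁻ g = fun v => invLaplace G σ v *
            Complex.exp (-(2 * Real.pi * ∑ i, σ i * v i)) := funext hF
        rw [this]
        have := continuous_invLaplace hG hdec hσ
        exact Continuous.aestronglyMeasurable (by fun_prop)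
      · rw [hF]
        push_cast
        refine hC (fun i => (σ i : ℂ)) ?_ v
        simp only [Complex.ofReal_re]
        exact mem_ball_self hr
    have h2 := h1.comp_neg
    refine h2.congr (Eventually.of_forall fun v => ?_)
    simp [Real.fourierInv_eq_fourier_neg]
  have hinv := congrFun (hgc.fourier_fourierInv_eq hgi hFi) t₀
  rw [hg] at hinv
  simp only [hzt] at hinv
  rw [← hinv, Real.fourier_eq']
  unfold laplace
  congr 1
  funext v
  rw [hF, smul_eq_mul, mul_left_comm, ← Complex.exp_add]
  congr 2
  rw [PiLp.inner_apply]
  push_cast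
  have : ∀ i, z i = σ i + t₀ i * Complex.I := fun i => (congrFun hzt i).symm
  simp_rw [this, add_mul, Finset.sum_add_distrib, mul_add, neg_add_rev]
  congr 1
  rw [← neg_mul, ← neg_mul, mul_assoc _ _ Complex.I, Finset.sum_mul, neg_mul, neg_mul, neg_mul]
  congr 2
  refine Finset.sum_congr rfl fun i _ => ?_
  simp
  ring

end QuadTwist
end

noncomputable section

namespace QuadTwist

open MeasureTheory Filter Set Metric Topology

variable {n : ℕ}

/-! ### Analyticity of the Laplace transform -/

/-- The linear form `y ↦ -2π y·v`. -/
def dualForm (v : EuclideanSpace ℝ (Fin n)) : (Fin n → ℂ) →L[ℂ] ℂ :=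
  ∑ i, (-(2 * Real.pi * v i) : ℂ) • ContinuousLinearMap.proj i

theorem dualForm_apply (v : EuclideanSpace ℝ (Fin n)) (y : Fin n → ℂ) :
    dualForm v y = -(2 * Real.pi * ∑ i, y i * v i) := by
  simp only [dualForm, sum_apply, smul_apply,
    ContinuousLinearMap.proj_apply, smul_eq_mul, Finset.mul_sum, ← Finset.sum_neg_distrib]
  exact Finset.sum_congr rfl fun i _ => by ring

theorem norm_dualForm_le (v : EuclideanSpace ℝ (Fin n)) : ‖dualForm v‖ ≤ 2 * Real.pi * ∑ i, |v i| := by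
  refine ContinuousLinearMap.opNorm_le_bound _ (by positivity) fun y => ?_
  rw [dualForm_apply, norm_neg, norm_mul, mul_assoc (2 * Real.pi), Finset.sum_mul]
  have h : ‖(2 * Real.pi : ℂ)‖ = 2 * Real.pi := by
    rw [norm_mul, Complex.norm_real, Complex.norm_ofNat, Real.norm_of_nonneg Real.pi_pos.le]
  rw [h]
  gcongr
  refine (norm_sum_le _ _).trans (Finset.sum_le_sum fun i _ => ?_)
  rw [norm_mul, Complex.norm_real, Real.norm_eq_abs, mul_comm]
  gcongr
  exact norm_le_pi_norm y i

theorem continuous_dualForm : Continuous (dualForm : EuclideanSpace ℝ (Fin n) → _) := by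
  unfold dualForm; fun_prop

/-- The terms of the power series of `exp (y ↦ -2π y·v)`, as multilinear maps. -/
def dualPower (m : ℕ) (v : EuclideanSpace ℝ (Fin n)) : (Fin n → ℂ) [×m]→L[ℂ] ℂ :=
  (ContinuousMultilinearMap.mkPiAlgebraFin ℂ m ℂ).compContinuousLinearMap fun _ => dualForm v

theorem dualPower_apply (m : ℕ) (v : EuclideanSpace ℝ (Fin n)) (y : Fin n → ℂ) :
    dualPower m v (fun _ => y) = dualForm v y ^ m := by
  simp [dualPower]

theorem continuous_dualPower (m : ℕ) : Continuous (dualPower (n := n) m) := by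
  have h : dualPower (n := n) m = fun v =>
      ContinuousMultilinearMap.compContinuousLinearMapContinuousMultilinear ℂ (fun _ : Fin m => Fin n → ℂ)
        (fun _ => ℂ) ℂ (fun _ => dualForm v) (ContinuousMultilinearMap.mkPiAlgebraFin ℂ m ℂ) := rfl
  rw [h]
  have hc : Continuous fun v : EuclideanSpace ℝ (Fin n) => (fun _ : Fin m => dualForm v) :=
    continuous_pi fun _ => continuous_dualForm
  exact ((ContinuousMultilinearMap.compContinuousLinearMapContinuousMultilinear ℂ
    (fun _ : Fin m => Fin n → ℂ) (fun _ => ℂ) ℂ).cont.comp hc).clm_apply continuous_const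

theorem norm_dualPower_le (m : ℕ) (v : EuclideanSpace ℝ (Fin n)) :
    ‖dualPower m v‖ ≤ (2 * Real.pi * ∑ i, |v i|) ^ m := by
  refine (ContinuousMultilinearMap.norm_compContinuousLinearMap_le _ _).trans ?_
  rw [ContinuousMultilinearMap.norm_mkPiAlgebraFin, one_mul, Finset.prod_const, Finset.card_univ,
    Fintype.card_fin]
  exact pow_le_pow_left₀ (norm_nonneg _) (norm_dualForm_le v) m

/-- The power series comes from expanding `exp(-2π y·v)` under the integral sign. Joint analyticity
in all variables is what the meromorphy statement and the identity theorem use later. -/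
theorem analyticAt_laplace {u : EuclideanSpace ℝ (Fin n) → ℂ} (hu : Continuous u) {z : Fin n → ℂ}
    (hz : z ∈ tube (laplaceDomain u)) : AnalyticAt ℂ (laplace u) z := by
  obtain ⟨r, hr, C, hC0, hC⟩ := laplaceDomain_ball hz
  replace hC := hC z (mem_ball_self hr)
  -- For this radius `(2π S ρ)^m / m! = (rS/2)^m / m! ≤ e^{rS/2}`, which uses half of the decay
  -- `e^{-rS}` and leaves an integrable majorant uniform in `m`.
  set ρ : ℝ := r / (4 * Real.pi) with hρ
  have hρ0 : 0 < ρ := by positivity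
  set c : EuclideanSpace ℝ (Fin n) → ℂ := fun v =>
    u v * Complex.exp (-(2 * Real.pi * ∑ i, z i * v i)) with hc
  have hcc : Continuous c := by fun_prop
  set S : EuclideanSpace ℝ (Fin n) → ℝ := fun v => ∑ i, |v i| with hS
  have hS0 : ∀ v, 0 ≤ S v := fun v => Finset.sum_nonneg fun i _ => abs_nonneg _
  have hint : Integrable fun v => C * Real.exp (-(r / 2 * S v)) :=
    (integrable_exp_neg_mul_sum (by positivity)).const_mul C
  set D := ∫ v, C * Real.exp (-(r / 2 * S v)) with hD
  set p : FormalMultilinearSeries ℂ (Fin n → ℂ) ℂ := fun m =>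
    ∫ v, (c v / m.factorial) • dualPower m v with hp
  have hterm : ∀ (m : ℕ) (v : EuclideanSpace ℝ (Fin n)),
      ‖c v‖ / m.factorial * (2 * Real.pi * S v) ^ m * ρ ^ m ≤ C * Real.exp (-(r / 2 * S v)) := fun m v => by
    have h1 := Real.pow_div_factorial_le_exp (x := r / 2 * S v) (by have := hS0 v; positivity) m
    have h2 : (2 * Real.pi * S v) ^ m * ρ ^ m = (r / 2 * S v) ^ m := by
      rw [← mul_pow, hρ]; congr 1; field_simp; ring
    calc _ = ‖c v‖ * ((r / 2 * S v) ^ m / m.factorial) := by rw [mul_assoc, h2]; ring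
      _ ≤ (C * Real.exp (-(r * S v))) * Real.exp (r / 2 * S v) := by
        have := hS0 v
        gcongr
        exact hC v
      _ = _ := by rw [mul_assoc, ← Real.exp_add]; congr 2; ring
  have hQ : ∀ (m : ℕ) (v : EuclideanSpace ℝ (Fin n)), ‖(c v / m.factorial) • dualPower m v‖ ≤
      (ρ ^ m)⁻¹ * (C * Real.exp (-(r / 2 * S v))) := fun m v => by
    rw [← div_eq_inv_mul, le_div_iff₀ (by positivity), norm_smul, norm_div, Complex.norm_natCast]
    refine le_trans ?_ (hterm m v)
    gcongr
    exact norm_dualPower_le m v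
  have hQint : ∀ m : ℕ, Integrable fun v => (c v / m.factorial) • dualPower m v := fun m =>
    (hint.const_mul _).mono' ((hcc.div_const _).smul (continuous_dualPower m)).aestronglyMeasurable
      (Eventually.of_forall (hQ m))
  have hpn : ∀ m, ‖p m‖ * ρ ^ m ≤ D := fun m => by
    have : ‖p m‖ ≤ (ρ ^ m)⁻¹ * D := by
      rw [hD, ← integral_const_mul]
      exact norm_integral_le_of_norm_le (hint.const_mul _) (Eventually.of_forall (hQ m))
    rwa [← div_eq_inv_mul, le_div_iff₀ (by positivity)] at this
  have hpy : ∀ (m : ℕ) (y : Fin n → ℂ), p m (fun _ => y) = ∫ v, c v / m.factorial * dualForm v y ^ m := fun m y => by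
    have h := ContinuousLinearMap.integral_comp_comm
      (ContinuousMultilinearMap.apply ℂ (fun _ : Fin m => Fin n → ℂ) ℂ fun _ => y) (hQint m)
    simp only [hp]
    rw [← ContinuousMultilinearMap.apply_apply (𝕜 := ℂ), ← h]
    refine integral_congr_ae (Eventually.of_forall fun v => ?_)
    simp [dualPower_apply]
  refine ⟨p, ENNReal.ofReal ρ, ?_, by simpa using hρ0, fun {y} hy => ?_⟩
  · have := p.le_radius_of_bound (r := ⟨ρ, hρ0.le⟩) D hpn
    rwa [ENNReal.ofReal, Real.toNNReal_of_nonneg hρ0.le]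
  · have hy' : ‖y‖ < ρ := by
      simpa [edist_zero_right, ← ofReal_norm, ENNReal.ofReal_lt_ofReal_iff hρ0] using hy
    simp_rw [hpy]
    have hb : ∀ (m : ℕ) (v : EuclideanSpace ℝ (Fin n)), ‖c v / m.factorial * dualForm v y ^ m‖ ≤
        (‖y‖ / ρ) ^ m * (C * Real.exp (-(r / 2 * S v))) := fun m v => by
      rw [norm_mul, norm_div, Complex.norm_natCast, norm_pow, div_pow,
        div_mul_eq_mul_div (‖y‖ ^ m),
        le_div_iff₀ (by positivity)]
      have h1 : ‖dualForm v y‖ ≤ (2 * Real.pi * S v) * ‖y‖ :=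
        ((dualForm v).le_opNorm y).trans (by gcongr; exact norm_dualForm_le v)
      calc _ ≤ ‖c v‖ / m.factorial * ((2 * Real.pi * S v) * ‖y‖) ^ m * ρ ^ m := by gcongr
        _ = ‖y‖ ^ m * (‖c v‖ / m.factorial * (2 * Real.pi * S v) ^ m * ρ ^ m) := by rw [mul_pow]; ring
        _ ≤ _ := mul_le_mul_of_nonneg_left (hterm m v) (by positivity)
    have hmeas : ∀ m : ℕ, AEStronglyMeasurable (fun v => c v / m.factorial * dualForm v y ^ m) volume := fun m => by
      have : Continuous fun v : EuclideanSpace ℝ (Fin n) => dualForm v y :=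
        continuous_dualForm.clm_apply continuous_const
      exact Continuous.aestronglyMeasurable (by fun_prop)
    have hI : ∀ m : ℕ, Integrable fun v => c v / m.factorial * dualForm v y ^ m := fun m =>
      (hint.const_mul _).mono' (hmeas m) (Eventually.of_forall (hb m))
    have hgeo : Summable fun m : ℕ => (‖y‖ / ρ) ^ m * D :=
      (summable_geometric_of_lt_one (by positivity) ((div_lt_one hρ0).2 hy')).mul_right D
    have key := hasSum_integral_of_summable_integral_norm hI
      (Summable.of_nonneg_of_le (fun m => integral_nonneg fun v => norm_nonneg _) (fun m => by
        rw [hD, ← integral_const_mul]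
        exact integral_mono (hI m).norm (hint.const_mul _) (hb m)) hgeo)
    convert key using 1
    refine integral_congr_ae (Eventually.of_forall fun v => ?_)
    have he := (NormedSpace.expSeries_div_hasSum_exp (𝔸 := ℂ) (dualForm v y)).mul_left (c v)
    rw [← Complex.exp_eq_exp_ℂ, dualForm_apply] at he
    have h2 : (∑' m : ℕ, c v / m.factorial * dualForm v y ^ m) =
        c v * Complex.exp (-(2 * Real.pi * ∑ i, y i * v i)) := by
      rw [← he.tsum_eq]
      refine tsum_congr fun m => ?_
      rw [dualForm_apply]; ring
    beta_reduce
    rw [h2]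
    simp only [hc]
    rw [mul_assoc (u v), ← Complex.exp_add]
    congr 2
    simp only [Pi.add_apply, add_mul, Finset.sum_add_distrib]
    ring

end QuadTwist
end

noncomputable section

namespace QuadTwist

open scoped NumberTheorySymbols

/-! ### The Kronecker symbol as a Dirichlet character -/

/-- A periodic completely multiplicative function with values in `ℤ` is a Dirichlet character. -/
theorem exists_dirichletCharacter {d : ℕ} (hd : d ≠ 0) (g : ℕ → ℤ) (h1 : g 1 = 1)
    (hmul : ∀ a b, g (a * b) = g a * g b) (hper : ∀ n, g (n % d) = g n)
    (h0 : ∀ n, ¬ n.Coprime d → g n = 0) :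
    ∃ ψ : DirichletCharacter ℂ d, ∀ n : ℕ, ψ n = g n := by
  have : NeZero d := ⟨hd⟩
  have hval : ∀ n : ℕ, g ((n : ZMod d).val) = g n := fun n => by rw [ZMod.val_natCast, hper]
  refine ⟨{ toFun := fun x => (g x.val : ℂ)
            map_one' := ?_
            map_mul' := fun x y => ?_
            map_nonunit' := fun x hx => ?_ }, fun n => ?_⟩
  · have := hval 1
    rw [Nat.cast_one] at this
    rw [this, h1, Int.cast_one]
  · rw [ZMod.val_mul, hper, hmul, Int.cast_mul]
  · rw [h0, Int.cast_zero]
    rwa [← ZMod.isUnit_iff_coprime, ZMod.natCast_zmod_val]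
  · change ((g ((n : ZMod d).val) : ℤ) : ℂ) = g n
    rw [hval]

theorem two_pow_factorization_mul (n : ℕ) (hn : n ≠ 0) :
    ∃ a b : ℕ, n = 2 ^ a * b ∧ Odd b ∧ n.factorization 2 = a ∧ n / 2 ^ n.factorization 2 = b := by
  refine ⟨n.factorization 2, n / 2 ^ n.factorization 2,
    (Nat.ordProj_mul_ordCompl_eq_self n 2).symm, ?_, rfl, rfl⟩
  rw [← Nat.not_even_iff_odd, even_iff_two_dvd]
  exact Nat.not_dvd_ordCompl Nat.prime_two hn

theorem kronecker_of_odd (d : ℤ) {n : ℕ} (hn : Odd n) : kronecker d n = J(d | n) := by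
  have hn0 : n ≠ 0 := hn.pos.ne'
  have h2 : n.factorization 2 = 0 :=
    Nat.factorization_eq_zero_of_not_dvd (by rwa [← even_iff_two_dvd, Nat.not_even_iff_odd])
  simp [kronecker, hn0, h2]

theorem kronecker_of_even_even {d : ℕ} (hd : Even d) {n : ℕ} (hn : Even n) :
    kronecker d n = 0 := by
  unfold kronecker
  split_ifs with h h'
  · exfalso
    rw [Int.natAbs_natCast] at h'
    rw [h'] at hd
    exact absurd hd (by decide)
  · rfl
  · have h2 : n.factorization 2 ≠ 0 :=
      (Nat.prime_two.factorization_pos_of_dvd h (even_iff_two_dvd.1 hn)).ne'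
    have : ZMod.χ₈ ((d : ℤ) : ZMod 8) = 0 := by
      rw [ZMod.χ₈_int_eq_if_mod_eight, if_pos]
      obtain ⟨c, rfl⟩ := hd
      push_cast
      omega
    rw [this, zero_pow h2, zero_mul]

/-- Quadratic reciprocity for the odd part of `n` and the supplementary law at `2` both hold without
sign when `d ≡ 1 mod 4`. -/
theorem kronecker_of_one_mod_four {d : ℕ} (hd : d % 4 = 1) (n : ℕ) :
    kronecker d n = J(n | d) := by
  have hodd : Odd d := Nat.odd_iff.2 (by omega)
  by_cases hn : n = 0
  · subst hn
    by_cases h1 : d = 1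
    · subst h1; simp [kronecker]
    · rw [Nat.cast_zero, jacobiSym.zero_left (by omega)]
      simp [kronecker, h1]
  · obtain ⟨a, b, hab, hb, h1, h2⟩ := two_pow_factorization_mul n hn
    unfold kronecker
    rw [if_neg hn, h2, h1, hab]
    push_cast
    rw [jacobiSym.mul_left, jacobiSym.pow_left, jacobiSym.at_two hodd,
      ← jacobiSym.quadratic_reciprocity_one_mod_four hd hb]

theorem jacobiSym_of_three_mod_four {m : ℕ} (hm : m % 4 = 3) {n : ℕ} (hn : Odd n) :
    J(m | n) = ZMod.χ₄ n * J(n | m) := by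
  have hodd : Odd m := Nat.odd_iff.2 (by omega)
  rw [jacobiSym.quadratic_reciprocity' hodd hn, qrSign.symm hn hodd, qrSign,
    ZMod.χ₄_nat_three_mod_four hm, jacobiSym.at_neg_one hn]

theorem mulChar_even_eq_zero {q : ℕ} (hq : Even q) (θ : MulChar (ZMod q) ℤ) {n : ℕ} (hn : Even n) :
    θ (n : ZMod q) = 0 := by
  refine θ.map_nonunit fun h => ?_
  rw [ZMod.isUnit_iff_coprime] at h
  exact Nat.not_coprime_of_dvd_of_dvd one_lt_two (even_iff_two_dvd.1 hn) (even_iff_two_dvd.1 hq) h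

/-- The shape of a positive fundamental discriminant `d = q m`, and of its Kronecker symbol. -/
theorem IsPosFundDisc.decomposition {d : ℕ} (hd : IsPosFundDisc d) :
    ∃ (q m : ℕ) (θ : MulChar (ZMod q) ℤ), d = q * m ∧ Odd m ∧ Squarefree m ∧ (∃ e, q = 2 ^ e) ∧
      (∀ n : ℕ, kronecker d n = θ n * J(n | m)) ∧ θ (-1) * J(-1 | m) = 1 ∧
      (q = 1 ∨ 2 ∣ q ∧ ∃ u : ℕ, u ≡ 1 [MOD q / 2] ∧ θ u = -1) := by
  rcases hd with ⟨h4, hsq⟩ | ⟨m, rfl, hm, hsq⟩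
  · refine ⟨1, d, 1, (one_mul d).symm, Nat.odd_iff.2 (by omega), hsq, ⟨0, rfl⟩, fun n => ?_, ?_,
      Or.inl rfl⟩
    · rw [MulChar.one_apply (isUnit_of_subsingleton _), one_mul, kronecker_of_one_mod_four h4]
    · rw [MulChar.one_apply (isUnit_of_subsingleton _), one_mul,
        jacobiSym.at_neg_one (Nat.odd_iff.2 (by omega)), ZMod.χ₄_nat_one_mod_four h4]
  -- For `d = 8c` the 2-part is `χ₈` when `c ≡ 1 mod 4`; when `c ≡ 3`, reciprocity contributes a
  -- `χ₄` and turns it into `χ₈'`. For `d = 4m` with `m ≡ 3` only this `χ₄` appears. The last clause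
  -- of the goal, a `u ≡ 1 mod q/2` with `θ u = -1`, expresses primitivity at `2`.
  rcases hm with hm | hm
  · obtain ⟨c, hc⟩ : 2 ∣ m := by omega
    have hcodd : c % 2 = 1 := by omega
    have hcsq : Squarefree c := hsq.squarefree_of_dvd ⟨2, by rw [hc, mul_comm]⟩
    have hJ : ∀ n : ℕ, Odd n → J(((4 * m : ℕ) : ℤ) | n) = ZMod.χ₈ n * J(c | n) := fun n hn => by
      rw [hc]
      push_cast
      rw [jacobiSym.mul_left, jacobiSym.mul_left, jacobiSym.at_four hn, jacobiSym.at_two hn, one_mul]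
    have hev : Even (4 * m) := ⟨2 * m, by ring⟩
    rcases (by omega : c % 4 = 1 ∨ c % 4 = 3) with h | h
    · refine ⟨8, c, ZMod.χ₈, by omega, Nat.odd_iff.2 hcodd, hcsq, ⟨3, rfl⟩, fun n => ?_, ?_,
        Or.inr ⟨by norm_num, 5, by decide, by decide⟩⟩
      · rcases Nat.even_or_odd n with hn | hn
        · rw [kronecker_of_even_even hev hn, mulChar_even_eq_zero (by decide) _ hn, zero_mul]
        · rw [kronecker_of_odd _ hn, hJ n hn, jacobiSym.quadratic_reciprocity_one_mod_four h hn]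
      · rw [jacobiSym.at_neg_one (Nat.odd_iff.2 hcodd), ZMod.χ₄_nat_one_mod_four h]
        decide
    · refine ⟨8, c, ZMod.χ₈', by omega, Nat.odd_iff.2 hcodd, hcsq, ⟨3, rfl⟩, fun n => ?_, ?_,
        Or.inr ⟨by norm_num, 5, by decide, by decide⟩⟩
      · rcases Nat.even_or_odd n with hn | hn
        · rw [kronecker_of_even_even hev hn, mulChar_even_eq_zero (by decide) _ hn, zero_mul]
        · rw [kronecker_of_odd _ hn, hJ n hn, jacobiSym_of_three_mod_four h hn, ← mul_assoc,
            show ZMod.χ₈' (n : ZMod 8) = ZMod.χ₈ n * ZMod.χ₄ n by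
              have := ZMod.χ₈'_int_eq_χ₄_mul_χ₈ n
              push_cast at this
              rw [this, mul_comm]]
      · rw [jacobiSym.at_neg_one (Nat.odd_iff.2 hcodd), ZMod.χ₄_nat_three_mod_four h]
        decide
  · have hmodd : Odd m := Nat.odd_iff.2 (by omega)
    have hev : Even (4 * m) := ⟨2 * m, by ring⟩
    refine ⟨4, m, ZMod.χ₄, rfl, hmodd, hsq, ⟨2, rfl⟩, fun n => ?_, ?_,
        Or.inr ⟨by norm_num, 3, by decide, by decide⟩⟩
    · rcases Nat.even_or_odd n with hn | hn
      · rw [kronecker_of_even_even hev hn, mulChar_even_eq_zero (by decide) _ hn, zero_mul]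
      · rw [kronecker_of_odd _ hn]
        push_cast
        rw [jacobiSym.mul_left, jacobiSym.at_four hn, one_mul, jacobiSym_of_three_mod_four hm hn]
    · rw [jacobiSym.at_neg_one hmodd, ZMod.χ₄_nat_three_mod_four hm]
      decide

theorem IsPosFundDisc.pos {d : ℕ} (hd : IsPosFundDisc d) : 0 < d := by
  rcases hd with ⟨h, -⟩ | ⟨m, rfl, hm, -⟩ <;> omega

theorem exists_jacobiSym_eq_neg_one {p : ℕ} (hp : p.Prime) (hp2 : p ≠ 2) :
    ∃ a : ℕ, J(a | p) = -1 := by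
  have : Fact p.Prime := ⟨hp⟩
  obtain ⟨x, hx⟩ := FiniteField.exists_nonsquare (F := ZMod p) (by rwa [ZMod.ringChar_zmod_n])
  refine ⟨x.val, ?_⟩
  rw [ZMod.nonsquare_iff_jacobiSym_eq_neg_one]
  simpa using hx

theorem jacobiSym_eq_one_of_modEq {b m : ℕ} (h : b ≡ 1 [MOD m]) : J(b | m) = 1 := by
  rw [jacobiSym.mod_left' (a₂ := 1), jacobiSym.one_left]
  exact (Int.natCast_modEq_iff).2 h

/-- Primitivity holds because for each prime `p ∣ d` there is `b ≡ 1 mod d/p` with `χ_d(b) = -1`,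
built by the Chinese remainder theorem. Evenness holds because `d > 0`. -/
theorem IsPosFundDisc.exists_character {d : ℕ} (hd : IsPosFundDisc d) :
    ∃ ψ : DirichletCharacter ℂ d, ψ.IsPrimitive ∧ ψ (-1) = 1 ∧ ψ.IsQuadratic ∧
      ∀ n : ℕ, ψ n = chi d n := by
  have hdpos := hd.pos
  have : NeZero d := ⟨hdpos.ne'⟩
  obtain ⟨q, m, θ, hdq, hmodd, hmsq, ⟨e, he⟩, hkr, heven, hprim⟩ := hd.decomposition
  have hm0 : m ≠ 0 := hmodd.pos.ne'
  have : NeZero m := ⟨hm0⟩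
  have hqm : q.Coprime m := by
    rw [he]; exact (Nat.coprime_two_left.2 hmodd).pow_left e
  have hq0 : q ≠ 0 := by rw [he]; positivity
  have : NeZero q := ⟨hq0⟩
  set g : ℕ → ℤ := fun n => θ n * J(n | m) with hg
  have hgper : ∀ n, g (n % d) = g n := fun n => by
    have h1 : ((n % d : ℕ) : ZMod q) = n := by
      rw [ZMod.natCast_eq_natCast_iff]
      exact (Nat.mod_modEq n d).of_dvd ⟨m, hdq⟩
    have h2 : J(((n % d : ℕ) : ℤ) | m) = J(n | m) := by
      refine jacobiSym.mod_left' ?_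
      exact (Int.natCast_modEq_iff).2 ((Nat.mod_modEq n d).of_dvd ⟨q, by rw [hdq, mul_comm]⟩)
    simp only [hg, h1, h2]
  obtain ⟨ψ, hψ⟩ := exists_dirichletCharacter hdpos.ne' g (by simp [hg, jacobiSym.one_left])
    (fun a b => by
      simp only [hg]
      push_cast
      rw [map_mul, jacobiSym.mul_left]
      ring) hgper (fun n hn => by
      simp only [hg]
      rw [hdq, Nat.coprime_mul_iff_right, not_and_or] at hn
      rcases hn with hn | hn
      · rw [θ.map_nonunit, zero_mul]
        rwa [ZMod.isUnit_iff_coprime]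
      · rw [(jacobiSym.eq_zero_iff_not_coprime).2, mul_zero]
        simpa using hn)
  have hψchi : ∀ n : ℕ, ψ n = chi d n := fun n => by rw [hψ, chi, hkr]
  refine ⟨ψ, ?_, ?_, ?_, hψchi⟩
  · rw [DirichletCharacter.isPrimitive_def]
    by_contra hne
    obtain ⟨k, hk⟩ := ψ.conductor_dvd_level
    have hk1 : k ≠ 1 := by
      rintro rfl
      rw [mul_one] at hk
      exact hne hk.symm
    obtain ⟨p, hp, l, rfl⟩ := Nat.exists_prime_and_dvd hk1
    have hfac : ψ.FactorsThrough (ψ.conductor * l) :=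
      DirichletCharacter.FactorsThrough.mono ψ ψ.factorsThrough_conductor ⟨l, rfl⟩ ⟨p, by
        refine hk.trans ?_; ring⟩
    set d' := ψ.conductor * l with hd'
    have hdd' : d = p * d' := by refine hk.trans ?_; rw [hd']; ring
    have hfac1 : ∀ b : ℕ, b.Coprime d → b ≡ 1 [MOD d'] → ψ b = 1 := fun b hb hb1 => by
      have h2 := DirichletCharacter.changeLevel_eq_cast_of_dvd' hfac.χ₀ hfac.dvd (a := b)
        (by exact_mod_cast Nat.isCoprime_iff_coprime.2 hb)
      rw [← hfac.eq_changeLevel] at h2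
      have h3 : ((b : ℤ) : ZMod d') = 1 := by
        have := (ZMod.natCast_eq_natCast_iff b 1 d').2 hb1
        simpa using this
      rw [h3, map_one] at h2
      simpa using h2
    -- If the conductor were proper, the character would factor through `d' = d/p` for some prime
    -- `p`, hence be `1` on such a `b`.
    suffices hb : ∃ b : ℕ, b ≡ 1 [MOD d'] ∧ g b = -1 by
      obtain ⟨b, hb1, hb2⟩ := hb
      have hcop : b.Coprime d := by
        by_contra hcon
        have : ψ b = 0 := ψ.map_nonunit (by rwa [ZMod.isUnit_iff_coprime])
        rw [hψ, hb2] at this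
        norm_num at this
      have := hfac1 b hcop hb1
      rw [hψ, hb2] at this
      norm_num at this
    have hpdvd : p ∣ q * m := by rw [← hdq, hdd']; exact ⟨d', rfl⟩
    by_cases hp2 : p = 2
    · subst hp2
      have hpq : 2 ∣ q := (Nat.prime_two.dvd_mul.1 hpdvd).resolve_right
        (by rwa [← even_iff_two_dvd, Nat.not_even_iff_odd])
      rcases hprim with h1 | ⟨-, u, hu, hθu⟩
      · rw [h1] at hpq; norm_num at hpq
      obtain ⟨b, hbq, hbm⟩ := Nat.chineseRemainder hqm u 1
      refine ⟨b, ?_, ?_⟩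
      · obtain ⟨q', rfl⟩ := hpq
        have hd'q : d' = q' * m := by
          have : 2 * d' = 2 * (q' * m) := by rw [← hdd', hdq]; ring
          omega
        rw [hd'q]
        refine (Nat.modEq_and_modEq_iff_modEq_mul
          (Nat.Coprime.of_dvd_left ⟨2, by ring⟩ hqm)).1 ⟨?_, hbm⟩
        rw [Nat.mul_div_cancel_left _ two_pos] at hu
        exact (hbq.of_dvd ⟨2, by ring⟩).trans hu
      · simp only [hg]
        rw [(ZMod.natCast_eq_natCast_iff b u q).2 hbq, hθu, jacobiSym_eq_one_of_modEq hbm, mul_one]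
    · have hpm : p ∣ m := by
        refine (hp.dvd_mul.1 hpdvd).resolve_left fun h => hp2 ?_
        rw [he] at h
        exact (Nat.prime_dvd_prime_iff_eq hp Nat.prime_two).1 (hp.dvd_of_dvd_pow h)
      obtain ⟨m', rfl⟩ := hpm
      have hm' : m' ≠ 0 := fun h => hm0 (by rw [h, mul_zero])
      have hpm' : p.Coprime m' := Nat.coprime_of_squarefree_mul hmsq
      have hpq : p.Coprime q := (Nat.Coprime.of_dvd_right ⟨m', rfl⟩ hqm).symm
      have hd'q : d' = q * m' :=
        Nat.eq_of_mul_eq_mul_left hp.pos (by rw [← hdd', hdq]; ring)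
      -- For odd `p`, take a non-residue mod `p` that is `1` modulo the rest; `m` being squarefree
      -- makes `p` coprime to the rest.
      obtain ⟨a, ha⟩ := exists_jacobiSym_eq_neg_one hp hp2
      obtain ⟨b, hbp, hbd⟩ := Nat.chineseRemainder
        (by rw [hd'q]; exact Nat.Coprime.mul_right hpq hpm' : p.Coprime d') a 1
      refine ⟨b, hbd, ?_⟩
      rw [hd'q] at hbd
      simp only [hg]
      rw [jacobiSym.mul_right' _ hp.ne_zero hm',
        jacobiSym_eq_one_of_modEq (m := m') (hbd.of_dvd ⟨q, by ring⟩),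
        jacobiSym.mod_left' (a₂ := a) ((Int.natCast_modEq_iff).2 hbp), ha,
        (ZMod.natCast_eq_natCast_iff b 1 q).2 (hbd.of_dvd ⟨m', rfl⟩)]
      simp
  · have h1 : ((d - 1 : ℕ) : ZMod d) = -1 := by
      rw [Nat.cast_sub hdpos]; simp
    rw [← h1, hψ]
    have h2 : ((d - 1 : ℕ) : ZMod q) = -1 := by
      rw [Nat.cast_sub hdpos, hdq]; simp
    have h3 : J(((d - 1 : ℕ) : ℤ) | m) = J(-1 | m) := by
      refine jacobiSym.mod_left' ?_
      rw [Int.natCast_sub hdpos, hdq]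
      refine (Int.emod_emod_of_dvd _ (dvd_refl _)).symm.trans ?_
      push_cast
      have : (q : ℤ) * m - 1 = -1 + m * q := by ring
      rw [this, Int.add_mul_emod_self_left, Int.emod_emod_of_dvd _ (dvd_refl _)]
    simp only [hg, h2, h3, heven, Int.cast_one]
  · intro x
    have hx : ψ x = g x.val := by rw [← hψ, ZMod.natCast_zmod_val]
    have htri : g x.val = 0 ∨ g x.val = 1 ∨ g x.val = -1 := by
      by_cases hcop : x.val.Coprime d
      · right
        have hu : IsUnit ((x.val : ZMod d)) := by rwa [ZMod.isUnit_iff_coprime]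
        -- At a unit the value is an integer some positive power of which is `1`.
        have hord : g x.val ∣ 1 := by
          have hpow : ψ (x.val : ZMod d) ^ (Monoid.exponent (ZMod d)ˣ) = 1 := by
            obtain ⟨u, hu⟩ := hu
            rw [← hu, ← map_pow, ← Units.val_pow_eq_pow_val, Monoid.pow_exponent_eq_one]
            simp
          rw [hψ] at hpow
          have hpow' : g x.val ^ (Monoid.exponent (ZMod d)ˣ) = 1 := by exact_mod_cast hpow
          rw [← hpow']
          exact dvd_pow_self _ (Monoid.exponent_ne_zero_of_finite)
        exact Int.isUnit_iff.1 (isUnit_of_dvd_one hord)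
      · left
        have : ψ (x.val : ZMod d) = 0 := ψ.map_nonunit (by rwa [ZMod.isUnit_iff_coprime])
        rw [hψ] at this
        exact_mod_cast this
    rw [hx]
    rcases htri with h | h | h <;> simp [h]

end QuadTwist
end

noncomputable section

namespace QuadTwist

open MeasureTheory Filter Set Topology
open UpperHalfPlane (ofComplex qExpansion)

variable {κ : ℤ}

/-! ### Fourier coefficients of level one cusp forms -/

theorem cuspForm_weight {f : CuspForm 𝒮ℒ κ} (hf : f ≠ 0) : 12 ≤ κ ∧ Even κ := by
  constructor
  · by_contra hlt
    exact hf (rank_zero_iff_forall_zero.1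
      (CuspForm.rank_eq_zero_of_weight_lt_twelve (not_le.1 hlt)) f)
  · by_contra hodd
    rw [Int.not_even_iff_odd] at hodd
    refine hf (CuspForm.toModularFormₗ_injective ?_)
    rw [map_zero]
    exact ModularForm.levelOne_odd_weight_eq_zero hodd _

/-- The `n`-th Fourier coefficient. -/
def coeffC (f : CuspForm 𝒮ℒ κ) (n : ℕ) : ℂ := (qExpansion 1 (f : ℍ → ℂ)).coeff n

theorem hasSum_coeffC (f : CuspForm 𝒮ℒ κ) {z : ℂ} (hz : 0 < z.im) :
    HasSum (fun n : ℕ => coeffC f n * Complex.exp (2 * Real.pi * Complex.I * n * z))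
      (f (ofComplex z)) := by
  have h := ModularForm.hasSum_qExpansion f one_pos
    (by simp : (1 : ℝ) ∈ (𝒮ℒ).strictPeriods) (ofComplex z)
  convert h using 2 with n
  rw [UpperHalfPlane.ofComplex_apply_of_im_pos hz, Function.Periodic.qParam, ← Complex.exp_nat_mul]
  simp only [coeffC]
  congr 2
  push_cast
  ring

theorem coeffC_zero (f : CuspForm 𝒮ℒ κ) : coeffC f 0 = 0 :=
  CuspFormClass.qExpansion_coeff_zero f one_pos (by simp)

theorem coeffC_isBigO (f : CuspForm 𝒮ℒ κ) :
    (fun n => coeffC f n) =O[atTop] fun n : ℕ => (n : ℝ) ^ ((κ : ℝ) / 2) := by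
  have := CuspFormClass.qExpansion_isBigO f
  rwa [Subgroup.strictWidthInfty_SL2Z] at this

theorem continuous_line (f : CuspForm 𝒮ℒ κ) {t : ℝ} (ht : 0 < t) :
    Continuous fun x : ℝ => f (ofComplex (x + t * Complex.I)) := by
  have h : ∀ x : ℝ, ofComplex ((x : ℂ) + t * Complex.I) = ⟨x + t * Complex.I, by simpa using ht⟩ :=
    fun x => UpperHalfPlane.ofComplex_apply_of_im_pos (by simpa using ht)
  simp_rw [h]
  have hf : Continuous f := (ModularFormClass.holo f).continuous
  refine hf.comp ?_
  rw [UpperHalfPlane.isEmbedding_coe.continuous_iff]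
  simp only [Function.comp_def]
  fun_prop

/-- Parseval's inequality for the Fourier expansion on a horizontal line. -/
theorem sum_sq_coeffC_le (f : CuspForm 𝒮ℒ κ) {C : ℝ} (hC : ∀ τ : ℍ, ‖f τ‖ ≤ C / τ.im ^ (κ / 2 : ℝ))
    {t : ℝ} (ht : 0 < t) (s : Finset ℕ) :
    ∑ n ∈ s, (‖coeffC f n‖ * Real.exp (-2 * Real.pi * n * t)) ^ 2 ≤ (C / t ^ (κ / 2 : ℝ)) ^ 2 := by
  set F : ℝ → ℂ := fun x => f (ofComplex (x + t * Complex.I)) with hF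
  have hFc : Continuous F := continuous_line f ht
  have hFb : ∀ x, ‖F x‖ ≤ C / t ^ (κ / 2 : ℝ) := fun x => by
    have h := hC (ofComplex (x + t * Complex.I))
    rw [← UpperHalfPlane.coe_im, UpperHalfPlane.ofComplex_apply_of_im_pos (by simpa using ht)] at h
    simp only [hF]
    rw [UpperHalfPlane.ofComplex_apply_of_im_pos (by simpa using ht)]
    simpa using h
  have hL2 : MemLp F 2 (volume.restrict (Ioc 0 1)) :=
    MemLp.of_bound hFc.aestronglyMeasurable _ (Eventually.of_forall hFb)
  have hP := hasSum_sq_fourierCoeffOn zero_lt_one hL2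
  have hcoef : ∀ n : ℕ, ‖fourierCoeffOn zero_lt_one F n‖ =
      ‖coeffC f n‖ * Real.exp (-2 * Real.pi * n * t) := fun n => by
    have h := ModularFormClass.qExpansion_coeff_eq_intervalIntegral f one_pos
      (by simp : (1 : ℝ) ∈ (𝒮ℒ).strictPeriods) n ht
    have h2 : coeffC f n = Complex.exp (2 * Real.pi * n * t) *
        fourierCoeffOn zero_lt_one F n := by
      rw [coeffC, h, fourierCoeffOn_eq_integral]
      simp only [Complex.ofReal_one, div_one, one_mul, sub_zero, one_smul]
      rw [← intervalIntegral.integral_const_mul]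
      refine intervalIntegral.integral_congr fun x _ => ?_
      simp only [hF]
      rw [UpperHalfPlane.ofComplex_apply_of_im_pos (by simpa using ht), smul_eq_mul, ← mul_assoc]
      congr 1
      rw [Function.Periodic.qParam, ← Complex.exp_nat_mul, one_div, ← Complex.exp_neg,
        fourier_coe_apply, ← Complex.exp_add]
      congr 1
      push_cast
      linear_combination (-(2 * Real.pi * n * t : ℂ)) * Complex.I_sq
    rw [h2, norm_mul, Complex.norm_exp, mul_right_comm, ← Real.exp_add]
    have : (2 * (Real.pi : ℂ) * n * t).re = 2 * Real.pi * n * t := by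
      have : (2 * (Real.pi : ℂ) * n * t) = ((2 * Real.pi * n * t : ℝ) : ℂ) := by push_cast; rfl
      rw [this, Complex.ofReal_re]
    rw [this]
    have : 2 * Real.pi * n * t + -2 * Real.pi * n * t = 0 := by ring
    rw [this, Real.exp_zero, one_mul]
  calc ∑ n ∈ s, (‖coeffC f n‖ * Real.exp (-2 * Real.pi * n * t)) ^ 2
      = ∑ i ∈ s.map Nat.castEmbedding, ‖fourierCoeffOn zero_lt_one F (i : ℤ)‖ ^ 2 := by
        rw [Finset.sum_map]
        exact Finset.sum_congr rfl fun n _ => by rw [← hcoef]; rfl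
    _ ≤ _ := sum_le_hasSum _ (fun i _ => by positivity) hP
    _ ≤ ∫ x in (0 : ℝ)..1, (C / t ^ (κ / 2 : ℝ)) ^ 2 := by
        simp only [sub_zero, inv_one, one_smul]
        refine intervalIntegral.integral_mono_on zero_le_one ?_ ?_ fun x _ => ?_
        · exact (by fun_prop : Continuous fun x => ‖F x‖ ^ 2).intervalIntegrable _ _
        · exact intervalIntegrable_const
        · exact pow_le_pow_left₀ (norm_nonneg _) (hFb x) 2
    _ = _ := by simp

/-- Parseval at height `t = 1/n`: the weights `e^{-4πk/n}` are bounded below for `k ≤ n`, and `|f| ≪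
t^{-κ/2}` makes the right-hand side `n^κ`. -/
theorem sum_sq_coeffC_isBigO (f : CuspForm 𝒮ℒ κ) :
    (fun n : ℕ => ∑ k ∈ Finset.Icc 1 n, ‖coeffC f k‖ ^ 2) =O[atTop] fun n => (n : ℝ) ^ (κ : ℝ) := by
  obtain ⟨C, hC⟩ := CuspFormClass.exists_bound f
  refine Asymptotics.IsBigO.of_bound (Real.exp (4 * Real.pi) * C ^ 2) ?_
  filter_upwards [eventually_gt_atTop 0] with n hn
  have hn0 : (0 : ℝ) < n := by exact_mod_cast hn
  have h := sum_sq_coeffC_le f hC (t := 1 / n) (by positivity) (Finset.Icc 1 n)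
  have hrhs : (C / (1 / (n : ℝ)) ^ (κ / 2 : ℝ)) ^ 2 = C ^ 2 * (n : ℝ) ^ (κ : ℝ) := by
    rw [one_div, Real.inv_rpow hn0.le, div_inv_eq_mul, mul_pow, ← Real.rpow_mul_natCast hn0.le]
    congr 2
    push_cast
    ring
  rw [hrhs] at h
  have h2 : Real.exp (-(4 * Real.pi)) * ∑ k ∈ Finset.Icc 1 n, ‖coeffC f k‖ ^ 2 ≤
      C ^ 2 * (n : ℝ) ^ (κ : ℝ) := by
    refine le_trans ?_ h
    rw [Finset.mul_sum]
    refine Finset.sum_le_sum fun k hk => ?_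
    rw [mul_pow, mul_comm, ← Real.exp_nat_mul]
    refine mul_le_mul_of_nonneg_left (Real.exp_le_exp.2 ?_) (by positivity)
    have hk' : (k : ℝ) * (1 / n) ≤ 1 := by
      rw [mul_one_div, div_le_one hn0]
      exact_mod_cast (Finset.mem_Icc.1 hk).2
    push_cast
    nlinarith [Real.pi_pos, mul_le_mul_of_nonneg_left hk' Real.pi_pos.le]
  rw [Real.norm_of_nonneg (Finset.sum_nonneg fun i _ => by positivity),
    Real.norm_of_nonneg (by positivity), mul_assoc]
  rw [Real.exp_neg, inv_mul_le_iff₀ (Real.exp_pos _)] at h2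
  exact h2

theorem norm_coeffA (f : CuspForm 𝒮ℒ κ) {n : ℕ} (hn : n ≠ 0) :
    ‖coeffA f n‖ = ‖coeffC f n‖ / (n : ℝ) ^ (((κ : ℝ) - 1) / 2) := by
  rw [coeffA, norm_div, Complex.norm_natCast_cpow_of_pos (Nat.pos_of_ne_zero hn)]
  congr 2
  have : (((κ : ℂ) - 1) / 2) = ((((κ : ℝ) - 1) / 2 : ℝ) : ℂ) := by push_cast; rfl
  rw [this, Complex.ofReal_re]

/-- Absolute convergence of `∑ a_f(n) n^(-s)` for `Re s > 1`. -/
theorem summable_coeffA (f : CuspForm 𝒮ℒ κ) (hκ : 0 < κ) {σ : ℝ} (hσ : 1 < σ) :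
    Summable fun n : ℕ => ‖coeffA f n‖ / (n : ℝ) ^ σ := by
  -- The mean-square bound suffices: the series of squares converges at `κ - 1 + σ > κ`, and
  -- `|a_f(n)| ≤ |a_f(n)|² + 1` passes to first powers without any pointwise bound.
  have h1 := LSeriesSummable_of_sum_norm_bigO_and_nonneg (f := fun n => ‖coeffC f n‖ ^ 2)
    (sum_sq_coeffC_isBigO f) (fun n => by positivity) (by exact_mod_cast hκ.le)
    (s := ((κ - 1 + σ : ℝ) : ℂ)) (by rw [Complex.ofReal_re]; linarith)
  have h2 := h1.norm
  have h3 : Summable fun n : ℕ => 1 / (n : ℝ) ^ σ := Real.summable_one_div_nat_rpow.2 hσ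
  refine Summable.of_nonneg_of_le (fun n => by positivity) (fun n => ?_) (h2.add h3)
  rw [LSeries.term_def]
  by_cases hn : n = 0
  · subst hn
    simp [Real.zero_rpow (by linarith : σ ≠ 0)]
  · have hn0 : (0 : ℝ) < n := by exact_mod_cast Nat.pos_of_ne_zero hn
    rw [if_neg hn, norm_div, Complex.norm_natCast_cpow_of_pos (Nat.pos_of_ne_zero hn),
      Complex.ofReal_re, Complex.norm_real, Real.norm_of_nonneg (by positivity)]
    have h4 : ‖coeffC f n‖ ^ 2 / (n : ℝ) ^ (κ - 1 + σ) = ‖coeffA f n‖ ^ 2 / (n : ℝ) ^ σ := by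
      rw [norm_coeffA f hn, div_pow, Real.rpow_add hn0, ← Real.rpow_mul_natCast hn0.le, div_div]
      congr 3
      push_cast
      ring
    rw [h4, ← add_div]
    refine div_le_div_of_nonneg_right ?_ (by positivity)
    nlinarith [sq_nonneg (‖coeffA f n‖ - 1)]

theorem coeffC_eq (f : CuspForm 𝒮ℒ κ) (n : ℕ) :
    coeffC f n = coeffA f n * (n : ℂ) ^ (((κ : ℂ) - 1) / 2) := by
  by_cases hn : n = 0
  · subst hn; rw [coeffC_zero, coeffA]
    have := coeffC_zero f
    rw [coeffC] at this
    rw [this, zero_div, zero_mul]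
  · rw [coeffA, div_mul_cancel₀]; · rfl
    exact Complex.cpow_ne_zero_iff.2 (Or.inl (by exact_mod_cast hn))

end QuadTwist
end

noncomputable section

namespace QuadTwist

open MeasureTheory Filter Set Topology
open UpperHalfPlane (ofComplex qExpansion)

variable {κ : ℤ}

/-! ### Twists of cusp forms by primitive quadratic characters -/

/-- By primitivity the discrete Fourier transform of `ψ` is a multiple of the Gauss sum; if that
vanished, injectivity of the transform would force `ψ = 0`. -/
theorem gaussSum_stdAddChar_ne_zero {d : ℕ} [NeZero d] {ψ : DirichletCharacter ℂ d}
    (hψ : ψ.IsPrimitive) : gaussSum ψ (ZMod.stdAddChar (N := d)) ≠ 0 := by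
  intro h
  have h0 : ZMod.dft (ψ : ZMod d → ℂ) = 0 := by
    funext k
    rw [hψ.fourierTransform_eq_inv_mul_gaussSum, h, mul_zero]
    rfl
  have h1 : (ψ : ZMod d → ℂ) = 0 := by
    simpa using h0
  have := congrFun h1 1
  simp at this

/-- The combination `∑_b ψ(b) f((b + i y) / d)` of translates of `f`. -/
def twistSum (f : CuspForm 𝒮ℒ κ) {d : ℕ} [NeZero d] (ψ : DirichletCharacter ℂ d) (y : ℝ) : ℂ :=
  ∑ b : ZMod d, ψ b * f (ofComplex (((b.val : ℂ) + y * Complex.I) / d))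

theorem im_div_natCast {d : ℕ} (x y : ℝ) :
    (((x : ℂ) + y * Complex.I) / (d : ℂ)).im = y / d := by
  rw [show (d : ℂ) = ((d : ℝ) : ℂ) by push_cast; rfl, Complex.div_ofReal_im]
  simp

theorem im_point_pos {d : ℕ} [NeZero d] (b : ℕ) {y : ℝ} (hy : 0 < y) :
    0 < (((b : ℂ) + y * Complex.I) / (d : ℂ)).im := by
  have := im_div_natCast (d := d) b y
  push_cast at this
  rw [this]
  have : (0 : ℝ) < d := by exact_mod_cast Nat.pos_of_ne_zero (NeZero.ne d)
  positivity

/-- For primitive `ψ`, `∑_b ψ(b) e(nb/d) = ψ⁻¹(n) τ` for all `n`, coprime to `d` or not, and `ψ⁻¹ =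
ψ` for quadratic characters. The common factor `τ` is kept and cancels later, so its value is never
needed. -/
theorem hasSum_twistSum (f : CuspForm 𝒮ℒ κ) {d : ℕ} [NeZero d] {ψ : DirichletCharacter ℂ d}
    (hψ : ψ.IsPrimitive) (hq : ψ.IsQuadratic) {y : ℝ} (hy : 0 < y) :
    HasSum (fun n : ℕ => gaussSum ψ (ZMod.stdAddChar (N := d)) * (coeffC f n * ψ n) *
      Real.exp (-(2 * Real.pi * n / d) * y)) (twistSum f ψ y) := by
  have hd0 : (d : ℂ) ≠ 0 := by exact_mod_cast NeZero.ne d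
  have h : HasSum (fun n : ℕ => ∑ b : ZMod d, ψ b * (coeffC f n *
      Complex.exp (2 * Real.pi * Complex.I * n * (((b.val : ℂ) + y * Complex.I) / d))))
      (twistSum f ψ y) :=
    hasSum_sum fun b _ => (hasSum_coeffC f (im_point_pos b.val hy)).mul_left _
  convert h using 2 with n
  have hg := gaussSum_mulShift_of_isPrimitive (ZMod.stdAddChar (N := d)) hψ (n : ZMod d)
  rw [hq.inv] at hg
  rw [show gaussSum ψ (ZMod.stdAddChar (N := d)) * (coeffC f n * ψ n) =
    coeffC f n * (ψ n * gaussSum ψ (ZMod.stdAddChar (N := d))) by ring, ← hg, gaussSum,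
    mul_assoc, Finset.sum_mul, Finset.mul_sum]
  refine Finset.sum_congr rfl fun b _ => ?_
  rw [AddChar.mulShift_apply]
  have h2 : ZMod.stdAddChar ((n : ZMod d) * b) =
      Complex.exp (2 * Real.pi * Complex.I * ((n * b.val : ℕ) : ℤ) / d) := by
    rw [← ZMod.stdAddChar_coe]
    push_cast
    rw [ZMod.natCast_zmod_val]
  rw [h2, mul_assoc, mul_left_comm, mul_assoc, Complex.ofReal_exp, ← Complex.exp_add]
  refine congrArg (ψ b * ·) (congrArg (coeffC f n * ·) (congrArg Complex.exp ?_))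
  push_cast
  field_simp
  linear_combination (-(n * y : ℂ)) * Complex.I_sq

theorem cuspForm_modular (f : CuspForm 𝒮ℒ κ) {a b c e : ℤ} (hdet : a * e - b * c = 1) {z w : ℂ}
    (hz : 0 < z.im) (hw : 0 < w.im) (hzw : w * (c * z + e) = a * z + b) :
    f (ofComplex w) = (c * z + e) ^ κ * f (ofComplex z) := by
  set γ : SL(2, ℤ) := ⟨!![a, b; c, e], by rw [Matrix.det_fin_two_of]; exact hdet⟩ with hγ
  have hmem : (γ : GL (Fin 2) ℝ) ∈ 𝒮ℒ := ⟨γ, rfl⟩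
  have h := SlashInvariantForm.slash_action_eqn' f hmem (ofComplex z)
  have h00 : (γ : GL (Fin 2) ℝ) 0 0 = (a : ℝ) := rfl
  have h01 : (γ : GL (Fin 2) ℝ) 0 1 = (b : ℝ) := rfl
  have h10 : (γ : GL (Fin 2) ℝ) 1 0 = (c : ℝ) := rfl
  have h11 : (γ : GL (Fin 2) ℝ) 1 1 = (e : ℝ) := rfl
  have hden : (c : ℂ) * z + e ≠ 0 := by
    intro h0
    have him := congrArg Complex.im h0
    have hre := congrArg Complex.re h0
    simp at him hre
    rcases him with hc | hz0
    · subst hc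
      simp at hre
      subst hre
      simp at hdet
    · exact hz.ne' hz0
  have hpt : (γ : GL (Fin 2) ℝ) • ofComplex z = ofComplex w := by
    ext
    rw [UpperHalfPlane.coe_smul_of_det_pos (by simp)]
    rw [UpperHalfPlane.ofComplex_apply_of_im_pos hz, UpperHalfPlane.ofComplex_apply_of_im_pos hw]
    simp only [UpperHalfPlane.num, UpperHalfPlane.denom, h00, h01, h10, h11, Complex.ofReal_intCast]
    exact (div_eq_iff hden).mpr hzw.symm
  rw [hpt, UpperHalfPlane.ofComplex_apply_of_im_pos hz] at h
  rw [h, UpperHalfPlane.ofComplex_apply_of_im_pos hz]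
  simp only [h10, h11, Complex.ofReal_intCast]

/-- The classes `b` and `-b⁻¹` are exchanged by a matrix of `SL(2, ℤ)`, and `ψ` takes the same value
on both because it is even and quadratic. The sum is thus carried to itself with factor `(iy)^κ`. -/
theorem twistSum_inv (f : CuspForm 𝒮ℒ κ) {d : ℕ} [NeZero d] {ψ : DirichletCharacter ℂ d}
    (hneg : ψ (-1) = 1) (hq : ψ.IsQuadratic) {y : ℝ} (hy : 0 < y) :
    twistSum f ψ (1 / y) = (Complex.I ^ κ * (y : ℂ) ^ κ) * twistSum f ψ y := by
  have hd0 : (d : ℂ) ≠ 0 := by exact_mod_cast NeZero.ne d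
  have hy0 : (y : ℂ) ≠ 0 := by exact_mod_cast hy.ne'
  have hred : ∀ x : ℝ, twistSum f ψ x = ∑ u : (ZMod d)ˣ,
      ψ u * f (ofComplex ((((u : ZMod d).val : ℂ) + x * Complex.I) / d)) := fun x => by
    unfold twistSum
    symm
    refine Finset.sum_of_injOn (fun u : (ZMod d)ˣ => (u : ZMod d)) Units.val_injective.injOn
      (by simp) (fun b _ hb => ?_) fun _ _ => rfl
    rw [ψ.map_nonunit, zero_mul]
    rintro ⟨u, rfl⟩
    exact hb ⟨u, by simp, rfl⟩
  rw [hred, hred, Finset.mul_sum]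
  refine Fintype.sum_equiv ((Equiv.inv _).trans (Equiv.neg _)) _ _ fun u => ?_
  simp only [Equiv.trans_apply, Equiv.inv_apply, Equiv.neg_apply]
  set v : (ZMod d)ˣ := -u⁻¹ with hv
  have hψv : ψ v = ψ u := by
    rw [hv]
    have h1 : (((-u⁻¹ : (ZMod d)ˣ)) : ZMod d) = (-1) * ((u⁻¹ : (ZMod d)ˣ) : ZMod d) := by
      push_cast; ring
    rw [h1, map_mul, hneg, one_mul]
    have h3 := MulChar.inv_apply ψ (u : ZMod d)
    rw [hq.inv, Ring.inverse_unit] at h3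
    exact h3.symm
  rw [hψv, mul_left_comm]
  congr 1
  set B := (u : ZMod d).val
  set B' := (v : ZMod d).val
  -- With `BB' + 1 = de` the matrix with rows `(B, -e)` and `(d, -B')` has determinant `1`, and its
  -- automorphy factor at `(B' + iy)/d` is exactly `iy`.
  obtain ⟨e, he⟩ : (d : ℤ) ∣ B * B' + 1 := by
    rw [← ZMod.intCast_zmod_eq_zero_iff_dvd]
    push_cast
    rw [ZMod.natCast_zmod_val, ZMod.natCast_zmod_val, hv]
    simp
  have heC : (B : ℂ) * B' + 1 = d * e := by exact_mod_cast he
  have hmod := cuspForm_modular f (a := B) (b := -e) (c := d) (e := -B')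
    (z := ((B' : ℂ) + y * Complex.I) / d) (w := ((B : ℂ) + (1 / y : ℝ) * Complex.I) / d)
    (by linear_combination -he) (im_point_pos B' hy)
    (im_point_pos B (by positivity)) (by
      push_cast
      field_simp
      linear_combination heC * (-1) * y + y * Complex.I_sq)
  rw [hmod, ← mul_zpow]
  congr 2
  push_cast
  field_simp
  ring

end QuadTwist
end

noncomputable section

namespace QuadTwist

open MeasureTheory Filter Set Topology
open UpperHalfPlane (ofComplex qExpansion)

variable {κ : ℤ}

/-! ### A bound for the reciprocal of the Gamma function -/

theorem norm_Gamma_le {s : ℂ} (hs : 0 < s.re) : ‖Complex.Gamma s‖ ≤ Real.Gamma s.re := by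
  rw [Complex.Gamma_eq_integral hs, Complex.GammaIntegral, Real.Gamma_eq_integral hs]
  refine (norm_integral_le_integral_norm _).trans (le_of_eq ?_)
  refine setIntegral_congr_fun measurableSet_Ioi fun x (hx : 0 < x) => ?_
  simp only [norm_mul, Complex.norm_real, Real.norm_eq_abs, Real.abs_exp]
  rw [Complex.norm_cpow_eq_rpow_re_of_pos hx, Complex.sub_re, Complex.one_re]

theorem norm_sin_le (z : ℂ) : ‖Complex.sin z‖ ≤ Real.exp |z.im| := by
  rw [Complex.sin, norm_div, norm_mul, Complex.norm_I, mul_one, Complex.norm_ofNat]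
  have h1 : ‖Complex.exp (-z * Complex.I)‖ ≤ Real.exp |z.im| := by
    rw [Complex.norm_exp]
    simpa using le_abs_self z.im
  have h2 : ‖Complex.exp (z * Complex.I)‖ ≤ Real.exp |z.im| := by
    rw [Complex.norm_exp]
    simpa using neg_le_abs z.im
  have := norm_sub_le (Complex.exp (-z * Complex.I)) (Complex.exp (z * Complex.I))
  linarith

/-- In `-1 ≤ Re s ≤ 0` the reflection formula gives `Γ(1-s) sin(πs)/π`, where `|Γ(1-s)| ≤ 1` by
convexity of `Γ` between `Γ(1) = Γ(2) = 1`. Wider strips follow from `Γ(s) = (s-1)Γ(s-1)` for `|Im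
s| > 1` and by compactness otherwise. -/
theorem exists_norm_inv_Gamma_le (N : ℕ) : ∃ C : ℝ, ∀ s : ℂ, -1 ≤ s.re → s.re ≤ N →
    ‖(Complex.Gamma s)⁻¹‖ ≤ C * Real.exp (Real.pi * |s.im|) := by
  induction N with
  | zero =>
    refine ⟨1, fun s h1 h2 => ?_⟩
    have hG : ‖Complex.Gamma (1 - s)‖ ≤ 1 := by
      have hre : (1 - s).re = 1 - s.re := by simp
      refine (norm_Gamma_le (by rw [hre]; push_cast at h2; linarith)).trans ?_
      have := Real.convexOn_Gamma.le_max_of_mem_Icc (x := 1) (y := 2) (z := (1 - s).re)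
        (by simp) (by simp) ⟨by rw [hre]; push_cast at h2; linarith, by rw [hre]; linarith⟩
      simpa using this
    have hsin := norm_sin_le (Real.pi * s)
    rw [Complex.im_ofReal_mul, abs_mul, abs_of_pos Real.pi_pos] at hsin
    have href := Complex.Gamma_mul_Gamma_one_sub s
    by_cases h0 : Complex.Gamma s = 0
    · rw [h0, inv_zero, norm_zero]; positivity
    have hpi : (Real.pi : ℂ) ≠ 0 := by exact_mod_cast Real.pi_ne_zero
    have hG1 : Complex.Gamma (1 - s) ≠ 0 := Complex.Gamma_ne_zero_of_re_pos (by
      have : (1 - s).re = 1 - s.re := by simp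
      rw [this]; push_cast at h2; linarith)
    have hs0 : Complex.sin (Real.pi * s) ≠ 0 := by
      intro h
      rw [h, div_zero] at href
      exact (mul_ne_zero h0 hG1) href
    have heq : (Complex.Gamma s)⁻¹ =
        Complex.Gamma (1 - s) * Complex.sin (Real.pi * s) / Real.pi := by
      rw [eq_div_iff hpi, inv_mul_eq_iff_eq_mul₀ h0]
      rw [eq_div_iff hs0] at href
      linear_combination -href
    rw [heq, norm_div, norm_mul, Complex.norm_real, Real.norm_eq_abs, abs_of_pos Real.pi_pos, one_mul]
    rw [div_le_iff₀ Real.pi_pos]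
    have h3 : (1 : ℝ) ≤ Real.pi := by linarith [Real.pi_gt_three]
    calc _ ≤ 1 * Real.exp (Real.pi * |s.im|) := by gcongr
      _ ≤ _ := by nlinarith [Real.exp_pos (Real.pi * |s.im|)]
  | succ N ih =>
    obtain ⟨C, hC⟩ := ih
    have hcpt : IsCompact (Icc (-1 : ℝ) (N + 1) ×ℂ Icc (-1 : ℝ) 1) := isCompact_Icc.reProdIm isCompact_Icc
    obtain ⟨C', hC'⟩ := hcpt.exists_bound_of_continuousOn
      (Complex.differentiable_one_div_Gamma.continuous.continuousOn)
    refine ⟨max C C', fun s h1 h2 => ?_⟩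
    push_cast at h2
    by_cases him : |s.im| ≤ 1
    · have h := hC' s ⟨⟨h1, h2⟩, abs_le.1 him⟩
      have h5 : 0 ≤ C' := (norm_nonneg _).trans h
      calc _ ≤ C' := h
        _ ≤ max C C' * 1 := by simp
        _ ≤ _ := by
          have := h5.trans (le_max_right C C')
          gcongr
          exact Real.one_le_exp (by positivity)
    · by_cases hre : s.re ≤ N
      · exact (hC s h1 hre).trans (by gcongr; exact le_max_left _ _)
      have hs : ‖s - 1‖ ≥ 1 := by
        have h := Complex.abs_im_le_norm (s - 1)
        simp only [Complex.sub_im, Complex.one_im, sub_zero] at h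
        linarith
      have hne : s - 1 ≠ 0 := by
        intro h; rw [h, norm_zero] at hs; linarith
      have hG := Complex.Gamma_add_one (s - 1) hne
      rw [sub_add_cancel] at hG
      have h := hC (s - 1) (by simp; linarith [Nat.cast_nonneg (α := ℝ) N]) (by simp; linarith)
      simp only [Complex.sub_im, Complex.one_im, sub_zero] at h
      rw [hG, mul_inv, norm_mul, norm_inv]
      calc _ ≤ 1 * ‖(Complex.Gamma (s - 1))⁻¹‖ := by
            gcongr
            exact inv_le_one_of_one_le₀ hs
        _ ≤ _ := by
          rw [one_mul]
          exact h.trans (by gcongr; exact le_max_left _ _)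

/-! ### The twisted `L`-functions -/

theorem exists_norm_coeffC_le (f : CuspForm 𝒮ℒ κ) (hκ : 0 < κ) :
    ∃ C : ℝ, ∀ n : ℕ, ‖coeffC f n‖ ≤ C * (n : ℝ) ^ ((κ : ℝ) / 2) := by
  have hκ' : (0 : ℝ) < κ := by exact_mod_cast hκ
  obtain ⟨C, hC⟩ := (Asymptotics.bound_of_isBigO_nat_atTop (coeffC_isBigO f))
  refine ⟨C, fun n => ?_⟩
  by_cases hn : n = 0
  · subst hn
    rw [coeffC_zero, norm_zero, Nat.cast_zero, Real.zero_rpow (by positivity), mul_zero]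
  · have h0 : (0 : ℝ) < n := by exact_mod_cast Nat.pos_of_ne_zero hn
    have := hC.2 (x := n) (by positivity)
    rwa [Real.norm_eq_abs, abs_of_pos (by positivity)] at this

/-- From `e^{-x} ≤ S! x^{-S}` at `x = ny/d`; the condition on `S` makes `∑ n^{κ/2 - S}` converge.
What matters is that the dependence on `d` is polynomial, with a constant free of `d` and `ψ`. -/
theorem exists_norm_twistSum_le (f : CuspForm 𝒮ℒ κ) (hκ : 0 < κ) {S : ℕ} (hS : κ + 2 ≤ S) :
    ∃ C : ℝ, 0 ≤ C ∧ ∀ (d : ℕ) [NeZero d] (ψ : DirichletCharacter ℂ d), ψ.IsPrimitive → ψ.IsQuadratic →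
      ∀ y : ℝ, 0 < y → ‖twistSum f ψ y‖ ≤
        ‖gaussSum ψ (ZMod.stdAddChar (N := d))‖ * (C * (d : ℝ) ^ S * (y ^ S)⁻¹) := by
  obtain ⟨C₀, hC₀⟩ := exists_norm_coeffC_le f hκ
  have hC₀0 : 0 ≤ C₀ := by
    have := (norm_nonneg _).trans (hC₀ 1)
    simpa using this
  have hsum : Summable fun n : ℕ => 1 / (n : ℝ) ^ (2 : ℕ) :=
    Real.summable_one_div_nat_pow.2 (by norm_num)
  refine ⟨C₀ * S.factorial * ∑' n : ℕ, 1 / (n : ℝ) ^ (2 : ℕ), by positivity, fun d _ ψ hψ hq y hy => ?_⟩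
  have hd : (0 : ℝ) < d := by exact_mod_cast Nat.pos_of_ne_zero (NeZero.ne d)
  have h := hasSum_twistSum f hψ hq hy
  rw [← h.tsum_eq]
  have hb : ∀ n : ℕ, ‖gaussSum ψ (ZMod.stdAddChar (N := d)) * (coeffC f n * ψ n) *
      Real.exp (-(2 * Real.pi * n / d) * y)‖ ≤ ‖gaussSum ψ (ZMod.stdAddChar (N := d))‖ *
        (C₀ * S.factorial * (d : ℝ) ^ S * (y ^ S)⁻¹) * (1 / (n : ℝ) ^ (2 : ℕ)) := fun n => by
    rw [norm_mul, norm_mul, norm_mul, Complex.norm_real, Real.norm_eq_abs, Real.abs_exp]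
    by_cases hn : n = 0
    · subst hn; simp [coeffC_zero]
    have hn0 : (0 : ℝ) < n := by exact_mod_cast Nat.pos_of_ne_zero hn
    have hn1 : (1 : ℝ) ≤ n := by exact_mod_cast Nat.pos_of_ne_zero hn
    have hexp : Real.exp (-(2 * Real.pi * n / d) * y) ≤ S.factorial * (d : ℝ) ^ S * (y ^ S)⁻¹ * ((n : ℝ) ^ S)⁻¹ := by
      have h1 := Real.pow_div_factorial_le_exp (x := n * y / d) (by positivity) S
      have h2 : Real.exp (n * y / d) ≤ Real.exp (2 * Real.pi * n / d * y) := by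
        apply Real.exp_le_exp.2
        have : n * y / d * 1 ≤ n * y / d * (2 * Real.pi) := by
          gcongr; linarith [Real.pi_gt_three]
        calc _ = n * y / d * 1 := by ring
          _ ≤ _ := this
          _ = _ := by ring
      rw [neg_mul, Real.exp_neg]
      have h3 := h1.trans h2
      calc _ ≤ ((n * y / d) ^ S / S.factorial)⁻¹ := inv_anti₀ (by positivity) h3
        _ = _ := by
          rw [div_pow, mul_pow]; field_simp
    have hpow : (n : ℝ) ^ ((κ : ℝ) / 2) * ((n : ℝ) ^ S)⁻¹ ≤ 1 / (n : ℝ) ^ (2 : ℕ) := by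
      rw [← Real.rpow_natCast, ← Real.rpow_natCast, ← Real.rpow_neg hn0.le, ← Real.rpow_add hn0,
        one_div, ← Real.rpow_neg hn0.le]
      apply Real.rpow_le_rpow_of_exponent_le hn1
      have : (κ : ℝ) + 2 ≤ S := by exact_mod_cast hS
      have h0 : (0 : ℝ) < κ := by exact_mod_cast hκ
      push_cast; linarith
    calc _ ≤ ‖gaussSum ψ (ZMod.stdAddChar (N := d))‖ * (C₀ * (n : ℝ) ^ ((κ : ℝ) / 2) * 1) *
          (S.factorial * (d : ℝ) ^ S * (y ^ S)⁻¹ * ((n : ℝ) ^ S)⁻¹) := by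
          gcongr
          · exact hC₀ n
          · exact DirichletCharacter.norm_le_one ψ _
      _ = ‖gaussSum ψ (ZMod.stdAddChar (N := d))‖ * (C₀ * S.factorial * (d : ℝ) ^ S * (y ^ S)⁻¹) *
          ((n : ℝ) ^ ((κ : ℝ) / 2) * ((n : ℝ) ^ S)⁻¹) := by ring
      _ ≤ _ := by gcongr
  refine (tsum_of_norm_bounded ((hsum.mul_left _).hasSum) hb).trans (le_of_eq ?_)
  rw [tsum_mul_left]; ring

theorem continuousOn_twistSum (f : CuspForm 𝒮ℒ κ) {d : ℕ} [NeZero d] (ψ : DirichletCharacter ℂ d) :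
    ContinuousOn (twistSum f ψ) (Ioi 0) := by
  have hf : DifferentiableOn ℂ (f ∘ ofComplex) {z | 0 < z.im} :=
    UpperHalfPlane.mdifferentiable_iff.1 (ModularFormClass.holo f)
  unfold twistSum
  refine continuousOn_finsetSum _ fun b _ => continuousOn_const.mul ?_
  refine hf.continuousOn.comp (f := fun y : ℝ => ((b.val : ℂ) + y * Complex.I) / d) ?_ fun y hy => im_point_pos b.val hy
  fun_prop

/-- The pair of functions (equal to each other) behind the functional equation of a twist. -/
def twistPair (f : CuspForm 𝒮ℒ κ) (hκ : 0 < κ) {d : ℕ} [NeZero d] {ψ : DirichletCharacter ℂ d}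
    (hψ : ψ.IsPrimitive) (hneg : ψ (-1) = 1) (hq : ψ.IsQuadratic) : WeakFEPair ℂ :=
  have htop : ∀ r : ℝ, (fun y => twistSum f ψ y - 0) =O[atTop] (· ^ r) := fun r => by
    obtain ⟨S, hS⟩ := exists_nat_ge (max ((κ : ℝ) + 2) (-r))
    obtain ⟨C, hC0, hC⟩ := exists_norm_twistSum_le f hκ (S := S)
      (by exact_mod_cast (le_max_left _ _).trans hS)
    refine Asymptotics.IsBigO.of_bound
      (‖gaussSum ψ (ZMod.stdAddChar (N := d))‖ * (C * (d : ℝ) ^ S)) ?_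
    filter_upwards [eventually_ge_atTop 1] with y hy
    have hy0 : 0 < y := by linarith
    rw [sub_zero]
    refine (hC d ψ hψ hq y hy0).trans ?_
    rw [Real.norm_eq_abs, abs_of_pos (by positivity), ← mul_assoc]
    have : 0 ≤ ‖gaussSum ψ (ZMod.stdAddChar (N := d))‖ * (C * (d : ℝ) ^ S) := by
      positivity
    gcongr
    rw [← Real.rpow_natCast, ← Real.rpow_neg hy0.le]
    exact Real.rpow_le_rpow_of_exponent_le hy (by linarith [(le_max_right _ _).trans hS])
  { f := twistSum f ψ
    g := twistSum f ψ
    k := κ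
    ε := Complex.I ^ κ
    f₀ := 0
    g₀ := 0
    hf_int := (continuousOn_twistSum f ψ).locallyIntegrableOn measurableSet_Ioi
    hg_int := (continuousOn_twistSum f ψ).locallyIntegrableOn measurableSet_Ioi
    hk := by exact_mod_cast hκ
    hε := zpow_ne_zero _ Complex.I_ne_zero
    h_feq := fun x hx => by
      rw [twistSum_inv f hneg hq hx, smul_eq_mul, Real.rpow_intCast]
      push_cast; rfl
    hf_top := htop
    hg_top := htop }

/-- Both constant terms of the pair vanish, so the Mellin transform has no poles. -/
theorem differentiable_mellin_twistSum (f : CuspForm 𝒮ℒ κ) (hκ : 0 < κ) {d : ℕ} [NeZero d]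
    {ψ : DirichletCharacter ℂ d} (hψ : ψ.IsPrimitive) (hneg : ψ (-1) = 1) (hq : ψ.IsQuadratic) :
    Differentiable ℂ (mellin (twistSum f ψ)) := by
  have hP : IsStrongFEPair (twistPair f hκ hψ hneg hq) := ⟨rfl, rfl⟩
  have := hP.differentiable_Λ
  rwa [hP.Λ_eq] at this

theorem mellin_twistSum_sub (f : CuspForm 𝒮ℒ κ) (hκ : 0 < κ) {d : ℕ} [NeZero d]
    {ψ : DirichletCharacter ℂ d} (hψ : ψ.IsPrimitive) (hneg : ψ (-1) = 1) (hq : ψ.IsQuadratic)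
    (s : ℂ) :
    mellin (twistSum f ψ) (κ - s) = Complex.I ^ κ * mellin (twistSum f ψ) s := by
  have hP : IsStrongFEPair (twistPair f hκ hψ hneg hq) := ⟨rfl, rfl⟩
  have := (twistPair f hκ hψ hneg hq).functional_equation s
  rw [hP.Λ_eq, hP.symm_Λ_eq, smul_eq_mul] at this
  have hk : (((twistPair f hκ hψ hneg hq).k : ℝ) : ℂ) = κ := by
    change (((κ : ℤ) : ℝ) : ℂ) = κ
    push_cast; rfl
  rw [hk] at this
  exact this

theorem mellin_twistSum_eq (f : CuspForm 𝒮ℒ κ) (hκ : 0 < κ) {d : ℕ} [NeZero d]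
    {ψ : DirichletCharacter ℂ d} (hψ : ψ.IsPrimitive) (hq : ψ.IsQuadratic)
    {s : ℂ} (hs : 1 < s.re) :
    mellin (twistSum f ψ) (s + ((κ : ℂ) - 1) / 2) =
      gaussSum ψ (ZMod.stdAddChar (N := d)) * Complex.Gamma (s + ((κ : ℂ) - 1) / 2) *
      (2 * Real.pi / d : ℂ) ^ (-(s + ((κ : ℂ) - 1) / 2)) *
      LSeries (fun n => coeffA f n * ψ n) s := by
  have hd : (0 : ℝ) < d := by exact_mod_cast Nat.pos_of_ne_zero (NeZero.ne d)
  have hκ1 : (1 : ℝ) ≤ κ := by exact_mod_cast hκ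
  set S : ℂ := s + ((κ : ℂ) - 1) / 2 with hS
  have hSre : S.re = s.re + ((κ : ℝ) - 1) / 2 := by
    rw [hS, show ((κ : ℂ) - 1) / 2 = ((((κ : ℝ) - 1) / 2 : ℝ) : ℂ) by push_cast; rfl,
      Complex.add_re, Complex.ofReal_re]
  set τ := gaussSum ψ (ZMod.stdAddChar (N := d))
  have h := hasSum_mellin (a := fun n : ℕ => τ * (coeffC f n * ψ n))
    (p := fun n : ℕ => 2 * Real.pi * n / d) (F := twistSum f ψ) (s := S) (fun n => ?_)
    (by rw [hSre]; linarith) (fun t ht => hasSum_twistSum f hψ hq ht) ?_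
  · rw [← h.tsum_eq, LSeries, ← tsum_mul_left]
    refine tsum_congr fun n => ?_
    by_cases hn : n = 0
    · subst hn
      simp [coeffC_zero]
    have hn0 : (n : ℂ) ≠ 0 := by exact_mod_cast hn
    rw [LSeries.term_of_ne_zero hn, coeffC_eq]
    have hp : ((2 * Real.pi * n / d : ℝ) : ℂ) ^ S = (2 * Real.pi / d : ℂ) ^ S * (n : ℂ) ^ S := by
      rw [show (2 * Real.pi * n / d : ℝ) = (2 * Real.pi / d) * (n : ℝ) by ring, Complex.ofReal_mul,
        Complex.mul_cpow_ofReal_nonneg (by positivity) (by positivity)]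
      push_cast; rfl
    have hpi : (2 * Real.pi / d : ℂ) ^ S ≠ 0 := by
      rw [Ne, Complex.cpow_eq_zero_iff, not_and_or]
      left
      have : (2 * Real.pi / d : ℂ) = ((2 * Real.pi / d : ℝ) : ℂ) := by push_cast; rfl
      rw [this]
      exact_mod_cast (by positivity : (2 * Real.pi / d : ℝ) ≠ 0)
    rw [hp, Complex.cpow_neg]
    have hs' : (n : ℂ) ^ S = (n : ℂ) ^ s * (n : ℂ) ^ (((κ : ℂ) - 1) / 2) := by
      rw [hS, Complex.cpow_add _ _ hn0]
    have h1 : (n : ℂ) ^ s ≠ 0 := by simp [Complex.cpow_eq_zero_iff, hn0]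
    have h2 : (n : ℂ) ^ (((κ : ℂ) - 1) / 2) ≠ 0 := by simp [Complex.cpow_eq_zero_iff, hn0]
    rw [hs']
    field_simp
  · by_cases hn : n = 0
    · left; subst hn; simp [coeffC_zero]
    · right
      have hn0 : (0 : ℝ) < n := by exact_mod_cast Nat.pos_of_ne_zero hn
      positivity
  · refine Summable.of_nonneg_of_le (fun n => by positivity) (fun n => ?_)
      ((summable_coeffA f hκ hs).mul_left (‖τ‖ * (2 * Real.pi / d) ^ (-S.re)))
    by_cases hn : n = 0
    · subst hn
      simp only [coeffC_zero, zero_mul, mul_zero, norm_zero, zero_div]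
      positivity
    have hn0 : (0 : ℝ) < n := by exact_mod_cast Nat.pos_of_ne_zero hn
    rw [show (2 * Real.pi * n / d : ℝ) = (2 * Real.pi / d) * (n : ℝ) by ring,
      Real.mul_rpow (by positivity) hn0.le, norm_mul, norm_mul, norm_coeffA f hn,
      Real.rpow_neg (by positivity), hSre, Real.rpow_add hn0]
    have : ‖ψ n‖ ≤ 1 := DirichletCharacter.norm_le_one ψ _
    calc _ ≤ ‖τ‖ * (‖coeffC f n‖ * 1) / ((2 * Real.pi / d) ^ (s.re + ((κ : ℝ) - 1) / 2) *
        ((n : ℝ) ^ s.re * (n : ℝ) ^ (((κ : ℝ) - 1) / 2))) := by gcongr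
      _ = _ := by field_simp

/-- The entire function `(2π/d)^S Γ(S)⁻¹ Λ(S) / τ` at `S = s + (κ-1)/2`, which continues the
twisted `L`-series. -/
def twistFun (f : CuspForm 𝒮ℒ κ) {d : ℕ} [NeZero d] (ψ : DirichletCharacter ℂ d) (s : ℂ) : ℂ :=
  (2 * Real.pi / d : ℂ) ^ (s + ((κ : ℂ) - 1) / 2) * (Complex.Gamma (s + ((κ : ℂ) - 1) / 2))⁻¹ *
    mellin (twistSum f ψ) (s + ((κ : ℂ) - 1) / 2) / gaussSum ψ (ZMod.stdAddChar (N := d))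

theorem two_pi_div_ne_zero (d : ℕ) [NeZero d] : (2 * Real.pi / d : ℂ) ≠ 0 := by
  simp [NeZero.ne d]

theorem differentiable_twistFun (f : CuspForm 𝒮ℒ κ) (hκ : 0 < κ) {d : ℕ} [NeZero d]
    {ψ : DirichletCharacter ℂ d} (hψ : ψ.IsPrimitive) (hneg : ψ (-1) = 1) (hq : ψ.IsQuadratic) :
    Differentiable ℂ (twistFun f ψ) := by
  have h1 := differentiable_mellin_twistSum f hκ hψ hneg hq
  have h2 := Complex.differentiable_one_div_Gamma
  have h3 : Differentiable ℂ fun s : ℂ => s + ((κ : ℂ) - 1) / 2 := by fun_prop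
  have h4 : Differentiable ℂ fun s : ℂ => (2 * Real.pi / d : ℂ) ^ (s + ((κ : ℂ) - 1) / 2) := fun s =>
    (h3 s).const_cpow (Or.inl (two_pi_div_ne_zero d))
  exact ((h4.mul (h2.comp h3)).mul (h1.comp h3)).div_const _

theorem twistFun_eq (f : CuspForm 𝒮ℒ κ) (hκ : 0 < κ) {d : ℕ} [NeZero d]
    {ψ : DirichletCharacter ℂ d} (hψ : ψ.IsPrimitive) (hq : ψ.IsQuadratic)
    {s : ℂ} (hs : 1 < s.re) : twistFun f ψ s = LSeries (fun n => coeffA f n * ψ n) s := by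
  have hκ1 : (1 : ℝ) ≤ κ := by exact_mod_cast hκ
  have hG : Complex.Gamma (s + ((κ : ℂ) - 1) / 2) ≠ 0 := Complex.Gamma_ne_zero_of_re_pos (by
    rw [show ((κ : ℂ) - 1) / 2 = ((((κ : ℝ) - 1) / 2 : ℝ) : ℂ) by push_cast; rfl,
      Complex.add_re, Complex.ofReal_re]
    linarith)
  have hτ := gaussSum_stdAddChar_ne_zero hψ
  have hp : (2 * Real.pi / d : ℂ) ^ (s + ((κ : ℂ) - 1) / 2) ≠ 0 := by
    rw [Ne, Complex.cpow_eq_zero_iff, not_and_or]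
    exact Or.inl (two_pi_div_ne_zero d)
  rw [twistFun, mellin_twistSum_eq f hκ hψ hq hs, Complex.cpow_neg]
  set P := (2 * Real.pi / d : ℂ) ^ (s + ((κ : ℂ) - 1) / 2)
  set G := Complex.Gamma (s + ((κ : ℂ) - 1) / 2)
  field_simp

/-- This is the Mellin form of `twistSum_inv` with the archimedean factors rearranged. The bound on
`Re s` keeps `Γ(1 - s + (κ-1)/2)` away from its poles, and evenness of `κ` enters through `i^{2κ} =
1`. -/
theorem twistFun_functional (f : CuspForm 𝒮ℒ κ) (hκ : 0 < κ) (hev : Even κ) {d : ℕ} [NeZero d]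
    {ψ : DirichletCharacter ℂ d} (hψ : ψ.IsPrimitive) (hneg : ψ (-1) = 1) (hq : ψ.IsQuadratic)
    {s : ℂ} (hs : s.re < ((κ : ℝ) + 1) / 2) :
    twistFun f ψ s = gammaX κ s * (d : ℂ) ^ (1 - 2 * s) * twistFun f ψ (1 - s) := by
  have hd : (0 : ℝ) < d := by exact_mod_cast Nat.pos_of_ne_zero (NeZero.ne d)
  have hd0 : (d : ℂ) ≠ 0 := by exact_mod_cast NeZero.ne d
  have hpi : (2 * Real.pi : ℂ) ≠ 0 := by simp
  have hG : Complex.Gamma (1 - s + ((κ : ℂ) - 1) / 2) ≠ 0 := Complex.Gamma_ne_zero_of_re_pos (by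
    rw [show ((κ : ℂ) - 1) / 2 = ((((κ : ℝ) - 1) / 2 : ℝ) : ℂ) by push_cast; rfl,
      Complex.add_re, Complex.ofReal_re, Complex.sub_re, Complex.one_re]
    linarith)
  have hfe := mellin_twistSum_sub f hκ hψ hneg hq (s + ((κ : ℂ) - 1) / 2)
  rw [show (κ : ℂ) - (s + ((κ : ℂ) - 1) / 2) = 1 - s + ((κ : ℂ) - 1) / 2 by ring] at hfe
  have hI : Complex.I ^ κ * Complex.I ^ κ = 1 := by
    rw [← zpow_add₀ Complex.I_ne_zero, ← two_mul, mul_comm, zpow_mul, zpow_ofNat]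
    obtain ⟨m, rfl⟩ := hev
    rw [← two_mul, zpow_mul, zpow_ofNat, Complex.I_sq]
    rcases Int.even_or_odd m with h | h
    · rw [h.neg_one_zpow, one_pow]
    · rw [h.neg_one_zpow]; norm_num
  rw [twistFun, twistFun, hfe, gammaX]
  have hd1 : ∀ a : ℂ, (2 * Real.pi / d : ℂ) ^ a = (2 * Real.pi : ℂ) ^ a * (d : ℂ) ^ (-a) := fun a => by
    have h1 : (2 * Real.pi / d : ℂ) = ((2 * Real.pi : ℝ) : ℂ) * (((d : ℝ)⁻¹ : ℝ) : ℂ) := by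
      push_cast; rw [div_eq_mul_inv]
    rw [h1, Complex.mul_cpow_ofReal_nonneg (by positivity) (by positivity), Complex.cpow_neg,
      Complex.ofReal_inv, Complex.inv_cpow]
    · push_cast; rfl
    · rw [Complex.ofReal_natCast, Complex.natCast_arg]; exact Real.pi_ne_zero.symm
  rw [hd1, hd1]
  have e1 : (2 * Real.pi : ℂ) ^ (s + ((κ : ℂ) - 1) / 2) =
      (2 * Real.pi : ℂ) ^ (2 * s - 1) * (2 * Real.pi : ℂ) ^ (1 - s + ((κ : ℂ) - 1) / 2) := by
    rw [← Complex.cpow_add _ _ hpi]; congr 1; ring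
  have e2 : (d : ℂ) ^ (-(s + ((κ : ℂ) - 1) / 2)) =
      (d : ℂ) ^ (1 - 2 * s) * (d : ℂ) ^ (-(1 - s + ((κ : ℂ) - 1) / 2)) := by
    rw [← Complex.cpow_add _ _ hd0]; congr 1; ring
  rw [e1, e2]
  set G := Complex.Gamma (1 - s + ((κ : ℂ) - 1) / 2)
  set P := (2 * Real.pi : ℂ) ^ (2 * s - 1)
  set P' := (2 * Real.pi : ℂ) ^ (1 - s + ((κ : ℂ) - 1) / 2)
  set D := (d : ℂ) ^ (1 - 2 * s)
  set D' := (d : ℂ) ^ (-(1 - s + ((κ : ℂ) - 1) / 2))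
  set Λ := mellin (twistSum f ψ) (s + ((κ : ℂ) - 1) / 2)
  set H := Complex.Gamma (s + ((κ : ℂ) - 1) / 2)
  set τ := gaussSum ψ (ZMod.stdAddChar (N := d))
  have : Complex.I ^ κ * P * G / H * D * (P' * D' * G⁻¹ * (Complex.I ^ κ * Λ) / τ) =
    (Complex.I ^ κ * Complex.I ^ κ) * (G * G⁻¹) * (P * P' * (D * D') * H⁻¹ * Λ / τ) := by ring
  rw [this, hI, mul_inv_cancel₀ hG]
  ring

/-- The integral is split at `y = 1`: above it the decay `y^{-S}` is used, below it the inversion `y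
↦ 1/y`. With `S = κ + 2` the twisted sum is `O(y²)` near `0`, and the integrand is bounded by a
multiple of `1/(1+y²)` throughout the strip. -/
theorem exists_norm_mellin_twistSum_le (f : CuspForm 𝒮ℒ κ) (hκ : 0 < κ) :
    ∃ C : ℝ, ∃ S : ℕ, 0 ≤ C ∧ ∀ (d : ℕ) [NeZero d] (ψ : DirichletCharacter ℂ d), ψ.IsPrimitive →
      ψ (-1) = 1 → ψ.IsQuadratic → ∀ s : ℂ, ((κ : ℝ) - 1) / 2 ≤ s.re → s.re ≤ ((κ : ℝ) + 3) / 2 →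
      ‖mellin (twistSum f ψ) s‖ ≤ ‖gaussSum ψ (ZMod.stdAddChar (N := d))‖ * (C * (d : ℝ) ^ S) := by
  have hκ1 : (1 : ℝ) ≤ κ := by exact_mod_cast hκ
  obtain ⟨S, hS⟩ := Int.eq_ofNat_of_zero_le (show 0 ≤ κ + 2 by omega)
  have hSκ : (S : ℝ) = κ + 2 := by exact_mod_cast hS.symm
  obtain ⟨C, hC0, hC⟩ := exists_norm_twistSum_le f hκ (S := S) (by rw [hS])
  have hint : IntegrableOn (fun y : ℝ => 4 * (1 + y ^ 2)⁻¹) (Ioi 0) :=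
    (integrable_inv_one_add_sq.const_mul 4).integrableOn
  have hI0 : 0 ≤ ∫ y in Ioi (0 : ℝ), 4 * (1 + y ^ 2)⁻¹ := integral_nonneg fun y => by positivity
  refine ⟨C * ∫ y in Ioi (0 : ℝ), 4 * (1 + y ^ 2)⁻¹, S, by positivity, fun d _ ψ hψ hneg hq s h1 h2 => ?_⟩
  set τ := gaussSum ψ (ZMod.stdAddChar (N := d))
  have hb : ∀ y ∈ Ioi (0 : ℝ), ‖((y : ℂ) ^ (s - 1)) • twistSum f ψ y‖ ≤
      (‖τ‖ * (C * (d : ℝ) ^ S)) * (4 * (1 + y ^ 2)⁻¹) := fun y (hy : 0 < y) => by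
    rw [norm_smul, Complex.norm_cpow_eq_rpow_re_of_pos hy, Complex.sub_re, Complex.one_re]
    have hA : 0 ≤ ‖τ‖ * (C * (d : ℝ) ^ S) := by positivity
    by_cases hy1 : y ≤ 1
    · have hfe := twistSum_inv f hneg hq hy
      have hn : ‖twistSum f ψ y‖ ≤ ‖τ‖ * (C * (d : ℝ) ^ S) * y ^ (2 : ℕ) := by
        have hy' : (0 : ℝ) < 1 / y := by positivity
        have h3 := twistSum_inv f hneg hq hy'
        rw [one_div_one_div] at h3
        have h4 := hC d ψ hψ hq _ hy'
        rw [h3, norm_mul, norm_mul, norm_zpow, norm_zpow, Complex.norm_I, one_zpow, one_mul,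
          Complex.norm_real, Real.norm_eq_abs, abs_of_pos hy']
        have h5 : (1 / y) ^ κ * (((1 / y) ^ S)⁻¹) = y ^ (2 : ℕ) := by
          rw [← zpow_natCast (1 / y), ← zpow_neg, ← zpow_add₀ hy'.ne', ← hS.symm.symm]
          rw [show κ + -(κ + 2) = -2 by ring, one_div, inv_zpow, zpow_neg, inv_inv]
          rfl
        calc _ ≤ (1 / y) ^ κ * (‖τ‖ * (C * (d : ℝ) ^ S * (((1 / y) ^ S)⁻¹))) := by gcongr
          _ = ‖τ‖ * (C * (d : ℝ) ^ S) * ((1 / y) ^ κ * (((1 / y) ^ S)⁻¹)) := by ring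
          _ = _ := by rw [h5]
      have hpow : y ^ (s.re - 1) * y ^ (2 : ℕ) ≤ 1 := by
        rw [← Real.rpow_natCast, ← Real.rpow_add hy]
        apply Real.rpow_le_one hy.le hy1
        push_cast; linarith
      have h4 : (1 : ℝ) ≤ 4 * (1 + y ^ 2)⁻¹ := by
        rw [← div_eq_mul_inv, le_div_iff₀ (by positivity)]; nlinarith
      calc _ ≤ y ^ (s.re - 1) * (‖τ‖ * (C * (d : ℝ) ^ S) * y ^ (2 : ℕ)) := by gcongr
        _ = ‖τ‖ * (C * (d : ℝ) ^ S) * (y ^ (s.re - 1) * y ^ (2 : ℕ)) := by ring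
        _ ≤ ‖τ‖ * (C * (d : ℝ) ^ S) * 1 := by gcongr
        _ ≤ _ := by gcongr
    · push Not at hy1
      have hn := hC d ψ hψ hq y hy
      have hpow : y ^ (s.re - 1) * (y ^ S)⁻¹ ≤ (y ^ (2 : ℕ))⁻¹ := by
        rw [← Real.rpow_natCast, ← Real.rpow_natCast, ← Real.rpow_neg hy.le, ← Real.rpow_neg hy.le,
          ← Real.rpow_add hy]
        apply Real.rpow_le_rpow_of_exponent_le hy1.le
        push_cast; rw [hSκ]; linarith
      have h4 : (y ^ (2 : ℕ))⁻¹ ≤ 4 * (1 + y ^ 2)⁻¹ := by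
        rw [← div_eq_mul_inv, le_div_iff₀ (by positivity), inv_mul_le_iff₀ (by positivity)]; nlinarith
      calc _ ≤ y ^ (s.re - 1) * (‖τ‖ * (C * (d : ℝ) ^ S * (y ^ S)⁻¹)) := by gcongr
        _ = ‖τ‖ * (C * (d : ℝ) ^ S) * (y ^ (s.re - 1) * (y ^ S)⁻¹) := by ring
        _ ≤ _ := mul_le_mul_of_nonneg_left (hpow.trans h4) hA
  rw [mellin]
  refine (norm_integral_le_of_norm_le (hint.const_mul (‖τ‖ * (C * (d : ℝ) ^ S))) ?_).trans (le_of_eq ?_)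
  · exact (ae_restrict_iff' measurableSet_Ioi).2 (Eventually.of_forall hb)
  · rw [integral_const_mul]; ring

theorem exists_norm_twistFun_le (f : CuspForm 𝒮ℒ κ) (hκ : 0 < κ) :
    ∃ C : ℝ, ∃ S : ℕ, 0 ≤ C ∧ ∀ (d : ℕ) [NeZero d] (ψ : DirichletCharacter ℂ d), ψ.IsPrimitive →
      ψ (-1) = 1 → ψ.IsQuadratic → ∀ s : ℂ, 0 ≤ s.re → s.re ≤ 2 →
      ‖twistFun f ψ s‖ ≤ C * (d : ℝ) ^ S * Real.exp (Real.pi * |s.im|) := by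
  have hκ1 : (1 : ℝ) ≤ κ := by exact_mod_cast hκ
  obtain ⟨C, S, hC0, hC⟩ := exists_norm_mellin_twistSum_le f hκ
  obtain ⟨N, hN⟩ := exists_nat_ge (((κ : ℝ) + 3) / 2)
  obtain ⟨C', hC'⟩ := exists_norm_inv_Gamma_le N
  have hC'0 : 0 ≤ C' := by
    have := (norm_nonneg _).trans (hC' 0 (by simp) (by simp))
    simpa using this
  refine ⟨(2 * Real.pi) ^ (((κ : ℝ) + 3) / 2) * C' * C, S, by positivity,
    fun d _ ψ hψ hneg hq s h1 h2 => ?_⟩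
  have hd1 : (1 : ℝ) ≤ d := by exact_mod_cast Nat.pos_of_ne_zero (NeZero.ne d)
  have hτ : 0 < ‖gaussSum ψ (ZMod.stdAddChar (N := d))‖ :=
    norm_pos_iff.2 (gaussSum_stdAddChar_ne_zero hψ)
  set a : ℂ := s + ((κ : ℂ) - 1) / 2 with ha
  have hc : ((κ : ℂ) - 1) / 2 = ((((κ : ℝ) - 1) / 2 : ℝ) : ℂ) := by push_cast; rfl
  have hare : a.re = s.re + ((κ : ℝ) - 1) / 2 := by
    rw [ha, hc, Complex.add_re, Complex.ofReal_re]
  have haim : a.im = s.im := by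
    rw [ha, hc, Complex.add_im, Complex.ofReal_im, add_zero]
  have b1 : ‖(2 * Real.pi / d : ℂ) ^ a‖ ≤ (2 * Real.pi) ^ (((κ : ℝ) + 3) / 2) := by
    rw [show (2 * Real.pi / d : ℂ) = ((2 * Real.pi / d : ℝ) : ℂ) by push_cast; rfl,
      Complex.norm_cpow_eq_rpow_re_of_pos (by positivity), hare]
    calc _ ≤ (2 * Real.pi) ^ (s.re + ((κ : ℝ) - 1) / 2) := by
          apply Real.rpow_le_rpow (by positivity) _ (by linarith)
          exact div_le_self (by positivity) hd1
      _ ≤ _ := by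
        apply Real.rpow_le_rpow_of_exponent_le (by linarith [Real.pi_gt_three])
        linarith
  have b2 := hC' a (by rw [hare]; linarith) (by rw [hare]; linarith)
  rw [haim] at b2
  have b3 := hC d ψ hψ hneg hq a (by rw [hare]; linarith) (by rw [hare]; linarith)
  rw [twistFun, norm_div, norm_mul, norm_mul, div_le_iff₀ hτ]
  calc _ ≤ (2 * Real.pi) ^ (((κ : ℝ) + 3) / 2) * (C' * Real.exp (Real.pi * |s.im|)) *
        (‖gaussSum ψ (ZMod.stdAddChar (N := d))‖ * (C * (d : ℝ) ^ S)) := by gcongr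
    _ = _ := by ring

/-! ### The `L`-functions `L(s, f ⊗ χ_d)` -/

/-- The chosen entire continuation agrees with any other one by the identity theorem. -/
theorem twistedL_eq_of_differentiable (f : CuspForm 𝒮ℒ κ) {d : ℕ} {G : ℂ → ℂ} (hG : Differentiable ℂ G)
    (h : ∀ s : ℂ, 1 < s.re → G s = LSeries (fun n => coeffA f n * chi d n) s) :
    twistedL f d = G := by
  have hex : ∃ G : ℂ → ℂ, Differentiable ℂ G ∧
      ∀ s : ℂ, 1 < s.re → G s = LSeries (fun n => coeffA f n * chi d n) s := ⟨G, hG, h⟩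
  rw [twistedL, entireContinuation, dif_pos hex]
  have hs := hex.choose_spec
  refine AnalyticOnNhd.eq_of_eventuallyEq (𝕜 := ℂ) (z₀ := 2) (fun z _ => hs.1.analyticAt z)
    (fun z _ => hG.analyticAt z) ?_
  have ho : IsOpen {s : ℂ | 1 < s.re} := isOpen_lt continuous_const Complex.continuous_re
  filter_upwards [ho.mem_nhds (by simp : (2 : ℂ) ∈ {s : ℂ | 1 < s.re})] with s hs1
  rw [hs.2 s hs1, h s hs1]

theorem IsPosFundDisc.exists_twistedL_eq (f : CuspForm 𝒮ℒ κ) (hκ : 0 < κ) {d : ℕ}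
    (hd : IsPosFundDisc d) : ∃ (_ : NeZero d) (ψ : DirichletCharacter ℂ d), ψ.IsPrimitive ∧
      ψ (-1) = 1 ∧ ψ.IsQuadratic ∧ twistedL f d = twistFun f ψ := by
  have : NeZero d := ⟨hd.pos.ne'⟩
  obtain ⟨ψ, h1, h2, h3, h4⟩ := hd.exists_character
  refine ⟨this, ψ, h1, h2, h3, twistedL_eq_of_differentiable f
    (differentiable_twistFun f hκ h1 h2 h3) fun s hs => ?_⟩
  rw [twistFun_eq f hκ h1 h3 hs]
  simp_rw [h4]

theorem IsPosFundDisc.differentiable_twistedL (f : CuspForm 𝒮ℒ κ) (hκ : 0 < κ) {d : ℕ}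
    (hd : IsPosFundDisc d) : Differentiable ℂ (twistedL f d) := by
  obtain ⟨_, ψ, h1, h2, h3, h4⟩ := hd.exists_twistedL_eq f hκ
  rw [h4]
  exact differentiable_twistFun f hκ h1 h2 h3

theorem IsPosFundDisc.twistedL_eq (f : CuspForm 𝒮ℒ κ) (hκ : 0 < κ) {d : ℕ} (hd : IsPosFundDisc d)
    {s : ℂ} (hs : 1 < s.re) : twistedL f d s = LSeries (fun n => coeffA f n * chi d n) s := by
  have : NeZero d := ⟨hd.pos.ne'⟩
  obtain ⟨ψ, h1, h2, h3, h4⟩ := hd.exists_character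
  simp_rw [← h4]
  rw [← twistFun_eq f hκ h1 h3 hs, twistedL_eq_of_differentiable f
    (differentiable_twistFun f hκ h1 h2 h3) fun s hs => ?_]
  rw [twistFun_eq f hκ h1 h3 hs]
  simp_rw [h4]

theorem IsPosFundDisc.twistedL_functional (f : CuspForm 𝒮ℒ κ) (hκ : 0 < κ) (hev : Even κ) {d : ℕ}
    (hd : IsPosFundDisc d) {s : ℂ} (hs : s.re < ((κ : ℝ) + 1) / 2) :
    twistedL f d s = gammaX κ s * (d : ℂ) ^ (1 - 2 * s) * twistedL f d (1 - s) := by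
  obtain ⟨_, ψ, h1, h2, h3, h4⟩ := hd.exists_twistedL_eq f hκ
  rw [h4]
  exact twistFun_functional f hκ hev h1 h2 h3 hs

/-- The exponents are far from convexity bounds, but any polynomial bound in `d` gives absolute
convergence of the multiple Dirichlet series for `Re w` large, and `e^{π|Im s|}` is absorbed by the
Gaussian weight. -/
theorem exists_norm_twistedL_le (f : CuspForm 𝒮ℒ κ) (hκ : 0 < κ) :
    ∃ C : ℝ, ∃ S : ℕ, 0 ≤ C ∧ ∀ d : ℕ, IsPosFundDisc d → ∀ s : ℂ, 0 ≤ s.re → s.re ≤ 2 →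
      ‖twistedL f d s‖ ≤ C * (d : ℝ) ^ S * Real.exp (Real.pi * |s.im|) := by
  obtain ⟨C, S, hC0, hC⟩ := exists_norm_twistFun_le f hκ
  refine ⟨C, S, hC0, fun d hd s h1 h2 => ?_⟩
  obtain ⟨_, ψ, h3, h4, h5, h6⟩ := hd.exists_twistedL_eq f hκ
  rw [h6]
  exact hC d ψ h3 h4 h5 s h1 h2

end QuadTwist
end

noncomputable section

namespace QuadTwist

open MeasureTheory Filter Set Topology
open scoped NumberTheorySymbols

/-! ### Sums of quadratic characters over squarefree numbers -/

open Classical in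
/-- The Dirichlet series `∑ μ²(m) ψ(m) m^(-w)`. -/
def sqfreeSeries {N : ℕ} (ψ : DirichletCharacter ℂ N) (w : ℂ) : ℂ :=
  ∑' m : ℕ, if Squarefree m then ψ m * (m : ℂ) ^ (-w) else 0

theorem summable_sqfreeSeries {N : ℕ} (ψ : DirichletCharacter ℂ N) {w : ℂ} (hw : 1 < w.re) :
    Summable fun m : ℕ => ‖(if Squarefree m then ψ m * (m : ℂ) ^ (-w) else 0)‖ := by
  refine Summable.of_nonneg_of_le (fun m => norm_nonneg _) (fun m => ?_)
    (summable_dirichletSummand ψ hw)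
  split_ifs
  · rfl
  · rw [norm_zero]; positivity

/-- Comparison of Euler factors: `1 + x = (1 - x²)/(1 - x)` with `x = ψ(p) p^{-w}`. -/
theorem sqfreeSeries_mul_LSeries {N : ℕ} [NeZero N] (ψ : DirichletCharacter ℂ N) {w : ℂ} (hw : 1 < w.re) :
    sqfreeSeries ψ w * LSeries (fun n => (ψ ^ 2) n) (2 * w) = LSeries (fun n => ψ n) w := by
  classical
  set F : ℕ → ℂ := fun m => if Squarefree m then ψ m * (m : ℂ) ^ (-w) else 0 with hF
  have h1 : HasProd (fun p : Nat.Primes => ∑' e : ℕ, F (p ^ e)) (∑' m, F m) := by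
    refine EulerProduct.eulerProduct_hasProd (by simp [hF]) (fun {m n} hmn => ?_)
      (summable_sqfreeSeries ψ hw) (by simp [hF])
    simp only [hF, Nat.squarefree_mul hmn]
    by_cases hm : Squarefree m <;> by_cases hn : Squarefree n <;> simp [hm, hn]
    rw [Complex.natCast_mul_natCast_cpow]
    ring
  have hp1 : ∀ p : Nat.Primes, ∑' e : ℕ, F (p ^ e) = 1 + ψ p * (p : ℂ) ^ (-w) := fun p => by
    rw [tsum_eq_sum (s := {0, 1})]
    · rw [Finset.sum_pair zero_ne_one]
      simp [hF, p.2.prime.squarefree]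
    · intro e he
      simp only [Finset.mem_insert, Finset.mem_singleton, not_or] at he
      have : ¬ Squarefree ((p : ℕ) ^ e) := fun h => by
        have := (Nat.squarefree_pow_iff p.2.ne_one he.1).1 h
        exact he.2 this.2
      simp [hF, this]
  simp_rw [hp1] at h1
  have h2w : 1 < (2 * w).re := by simp; linarith
  have h2 := DirichletCharacter.LSeries_eulerProduct_hasProd (ψ ^ 2) h2w
  have h3 := DirichletCharacter.LSeries_eulerProduct_hasProd ψ hw
  refine (h1.mul h2).unique ?_
  convert h3 using 2 with p
  have hp : (p : ℂ) ^ (-(2 * w)) = (p : ℂ) ^ (-w) * (p : ℂ) ^ (-w) := by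
    rw [← Complex.cpow_add _ _ (by exact_mod_cast p.2.ne_zero)]; congr 1; ring
  have hlt : ‖ψ p * (p : ℂ) ^ (-w)‖ < 1 := by
    rw [norm_mul, Complex.norm_natCast_cpow_of_pos p.2.pos]
    have : ((p : ℕ) : ℝ) ^ (-w).re < 1 := Real.rpow_lt_one_of_one_lt_of_neg
      (by exact_mod_cast p.2.one_lt) (by simp; linarith)
    calc _ ≤ 1 * ((p : ℕ) : ℝ) ^ (-w).re := by gcongr; exact DirichletCharacter.norm_le_one ψ _
      _ < 1 := by linarith
  rw [hp, MulChar.pow_apply' ψ two_ne_zero]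
  set x := ψ p * (p : ℂ) ^ (-w)
  have e : 1 - ψ p ^ 2 * ((p : ℂ) ^ (-w) * (p : ℂ) ^ (-w)) = (1 - x) * (1 + x) := by ring
  rw [e, mul_inv]
  have : 1 + x ≠ 0 := by
    intro h
    have : x = -1 := by linear_combination h
    rw [this] at hlt
    simp at hlt
  field_simp

theorem tendsto_real_nhdsGT_one : Tendsto (fun x : ℝ => (x : ℂ)) (𝓝[>] 1) (𝓝[≠] 1) := by
  refine tendsto_nhdsWithin_iff.2 ⟨?_, ?_⟩
  · exact (Complex.continuous_ofReal.tendsto' 1 1 (by simp)).mono_left nhdsWithin_le_nhds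
  · filter_upwards [self_mem_nhdsWithin] with x (hx : 1 < x) h
    have : x = 1 := by simpa using h
    linarith

theorem sqfreeSeries_eq {N : ℕ} [NeZero N] (ψ : DirichletCharacter ℂ N) {w : ℝ} (hw : 1 < w) :
    sqfreeSeries ψ w = ψ.LFunction w / (ψ ^ 2).LFunction (2 * w) := by
  have h2w : 1 < (2 * (w : ℂ)).re := by simp; linarith
  rw [eq_div_iff, DirichletCharacter.LFunction_eq_LSeries _ h2w,
    DirichletCharacter.LFunction_eq_LSeries _ (by simpa using hw)]
  · exact sqfreeSeries_mul_LSeries ψ (by simpa using hw)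
  · exact DirichletCharacter.LFunction_ne_zero_of_one_le_re _ (Or.inr fun h => by
      rw [h] at h2w; simp at h2w) h2w.le

/-- For a non-trivial `ψ`, `L(w, ψ)/L(2w, ψ²)` is regular at `w = 1`: the numerator is entire and
the denominator is non-zero there. -/
theorem tendsto_sqfreeSeries_of_ne_one {N : ℕ} [NeZero N] {ψ : DirichletCharacter ℂ N} (hψ : ψ ≠ 1) :
    Tendsto (fun w : ℝ => ((w : ℂ) - 1) * sqfreeSeries ψ w) (𝓝[>] 1) (𝓝 0) := by
  have h2 : (2 : ℂ) ≠ 1 := by norm_num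
  have hne : (ψ ^ 2).LFunction 2 ≠ 0 :=
    DirichletCharacter.LFunction_ne_zero_of_one_le_re _ (Or.inr h2) (by simp)
  have hc : ContinuousAt (fun w : ℂ => (w - 1) * (ψ.LFunction w / (ψ ^ 2).LFunction (2 * w))) 1 := by
    have h3 : ContinuousAt (fun w : ℂ => (ψ ^ 2).LFunction (2 * w)) 1 := by
      refine ContinuousAt.comp (g := (ψ ^ 2).LFunction) ?_ (by fun_prop)
      rw [mul_one]
      exact (DirichletCharacter.differentiableAt_LFunction _ 2 (Or.inl h2)).continuousAt
    exact (by fun_prop : ContinuousAt (fun w : ℂ => w - 1) 1).mul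
      ((DirichletCharacter.differentiableAt_LFunction _ 1 (Or.inr hψ)).continuousAt.div h3 (by rwa [mul_one]))
  have := hc.tendsto.comp (tendsto_real_nhdsGT_one.mono_right nhdsWithin_le_nhds)
  rw [sub_self, zero_mul] at this
  refine this.congr' ?_
  filter_upwards [self_mem_nhdsWithin] with w hw
  simp only [Function.comp_apply]
  rw [sqfreeSeries_eq ψ hw]

/-- The residue is `∏ (1 - p⁻¹)` divided by `ζ(2) ∏ (1 - p⁻²)`; the quotient of the local factors is
`p/(p+1)`. -/
theorem tendsto_sqfreeSeries_one (N : ℕ) [NeZero N] :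
    Tendsto (fun w : ℝ => ((w : ℂ) - 1) * sqfreeSeries (1 : DirichletCharacter ℂ N) w) (𝓝[>] 1)
      (𝓝 (arithA N / riemannZeta 2)) := by
  have h2 : (2 : ℂ) ≠ 1 := by norm_num
  have hne : (1 : DirichletCharacter ℂ N).LFunction 2 ≠ 0 :=
    DirichletCharacter.LFunction_ne_zero_of_one_le_re _ (Or.inr h2) (by simp)
  have h3 : Tendsto (fun w : ℂ => (1 : DirichletCharacter ℂ N).LFunction (2 * w)) (𝓝[≠] 1)
      (𝓝 ((1 : DirichletCharacter ℂ N).LFunction 2)) := by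
    have : ContinuousAt (fun w : ℂ => (1 : DirichletCharacter ℂ N).LFunction (2 * w)) 1 := by
      refine ContinuousAt.comp (g := (1 : DirichletCharacter ℂ N).LFunction) ?_ (by fun_prop)
      rw [mul_one]
      exact (DirichletCharacter.differentiableAt_LFunction _ 2 (Or.inl h2)).continuousAt
    have h := this.tendsto
    rw [mul_one] at h
    exact h.mono_left nhdsWithin_le_nhds
  have h := ((DirichletCharacter.LFunctionTrivChar_residue_one (N := N)).div h3 hne).comp
    tendsto_real_nhdsGT_one
  have hval : (∏ p ∈ N.primeFactors, (1 - (p : ℂ)⁻¹)) / (1 : DirichletCharacter ℂ N).LFunction 2 =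
      arithA N / riemannZeta 2 := by
    have e := DirichletCharacter.LFunctionTrivChar_eq_mul_riemannZeta (N := N) h2
    rw [DirichletCharacter.LFunctionTrivChar] at e
    rw [e, arithA, ← div_div, ← Finset.prod_div_distrib]
    congr 1
    refine Finset.prod_congr rfl fun p hp => ?_
    have hp' := Nat.prime_of_mem_primeFactors hp
    have hp0 : (p : ℂ) ≠ 0 := by exact_mod_cast hp'.ne_zero
    have hp1 : (p : ℂ) + 1 ≠ 0 := by exact_mod_cast (Nat.succ_ne_zero p)
    have hp2 : (p : ℂ) - 1 ≠ 0 := by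
      rw [sub_ne_zero]; exact_mod_cast hp'.ne_one
    have hpc : (p : ℂ) ^ (-2 : ℂ) = ((p : ℂ) ^ 2)⁻¹ := by
      rw [Complex.cpow_neg]; norm_cast
    have hp3 : (p : ℂ) ^ 2 - 1 ≠ 0 := by
      rw [show (p : ℂ) ^ 2 - 1 = (p - 1) * (p + 1) by ring]; exact mul_ne_zero hp2 hp1
    rw [hpc]
    have : 1 - ((p : ℂ) ^ 2)⁻¹ = (p ^ 2 - 1) / p ^ 2 := by field_simp
    rw [this]
    field_simp
    ring
  rw [hval] at h
  refine h.congr' ?_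
  filter_upwards [self_mem_nhdsWithin] with w hw
  simp only [Function.comp_apply]
  rw [sqfreeSeries_eq _ hw, one_pow, Pi.div_apply, DirichletCharacter.LFunctionTrivChar, mul_div_assoc]

/-! ### Averages of `χ_d(N)` over fundamental discriminants -/

/-- Some prime `p` divides `n` to an odd power. Take `m` a non-residue mod `p` and `1` modulo `8`
times the squarefree-and-square remainder `b'² c`, so that only the odd power of `J(m | p) = -1`
survives. -/
theorem exists_jacobiSym_eq_neg_one_of_not_isSquare {n : ℕ} (hn : Odd n) (hsq : ¬ IsSquare n) :
    ∃ m : ℕ, m % 8 = 1 ∧ J(m | n) = -1 := by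
  obtain ⟨a, b, ha, hb, hab, hasq⟩ := Nat.sq_mul_squarefree_of_pos hn.pos
  have ha1 : a ≠ 1 := by
    rintro rfl
    exact hsq ⟨b, by rw [← hab]; ring⟩
  obtain ⟨p, hp, c, rfl⟩ := Nat.exists_prime_and_dvd ha1
  have hpc : ¬ p ∣ c := fun h => by
    obtain ⟨e, rfl⟩ := h
    exact hp.ne_one (Nat.isUnit_iff.1 (hasq p ⟨e, by ring⟩))
  obtain ⟨e, b', hb', rfl⟩ := Nat.exists_eq_pow_mul_and_not_dvd hb.ne' p hp.ne_one
  have hc0 : c ≠ 0 := fun h => by simp [h] at ha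
  have hpb : ¬ p ∣ b' ^ 2 * c := fun h => by
    rcases (hp.dvd_mul).1 h with h | h
    · exact hb' (hp.dvd_of_dvd_pow h)
    · exact hpc h
  have hn' : n = p ^ (2 * e + 1) * (b' ^ 2 * c) := by rw [← hab]; ring
  have hp2 : p ≠ 2 := by
    rintro rfl
    rw [hn', pow_succ, Nat.odd_mul, Nat.odd_mul] at hn
    exact absurd hn.1.2 (by decide)
  obtain ⟨u, hu⟩ := exists_jacobiSym_eq_neg_one hp hp2
  have hcop : Nat.Coprime p (8 * (b' ^ 2 * c)) := by
    rw [hp.coprime_iff_not_dvd]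
    intro h
    rcases (hp.dvd_mul).1 h with h | h
    · exact hp2 ((Nat.prime_dvd_prime_iff_eq hp Nat.prime_two).1
        (hp.dvd_of_dvd_pow (show p ∣ 2 ^ 3 by simpa using h)))
    · exact hpb h
  obtain ⟨m, hm1, hm2⟩ := Nat.chineseRemainder hcop u 1
  refine ⟨m, ?_, ?_⟩
  · exact (Nat.ModEq.of_mul_right _ hm2)
  · have h1 : J(m | p) = -1 := by
      rw [← hu]
      exact jacobiSym.mod_left' (Int.natCast_modEq_iff.2 hm1)
    have h2 : J(m | b' ^ 2 * c) = 1 := jacobiSym_eq_one_of_modEq (Nat.ModEq.of_mul_left _ hm2)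
    have hb0 : b' ≠ 0 := fun h => by simp [h] at hb'
    have : NeZero p := ⟨hp.ne_zero⟩
    have : NeZero (b' ^ 2 * c) := ⟨by positivity⟩
    have : NeZero (p ^ (2 * e + 1)) := ⟨by have := hp.pos; positivity⟩
    rw [hn', jacobiSym.mul_right, h2, jacobiSym.pow_right, h1, mul_one, pow_succ, pow_mul]
    norm_num

/-- The function `m ↦ χ₈(m)^a J(m | n)` on odd numbers, extended by zero. -/
def oddSym (a n m : ℕ) : ℤ := if Odd m then ZMod.χ₈ m ^ a * J(m | n) else 0

theorem exists_character_oddSym (a : ℕ) {n : ℕ} (hn : Odd n) :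
    (∃ η : DirichletCharacter ℂ (8 * n), ∀ m : ℕ, η m = oddSym a n m) ∧
      ∃ θ : DirichletCharacter ℂ (8 * n), ∀ m : ℕ, θ m = (ZMod.χ₄ m * oddSym a n m : ℤ) := by
  have h80 : 8 * n ≠ 0 := by have := hn.pos; omega
  have hmul : ∀ x y, oddSym a n (x * y) = oddSym a n x * oddSym a n y := fun x y => by
    unfold oddSym
    by_cases hx : Odd x <;> by_cases hy : Odd y <;>
      simp only [hx, hy, Nat.odd_mul, and_true, and_false, if_true, if_false, mul_zero, zero_mul]
    push_cast
    rw [jacobiSym.mul_left, map_mul, mul_pow]; ring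
  have h1 : oddSym a n 1 = 1 := by simp [oddSym]
  have hc8 : ∀ x : ℕ, ((x % (8 * n) : ℕ) : ZMod 8) = x := fun x => by
    rw [ZMod.natCast_eq_natCast_iff]
    exact Nat.ModEq.of_mul_right n (Nat.mod_modEq _ _)
  have hper : ∀ x, oddSym a n (x % (8 * n)) = oddSym a n x := fun x => by
    have hJ : J((x % (8 * n) : ℕ) | n) = J(x | n) :=
      jacobiSym.mod_left' (Int.natCast_modEq_iff.2 (Nat.ModEq.of_mul_left 8 (Nat.mod_modEq _ _)))
    have ho : Odd (x % (8 * n)) ↔ Odd x := by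
      rw [Nat.odd_iff, Nat.odd_iff]
      have : x % (8 * n) % 2 = x % 2 := Nat.ModEq.of_mul_right (4 * n) (by
        rw [← mul_assoc]; exact Nat.mod_modEq _ _)
      rw [this]
    unfold oddSym
    simp only [ho, hJ, hc8]
  have h0 : ∀ x, ¬ x.Coprime (8 * n) → oddSym a n x = 0 := fun x hx => by
    unfold oddSym
    split_ifs with ho
    · have h8 : x.Coprime 8 := by
        rw [show 8 = 2 ^ 3 by norm_num]
        exact Nat.Coprime.pow_right _ (Nat.coprime_two_right.2 ho)
      have : ¬ x.Coprime n := fun h => hx (Nat.Coprime.mul_right h8 h)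
      have : J(x | n) = 0 := by
        have : NeZero n := ⟨hn.pos.ne'⟩
        rw [jacobiSym.eq_zero_iff_not_coprime]
        rwa [Int.gcd_natCast_natCast]
      rw [this, mul_zero]
    · rfl
  refine ⟨exists_dirichletCharacter h80 _ h1 hmul hper h0,
    exists_dirichletCharacter h80 (fun m => ZMod.χ₄ m * oddSym a n m) (by simp [h1])
      (fun x y => ?_) (fun x => ?_) fun x hx => ?_⟩
  · simp only [hmul]; push_cast; rw [map_mul]; ring
  · have : ((x % (8 * n) : ℕ) : ZMod 4) = x := by
      rw [ZMod.natCast_eq_natCast_iff]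
      exact Nat.ModEq.of_mul_right (2 * n) (by rw [← mul_assoc]; exact Nat.mod_modEq _ _)
    simp only [hper, this]
  · simp only [h0 x hx, mul_zero]

open Classical in
/-- The Dirichlet series `∑* χ_d(N) d^(-w)` over positive fundamental discriminants. -/
def discSeries (N : ℕ) (w : ℂ) : ℂ := ∑' d : ℕ, if IsPosFundDisc d then chi d N * (d : ℂ) ^ (-w) else 0

theorem hasSum_dilate {g : ℕ → ℂ} {S : ℂ} (h : HasSum g S) {c : ℕ} (hc : c ≠ 0) :
    HasSum (fun d : ℕ => if c ∣ d then g (d / c) else 0) S := by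
  have hinj : Function.Injective fun m : ℕ => c * m := fun x y hxy =>
    Nat.eq_of_mul_eq_mul_left (Nat.pos_of_ne_zero hc) hxy
  refine (hinj.hasSum_iff fun d hd => ?_).1 ?_
  · rw [if_neg]
    rintro ⟨m, rfl⟩
    exact hd ⟨m, rfl⟩
  · have : (fun d : ℕ => if c ∣ d then g (d / c) else 0) ∘ (fun m => c * m) = g := funext fun m => by
      simp [Nat.mul_div_cancel_left _ (Nat.pos_of_ne_zero hc)]
    rwa [this]

theorem kronecker_two_pow_mul (d : ℤ) (a : ℕ) {n : ℕ} (hn : Odd n) :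
    kronecker d (2 ^ a * n) = ZMod.χ₈ d ^ a * J(d | n) := by
  have hn0 : n ≠ 0 := hn.pos.ne'
  have h2 : n.factorization 2 = 0 :=
    Nat.factorization_eq_zero_of_not_dvd (by rwa [← even_iff_two_dvd, Nat.not_even_iff_odd])
  have hf : (2 ^ a * n).factorization 2 = a := by
    rw [Nat.factorization_mul (by positivity) hn0, Nat.prime_two.factorization_pow]
    simp [h2]
  rw [kronecker, if_neg (by positivity), hf, Nat.mul_div_cancel_left _ (by positivity)]

theorem oddSym_of_odd {a n m : ℕ} (hm : Odd m) : oddSym a n m = ZMod.χ₈ m ^ a * J(m | n) :=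
  if_pos hm

theorem oddSym_of_even {a n m : ℕ} (hm : Even m) : oddSym a n m = 0 :=
  if_neg (Nat.not_odd_iff_even.2 hm)

theorem not_isPosFundDisc_of_mod {d : ℕ} (h1 : d % 4 ≠ 1) (h0 : ∀ m, d = 4 * m → m % 4 < 2) :
    ¬ IsPosFundDisc d := by
  rintro (⟨h, -⟩ | ⟨m, hd, hm, -⟩)
  · exact h1 h
  · have := h0 m hd; omega

theorem cpow_natCast_mul (c m : ℕ) (w : ℂ) : ((c * m : ℕ) : ℂ) ^ w = (c : ℂ) ^ w * (m : ℂ) ^ w := by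
  push_cast
  exact Complex.natCast_mul_natCast_cpow c m w

-- A fundamental discriminant is a squarefree `m ≡ 1 mod 4`, or `4m` with `m ≡ 3 mod 4` squarefree,
-- or `8m` with `m` odd and squarefree; the classes mod `4` are selected by `(1 ± χ₄)/2`. For even
-- `d` the factor `χ₈(d)^a` vanishes unless `a = 0`, which is the role of `e`.
open Classical in
theorem discSeries_term {a n : ℕ} (hn : Odd n) {e : ℤ} (he : e = if a = 0 then 1 else 0) (w : ℂ) (d : ℕ) :
    (if IsPosFundDisc d then chi d (2 ^ a * n) * (d : ℂ) ^ (-w) else 0) =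
      (if 1 ∣ d then (fun m : ℕ => if Squarefree m then
        1 / 2 * ((oddSym a n m : ℂ) + (ZMod.χ₄ m * oddSym a n m : ℤ)) * (m : ℂ) ^ (-w) else 0) (d / 1) else 0) +
      (if 4 ∣ d then (fun m : ℕ => if Squarefree m then
        e * (4 : ℂ) ^ (-w) / 2 * ((oddSym a n m : ℂ) - (ZMod.χ₄ m * oddSym a n m : ℤ)) * (m : ℂ) ^ (-w)
          else 0) (d / 4) else 0) +
      (if 8 ∣ d then (fun m : ℕ => if Squarefree m then
        e * J(2 | n) * (8 : ℂ) ^ (-w) * (oddSym a n m : ℂ) * (m : ℂ) ^ (-w) else 0) (d / 8) else 0) := by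
  have hchi : chi d (2 ^ a * n) = (ZMod.χ₈ d ^ a * J(d | n) : ℤ) := by
    rw [chi, kronecker_two_pow_mul _ _ hn, Int.cast_natCast]
  rw [if_pos (one_dvd d), Nat.div_one]
  simp only [hchi]
  have hJ2 : J(2 | n) ^ 2 = 1 := by
    apply jacobiSym.sq_one
    rw [Int.gcd_eq_natAbs]; simpa using Nat.coprime_two_left.2 hn
  have hJ4 : J(4 | n) = 1 := by
    rw [show (4 : ℤ) = 2 ^ 2 by norm_num, jacobiSym.pow_left, hJ2]
  have hJ8 : J(8 | n) = J(2 | n) := by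
    rw [show (8 : ℤ) = 2 ^ 2 * 2 by norm_num, jacobiSym.mul_left, jacobiSym.pow_left, hJ2, one_mul]
  have hχ8 : ∀ m : ℕ, Even m → (ZMod.χ₈ (m : ZMod 8) ^ a : ℤ) = e := fun m hm => by
    have : ZMod.χ₈ (m : ZMod 8) = 0 := by
      rw [ZMod.χ₈_nat_eq_if_mod_eight, if_pos (Nat.even_iff.1 hm)]
    rw [this, he]
    split_ifs with h
    · rw [h, pow_zero]
    · rw [zero_pow h]
  rcases (by omega : d % 4 = 0 ∨ d % 4 = 1 ∨ d % 4 = 2 ∨ d % 4 = 3) with h | h | h | h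
  · obtain ⟨m, rfl⟩ := Nat.dvd_of_mod_eq_zero h
    have hnsq : ¬ Squarefree (4 * m) := fun hs => by
      have := hs 2 ⟨m, by ring⟩
      simp at this
    rw [if_neg hnsq, zero_add, if_pos (dvd_mul_right _ _), Nat.mul_div_cancel_left _ (by norm_num : 0 < 4)]
    have h4 : ∀ x : ℕ, 4 * m = 4 * x → x = m := fun x hx => by omega
    rcases (by omega : m % 4 = 0 ∨ m % 4 = 1 ∨ m % 4 = 2 ∨ m % 4 = 3) with hm | hm | hm | hm
    · rw [if_neg (not_isPosFundDisc_of_mod (by omega) fun x hx => by rw [h4 x hx]; omega)]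
      have hev : Even m := Nat.even_iff.2 (by omega)
      obtain ⟨l, rfl⟩ := Nat.dvd_of_mod_eq_zero hm
      rw [oddSym_of_even hev, show 4 * (4 * l) / 8 = 2 * l by omega, oddSym_of_even (even_two_mul l)]
      simp
    · rw [if_neg (not_isPosFundDisc_of_mod (by omega) fun x hx => by rw [h4 x hx]; omega),
        if_neg (by omega : ¬ 8 ∣ 4 * m), ZMod.χ₄_nat_one_mod_four hm]
      simp
    · have hev : Even m := Nat.even_iff.2 (by omega)
      obtain ⟨l, rfl⟩ := even_iff_two_dvd.1 hev
      have hl : Odd l := Nat.odd_iff.2 (by omega)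
      have hiff : IsPosFundDisc (4 * (2 * l)) ↔ Squarefree l := by
        constructor
        · rintro (⟨h', -⟩ | ⟨x, hx, -, hs⟩)
          · omega
          · rw [h4 x hx] at hs
            exact hs.squarefree_of_dvd (dvd_mul_left _ _)
        · intro hs
          refine Or.inr ⟨2 * l, rfl, Or.inl hm, ?_⟩
          rw [Nat.squarefree_mul (Nat.coprime_two_left.2 hl)]
          exact ⟨Nat.prime_two.prime.squarefree, hs⟩
      rw [oddSym_of_even hev, show 4 * (2 * l) = 8 * l by ring, if_pos (dvd_mul_right _ _),
        Nat.mul_div_cancel_left _ (by norm_num : 0 < 8)]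
      rw [show 4 * (2 * l) = 8 * l by ring] at hiff
      simp only [hiff, Int.cast_zero, mul_zero, sub_zero, zero_mul, ite_self, zero_add]
      split_ifs with hs
      · rw [cpow_natCast_mul, hχ8 _ ⟨4 * l, by ring⟩, oddSym_of_odd hl]
        push_cast
        rw [jacobiSym.mul_left, hJ8, he]
        split_ifs with ha
        · subst ha; push_cast; ring
        · push_cast; ring
      · rfl
    · have hodd : Odd m := Nat.odd_iff.2 (by omega)
      have hiff : IsPosFundDisc (4 * m) ↔ Squarefree m := by
        constructor
        · rintro (⟨h', -⟩ | ⟨x, hx, -, hs⟩)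
          · omega
          · rwa [h4 x hx] at hs
        · exact fun hs => Or.inr ⟨m, rfl, Or.inr hm, hs⟩
      rw [if_neg (by omega : ¬ 8 ∣ 4 * m), ZMod.χ₄_nat_three_mod_four hm, add_zero]
      simp only [hiff]
      split_ifs with hs
      · rw [cpow_natCast_mul, hχ8 _ ⟨2 * m, by ring⟩, oddSym_of_odd hodd]
        push_cast
        rw [jacobiSym.mul_left, hJ4, he]
        split_ifs with ha
        · subst ha; push_cast; ring
        · push_cast; ring
      · rfl
  · have hodd : Odd d := Nat.odd_iff.2 (by omega)
    have hiff : IsPosFundDisc d ↔ Squarefree d := by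
      constructor
      · rintro (⟨-, hs⟩ | ⟨x, hx, -, -⟩)
        · exact hs
        · omega
      · exact fun hs => Or.inl ⟨h, hs⟩
    rw [if_neg (by omega : ¬ 4 ∣ d), if_neg (by omega : ¬ 8 ∣ d), add_zero, add_zero]
    simp only [hiff]
    split_ifs with hs
    · rw [ZMod.χ₄_nat_one_mod_four h, oddSym_of_odd hodd]
      push_cast; ring
    · rfl
  · rw [if_neg (not_isPosFundDisc_of_mod (by omega) fun x hx => by omega),
      if_neg (by omega : ¬ 4 ∣ d), if_neg (by omega : ¬ 8 ∣ d), oddSym_of_even (Nat.even_iff.2 (by omega))]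
    simp
  · rw [if_neg (not_isPosFundDisc_of_mod (by omega) fun x hx => by omega),
      if_neg (by omega : ¬ 4 ∣ d), if_neg (by omega : ¬ 8 ∣ d), ZMod.χ₄_nat_three_mod_four h]
    simp

theorem discSeries_eq {a n : ℕ} (hn : Odd n) {e : ℤ} (he : e = if a = 0 then 1 else 0)
    {η θ : DirichletCharacter ℂ (8 * n)} (hη : ∀ m : ℕ, η m = oddSym a n m)
    (hθ : ∀ m : ℕ, θ m = (ZMod.χ₄ m * oddSym a n m : ℤ)) {w : ℂ} (hw : 1 < w.re) :
    discSeries (2 ^ a * n) w = 1 / 2 * (sqfreeSeries η w + sqfreeSeries θ w) +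
      e * (4 : ℂ) ^ (-w) / 2 * (sqfreeSeries η w - sqfreeSeries θ w) +
      e * J(2 | n) * (8 : ℂ) ^ (-w) * sqfreeSeries η w := by
  classical
  have h1 := (summable_sqfreeSeries η hw).of_norm.hasSum
  have h2 := (summable_sqfreeSeries θ hw).of_norm.hasSum
  have g1 := (h1.add h2).mul_left (1 / 2)
  have g2 := (h1.sub h2).mul_left (e * (4 : ℂ) ^ (-w) / 2)
  have g3 := h1.mul_left (e * J(2 | n) * (8 : ℂ) ^ (-w))
  have g := ((hasSum_dilate g1 one_ne_zero).add (hasSum_dilate g2 four_ne_zero)).add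
    (hasSum_dilate g3 (by norm_num : (8 : ℕ) ≠ 0))
  rw [discSeries, tsum_congr (discSeries_term hn he w)]
  refine Eq.trans (tsum_congr fun d => ?_) g.tsum_eq
  congr 1
  · congr 1
    · refine if_congr Iff.rfl ?_ rfl
      dsimp only
      split_ifs
      · rw [hη, hθ]; ring
      · simp
    · refine if_congr Iff.rfl ?_ rfl
      dsimp only
      split_ifs
      · rw [hη, hθ]; ring
      · simp
  · refine if_congr Iff.rfl ?_ rfl
    dsimp only
    split_ifs
    · rw [hη]; ring
    · simp

end QuadTwist
end

noncomputable section

namespace QuadTwist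

open MeasureTheory Filter Set Topology
open scoped NumberTheorySymbols

/-! ### Mean values of `χ_d(N)`: squares against non-squares -/

theorem ne_one_of_eq_neg_one {N m : ℕ} {ψ : DirichletCharacter ℂ N} {x : ℤ} (hψ : ψ m = x)
    (hx : x = -1) : ψ ≠ 1 := by
  rintro rfl
  rw [hx] at hψ
  by_cases h : IsUnit ((m : ZMod N))
  · rw [MulChar.one_apply h] at hψ; norm_num at hψ
  · rw [MulChar.map_nonunit _ h] at hψ; norm_num at hψ

theorem odd_of_mod_eight {m : ℕ} (h : m % 8 = 1 ∨ m % 8 = 3 ∨ m % 8 = 5) : Odd m :=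
  Nat.odd_iff.2 (by omega)

/-- The `m` found is `1 mod 4`, so it witnesses at once that the character and its `χ₄`-twist are
non-trivial. If `a` is odd, `m ≡ 5 mod 8` and `m ≡ 1 mod n` will do; if `a` is even, `n` itself is
not a square. -/
theorem exists_oddSym_eq_neg_one {a n : ℕ} (hn : Odd n) (hsq : ¬ IsSquare (2 ^ a * n)) :
    ∃ m : ℕ, oddSym a n m = -1 ∧ ZMod.χ₄ m * oddSym a n m = -1 := by
  rcases Nat.even_or_odd a with ha | ha
  · have hn' : ¬ IsSquare n := fun h => hsq (by
      obtain ⟨c, rfl⟩ := ha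
      exact IsSquare.mul ⟨2 ^ c, by rw [pow_add]⟩ h)
    obtain ⟨m, hm, hJ⟩ := exists_jacobiSym_eq_neg_one_of_not_isSquare hn hn'
    have : oddSym a n m = -1 := by
      rw [oddSym_of_odd (odd_of_mod_eight (Or.inl hm)), hJ, ZMod.χ₈_nat_eq_if_mod_eight]
      simp [hm, show m % 2 = 1 by omega]
    exact ⟨m, this, by rw [this, ZMod.χ₄_nat_one_mod_four (by omega)]; norm_num⟩
  · have hcop : Nat.Coprime 8 n := by
      rw [show 8 = 2 ^ 3 by norm_num]
      exact Nat.Coprime.pow_left _ (Nat.coprime_two_left.2 hn)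
    obtain ⟨m, hm1, hm2⟩ := Nat.chineseRemainder hcop 5 1
    have hm : m % 8 = 5 := hm1
    have : oddSym a n m = -1 := by
      rw [oddSym_of_odd (odd_of_mod_eight (by omega)), jacobiSym_eq_one_of_modEq hm2,
        ZMod.χ₈_nat_eq_if_mod_eight]
      simp [hm, show m % 2 = 1 by omega, ha.neg_one_pow]
    exact ⟨m, this, by rw [this, ZMod.χ₄_nat_one_mod_four (by omega)]; norm_num⟩

/-- When `2^a n` is a square, `a` is even and `n` is a square, so the character is principal. Its
`χ₄`-twist is not, as `m ≡ 3 mod 8` coprime to `n` shows. -/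
theorem oddSym_of_isSquare {a n : ℕ} (hn : Odd n) (hsq : IsSquare (2 ^ a * n)) :
    (∀ m : ℕ, IsUnit (m : ZMod (8 * n)) → oddSym a n m = 1) ∧
      ∃ m : ℕ, ZMod.χ₄ m * oddSym a n m = -1 := by
  have hn0 : n ≠ 0 := hn.pos.ne'
  have hcop : Nat.Coprime (2 ^ a) n := Nat.Coprime.pow_left _ (Nat.coprime_two_left.2 hn)
  have h1 : IsSquare (2 ^ a : ℕ) ∧ IsSquare n := by
    obtain ⟨r, hr⟩ := hsq
    constructor
    · obtain ⟨c, hc⟩ := exists_eq_pow_of_mul_eq_pow (α := ℕ) (k := 2) (a := 2 ^ a) (b := n) (c := r)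
        (Nat.isUnit_iff.2 hcop) (by rw [hr, sq])
      exact ⟨c, by rw [hc, sq]⟩
    · obtain ⟨c, hc⟩ := exists_eq_pow_of_mul_eq_pow (α := ℕ) (k := 2) (a := n) (b := 2 ^ a) (c := r)
        (Nat.isUnit_iff.2 hcop.symm) (by rw [mul_comm, hr, sq])
      exact ⟨c, by rw [hc, sq]⟩
  have ha : Even a := by
    obtain ⟨c, hc⟩ := h1.1
    have := congrArg (fun x => x.factorization 2) hc
    have hc0 : c ≠ 0 := by rintro rfl; simp at hc
    simp only [Nat.factorization_mul hc0 hc0, Nat.prime_two.factorization_pow, Finsupp.add_apply,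
      Finsupp.single_apply, if_true] at this
    exact ⟨_, this⟩
  have hval : ∀ m : ℕ, Odd m → m.Coprime n → oddSym a n m = 1 := fun m hm hmn => by
    obtain ⟨c, hc⟩ := h1.2
    have hc0 : c ≠ 0 := by rintro rfl; exact hn0 (by simpa using hc)
    have : NeZero c := ⟨hc0⟩
    have hJ : J(m | n) = 1 := by
      rw [hc, jacobiSym.mul_right, ← sq]
      apply jacobiSym.sq_one
      rw [Int.gcd_natCast_natCast]
      exact Nat.Coprime.coprime_mul_right_right (hc ▸ hmn)
    have h8 : (ZMod.χ₈ (m : ZMod 8)) = 1 ∨ ZMod.χ₈ (m : ZMod 8) = -1 := by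
      rw [ZMod.χ₈_nat_eq_if_mod_eight, if_neg (by rw [Nat.odd_iff.1 hm]; norm_num)]
      split_ifs <;> simp
    rw [oddSym_of_odd hm, hJ, mul_one]
    rcases h8 with h | h
    · rw [h, one_pow]
    · rw [h, ha.neg_one_pow]
  constructor
  · intro m hm
    rw [ZMod.isUnit_iff_coprime] at hm
    refine hval m ?_ hm.coprime_mul_left_right
    exact Nat.coprime_two_right.1 ((show 8 * n = 2 * (4 * n) by ring) ▸ hm).coprime_mul_right_right
  · have hcop : Nat.Coprime 8 n := by
      rw [show 8 = 2 ^ 3 by norm_num]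
      exact Nat.Coprime.pow_left _ (Nat.coprime_two_left.2 hn)
    obtain ⟨m, hm1, hm2⟩ := Nat.chineseRemainder hcop 3 1
    have hm : m % 8 = 3 := hm1
    have hmn : m.Coprime n := by
      rw [Nat.Coprime, hm2.gcd_eq, Nat.gcd_one_left]
    exact ⟨m, by rw [hval m (odd_of_mod_eight (by omega)) hmn, ZMod.χ₄_nat_three_mod_four (by omega)]; norm_num⟩

theorem arithA_eight_mul {n : ℕ} (hn : Odd n) : arithA (8 * n) = 2 / 3 * arithA n := by
  have h : (8 * n).primeFactors = insert 2 n.primeFactors := by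
    rw [Nat.primeFactors_mul (by norm_num) hn.pos.ne', show 8 = 2 ^ 3 by norm_num,
      Nat.primeFactors_prime_pow (by norm_num) Nat.prime_two]
    rfl
  rw [arithA, h, Finset.prod_insert, arithA]
  · norm_num
  · intro h2
    exact (Nat.not_even_iff_odd.2 hn) (even_iff_two_dvd.2 (Nat.dvd_of_mem_primeFactors h2))

theorem arithA_two_pow_mul {a n : ℕ} (ha : a ≠ 0) (hn : Odd n) :
    arithA (2 ^ a * n) = arithA (8 * n) := by
  rw [arithA, arithA, Nat.primeFactors_mul (by positivity) hn.pos.ne',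
    Nat.primeFactors_mul (by norm_num) hn.pos.ne', Nat.primeFactors_prime_pow ha Nat.prime_two,
    show 8 = 2 ^ 3 by norm_num, Nat.primeFactors_prime_pow (by norm_num) Nat.prime_two]

open Classical in
theorem tendsto_discSeries {N : ℕ} (hN : N ≠ 0) :
    Tendsto (fun w : ℝ => ((w : ℂ) - 1) * discSeries N w) (𝓝[>] 1)
      (𝓝 (if IsSquare N then arithA N / (2 * riemannZeta 2) else 0)) := by
  obtain ⟨a, n, rfl, hn, -, -⟩ := two_pow_factorization_mul N hN
  have : NeZero (8 * n) := ⟨by have := hn.pos; omega⟩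
  obtain ⟨⟨η, hη⟩, θ, hθ⟩ := exists_character_oddSym a hn
  set e : ℤ := if a = 0 then 1 else 0 with he
  set L : ℂ := if IsSquare (2 ^ a * n) then arithA (8 * n) / riemannZeta 2 else 0 with hL
  have hθ1 : θ ≠ 1 := by
    by_cases hsq : IsSquare (2 ^ a * n)
    · obtain ⟨m, hm⟩ := (oddSym_of_isSquare hn hsq).2
      exact ne_one_of_eq_neg_one (hθ m) hm
    · obtain ⟨m, -, hm⟩ := exists_oddSym_eq_neg_one hn hsq
      exact ne_one_of_eq_neg_one (hθ m) hm
  have tη : Tendsto (fun w : ℝ => ((w : ℂ) - 1) * sqfreeSeries η w) (𝓝[>] 1) (𝓝 L) := by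
    by_cases hsq : IsSquare (2 ^ a * n)
    · have : η = 1 := by
        refine MulChar.ext' fun x => ?_
        obtain ⟨m, rfl⟩ := ZMod.natCast_zmod_surjective x
        by_cases hm : IsUnit (m : ZMod (8 * n))
        · rw [hη, (oddSym_of_isSquare hn hsq).1 m hm, MulChar.one_apply hm]; simp
        · rw [MulChar.map_nonunit _ hm, MulChar.map_nonunit _ hm]
      rw [this, hL, if_pos hsq]
      exact tendsto_sqfreeSeries_one (8 * n)
    · obtain ⟨m, hm, -⟩ := exists_oddSym_eq_neg_one hn hsq
      rw [hL, if_neg hsq]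
      exact tendsto_sqfreeSeries_of_ne_one (ne_one_of_eq_neg_one (hη m) hm)
  have tθ := tendsto_sqfreeSeries_of_ne_one hθ1
  have tpow : ∀ c : ℕ, c ≠ 0 → Tendsto (fun w : ℝ => (c : ℂ) ^ (-(w : ℂ))) (𝓝[>] 1) (𝓝 ((c : ℂ)⁻¹)) := fun c hc => by
    have : Continuous fun w : ℝ => (c : ℂ) ^ (-(w : ℂ)) := by
      refine Continuous.const_cpow (by fun_prop) (Or.inl (by exact_mod_cast hc))
    have h := this.tendsto 1
    rw [Complex.ofReal_one, Complex.cpow_neg_one] at h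
    exact h.mono_left nhdsWithin_le_nhds
  have t4 := tpow 4 (by norm_num)
  have t8 := tpow 8 (by norm_num)
  have key := (((tη.add tθ).const_mul (1 / 2)).add
    (((t4.const_mul (e : ℂ)).div_const 2).mul (tη.sub tθ))).add
    ((t8.const_mul ((e : ℂ) * J(2 | n))).mul tη)
  -- For `a = 0` the three classes contribute `1/2 + 1/8 + 1/8 = 3/4` of `L`, and `a(8n) = (2/3)
  -- a(n)` brings this to one half. For `a > 0` only odd discriminants count, giving one half at
  -- once, with `a(2^a n) = a(8n)`.
  have hlim : (1 / 2 * (L + 0) + (e : ℂ) * ((4 : ℕ) : ℂ)⁻¹ / 2 * (L - 0) +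
      (e : ℂ) * J(2 | n) * ((8 : ℕ) : ℂ)⁻¹ * L) =
      if IsSquare (2 ^ a * n) then arithA (2 ^ a * n) / (2 * riemannZeta 2) else 0 := by
    by_cases hsq : IsSquare (2 ^ a * n)
    · have hz : riemannZeta 2 ≠ 0 := riemannZeta_ne_zero_of_one_le_re (by norm_num)
      rw [hL, if_pos hsq, if_pos hsq, he]
      by_cases ha : a = 0
      · subst ha
        have hJ : J(2 | n) = 1 := by
          obtain ⟨c, hc⟩ := hsq
          rw [pow_zero, one_mul] at hc
          have hc0 : c ≠ 0 := by rintro rfl; exact hn.pos.ne' (by simpa using hc)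
          have : NeZero c := ⟨hc0⟩
          rw [hc, jacobiSym.mul_right, ← sq]
          apply jacobiSym.sq_one
          have hco : Odd c := by rw [hc, Nat.odd_mul] at hn; exact hn.1
          rw [Int.gcd_eq_natAbs]; simpa using Nat.coprime_two_left.2 hco
        rw [hJ, if_pos rfl, pow_zero, one_mul, arithA_eight_mul hn]
        push_cast
        field_simp
        ring
      · rw [if_neg ha, arithA_two_pow_mul ha hn]
        push_cast
        field_simp
        ring
    · rw [hL, if_neg hsq, if_neg hsq]; simp
  rw [hlim] at key
  refine key.congr' ?_
  filter_upwards [self_mem_nhdsWithin] with w (hw : 1 < w)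
  rw [discSeries_eq hn he hη hθ (by simpa using hw)]
  push_cast
  ring

/-! ### Size and multiplicativity of `χ_d` -/

theorem norm_chi_le (d n : ℕ) : ‖chi d n‖ ≤ 1 := by
  have hj : ∀ (a : ℤ) (b : ℕ), |J(a | b)| ≤ 1 := fun a b => by
    rcases jacobiSym.trichotomy a b with h | h | h <;> simp [h]
  have h8 : ∀ x : ZMod 8, |ZMod.χ₈ x| ≤ 1 := by decide
  have : |kronecker d n| ≤ 1 := by
    unfold kronecker
    split_ifs
    · simp
    · simp
    · rw [abs_mul, abs_pow]
      exact mul_le_one₀ (pow_le_one₀ (abs_nonneg _) (h8 _)) (abs_nonneg _) (hj _ _)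
  rw [chi, Complex.norm_intCast]
  exact_mod_cast this

theorem chi_mul (d : ℕ) {m n : ℕ} (hm : m ≠ 0) (hn : n ≠ 0) : chi d (m * n) = chi d m * chi d n := by
  obtain ⟨a, m', rfl, hm', -, -⟩ := two_pow_factorization_mul m hm
  obtain ⟨b, n', rfl, hn', -, -⟩ := two_pow_factorization_mul n hn
  have : NeZero m' := ⟨hm'.pos.ne'⟩
  have : NeZero n' := ⟨hn'.pos.ne'⟩
  rw [chi, chi, chi, show 2 ^ a * m' * (2 ^ b * n') = 2 ^ (a + b) * (m' * n') by ring,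
    kronecker_two_pow_mul _ _ hm', kronecker_two_pow_mul _ _ hn',
    kronecker_two_pow_mul _ _ (hm'.mul hn'), jacobiSym.mul_right]
  push_cast
  ring

theorem chi_prod (d : ℕ) {ι : Type*} (t : Finset ι) {g : ι → ℕ} (hg : ∀ i ∈ t, g i ≠ 0) :
    chi d (∏ i ∈ t, g i) = ∏ i ∈ t, chi d (g i) := by
  classical
  induction t using Finset.induction_on with
  | empty => simp [chi, kronecker]
  | insert i t hi ih =>
    rw [Finset.prod_insert hi, Finset.prod_insert hi, chi_mul d (hg i (by simp))
      (Finset.prod_ne_zero_iff.2 fun j hj => hg j (by simp [hj])), ih fun j hj => hg j (by simp [hj])]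

/-- `(w - 1) ζ(w) → 1 < 2` gives a bound uniform in `N`, the majorant needed to pass to the limit
inside the sum over `n_1, …, n_k`. -/
theorem eventually_norm_discSeries_le :
    ∀ᶠ w : ℝ in 𝓝[>] 1, ∀ N : ℕ, ‖((w : ℂ) - 1) * discSeries N w‖ ≤ 2 := by
  classical
  filter_upwards [tendsto_sub_mul_tsum_nat_rpow.eventually (ge_mem_nhds one_lt_two),
    self_mem_nhdsWithin] with w h2 (hw : 1 < w) N
  have hs : Summable fun d : ℕ => 1 / (d : ℝ) ^ w := Real.summable_one_div_nat_rpow.2 hw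
  have hb : ∀ d : ℕ, ‖(if IsPosFundDisc d then chi d N * (d : ℂ) ^ (-(w : ℂ)) else 0)‖ ≤
      1 / (d : ℝ) ^ w := fun d => by
    split_ifs with h
    · rw [norm_mul, Complex.norm_natCast_cpow_of_pos h.pos, Complex.neg_re, Complex.ofReal_re,
        Real.rpow_neg (by positivity), one_div]
      exact mul_le_of_le_one_left (by positivity) (norm_chi_le d N)
    · rw [norm_zero]; positivity
  have h1 : ‖discSeries N w‖ ≤ ∑' d : ℕ, 1 / (d : ℝ) ^ w := tsum_of_norm_bounded hs.hasSum hb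
  have hw1 : 0 < w - 1 := by linarith
  rw [norm_mul, show (w : ℂ) - 1 = ((w - 1 : ℝ) : ℂ) by push_cast; rfl, Complex.norm_real,
    Real.norm_eq_abs, abs_of_pos hw1]
  exact le_trans (by gcongr) h2

/-! ### The residue of the multiple Dirichlet series -/

theorem summable_norm_pi_prod_and_tsum {β : Type*} {k : ℕ} (a : Fin k → β → ℂ)
    (ha : ∀ j, Summable fun b => ‖a j b‖) :
    (Summable fun n : Fin k → β => ‖∏ j, a j (n j)‖) ∧
      ∑' n : Fin k → β, ∏ j, a j (n j) = ∏ j, ∑' b, a j b := by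
  induction k with
  | zero =>
    constructor
    · exact Summable.of_finite
    · simp [tsum_fintype]
  | succ k ih =>
    obtain ⟨ih1, ih2⟩ := ih (fun j => a j.succ) fun j => ha j.succ
    have hsum := summable_mul_of_summable_norm (ha 0) ih1
    have he : ∀ p : β × (Fin k → β), ∏ j, a j (Fin.consEquiv (fun _ => β) p j) =
        a 0 p.1 * ∏ j, a j.succ (p.2 j) := fun p => by
      rw [Fin.prod_univ_succ]; simp [Fin.consEquiv]
    constructor
    · rw [← (Fin.consEquiv fun _ => β).summable_iff]
      refine (Summable.norm hsum).congr fun p => ?_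
      simp only [Function.comp_apply, he]
    · rw [← (Fin.consEquiv fun _ => β).tsum_eq, Fin.prod_univ_succ, ← ih2,
        tsum_mul_tsum_of_summable_norm (ha 0) ih1]
      exact tsum_congr he

variable {κ : ℤ}

theorem summable_coeffA_pnat (f : CuspForm 𝒮ℒ κ) (hκ : 0 < κ) {s : ℂ} (hs : 1 < s.re) :
    Summable fun n : ℕ+ => ‖coeffA f n / ((n : ℕ) : ℂ) ^ s‖ := by
  have h := (summable_coeffA f hκ hs).comp_injective PNat.coe_injective
  refine h.congr fun n => ?_
  rw [norm_div, Complex.norm_natCast_cpow_of_pos n.pos]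
  rfl

theorem LSeries_eq_tsum_pnat (a : ℕ → ℂ) (s : ℂ) :
    LSeries a s = ∑' n : ℕ+, a n / ((n : ℕ) : ℂ) ^ s := by
  rw [LSeries, ← PNat.coe_injective.tsum_eq]
  · exact tsum_congr fun n => LSeries.term_of_ne_zero n.ne_zero a s
  · intro n hn
    have hn0 : n ≠ 0 := by
      rintro rfl
      simp at hn
    exact ⟨⟨n, Nat.pos_of_ne_zero hn0⟩, rfl⟩

/-- In the region of absolute convergence the `L`-series may be expanded and the sum over `d` taken
innermost. -/
theorem mds_eq_tsum (f : CuspForm 𝒮ℒ κ) (hκ : 0 < κ) {k M : ℕ} (hM : 1 ≤ M) {s : Fin k → ℂ}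
    (hs : ∀ j, 1 < (s j).re) {w : ℂ} (hw : 1 < w.re) :
    mds f M s w = ∑' n : Fin k → ℕ+, (∏ j, coeffA f (n j) / ((n j : ℕ) : ℂ) ^ s j) *
      discSeries (M * ∏ j, (n j : ℕ)) w := by
  classical
  set c : (Fin k → ℕ+) → ℂ := fun n => ∏ j, coeffA f (n j) / ((n j : ℕ) : ℂ) ^ s j with hc
  have hcs : Summable fun n => ‖c n‖ :=
    (summable_norm_pi_prod_and_tsum (fun j (n : ℕ+) => coeffA f n / ((n : ℕ) : ℂ) ^ s j)
      fun j => summable_coeffA_pnat f hκ (hs j)).1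
  set t : ℕ → (Fin k → ℕ+) → ℂ := fun d n => c n *
    (if IsPosFundDisc d then chi d (M * ∏ j, (n j : ℕ)) * (d : ℂ) ^ (-w) else 0) with ht
  have hd : Summable fun d : ℕ => ‖1 / (d : ℝ) ^ w.re‖ :=
    (Real.summable_one_div_nat_rpow.2 hw).norm
  have hts : Summable (Function.uncurry t) := by
    have h := summable_mul_of_summable_norm hd (f := fun d : ℕ => 1 / (d : ℝ) ^ w.re)
      (g := fun n => ‖c n‖) (by simpa using hcs)
    refine Summable.of_norm_bounded h fun p => ?_
    simp only [Function.uncurry, ht]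
    rw [norm_mul, mul_comm]
    gcongr
    split_ifs with hp
    · rw [norm_mul, Complex.norm_natCast_cpow_of_pos hp.pos, Complex.neg_re,
        Real.rpow_neg (by positivity), one_div]
      exact mul_le_of_le_one_left (by positivity) (norm_chi_le _ _)
    · rw [norm_zero]; positivity
  have h1 : mds f M s w = ∑' d, ∑' n, t d n := by
    refine tsum_congr fun d => ?_
    split_ifs with hd
    · have hL : ∏ j, twistedL f d (s j) = ∑' n : Fin k → ℕ+, c n * chi d (∏ j, (n j : ℕ)) := by
        have ha : ∀ j, Summable fun n : ℕ+ => ‖coeffA f n * chi d n / ((n : ℕ) : ℂ) ^ s j‖ := fun j => by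
          refine Summable.of_nonneg_of_le (fun n => norm_nonneg _) (fun n => ?_)
            (summable_coeffA_pnat f hκ (hs j))
          rw [norm_div, norm_div, norm_mul]
          gcongr
          exact mul_le_of_le_one_right (norm_nonneg _) (norm_chi_le _ _)
        have h := (summable_norm_pi_prod_and_tsum _ ha).2
        rw [Finset.prod_congr rfl fun j _ => (hd.twistedL_eq f hκ (hs j)).trans
          (LSeries_eq_tsum_pnat _ _), ← h]
        refine tsum_congr fun n => ?_
        rw [chi_prod d Finset.univ fun j _ => (n j).ne_zero, hc, ← Finset.prod_mul_distrib]
        exact Finset.prod_congr rfl fun j _ => by ring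
      rw [hL, mul_div_assoc, ← tsum_div_const, ← tsum_mul_left]
      refine tsum_congr fun n => ?_
      simp only [ht, if_pos hd]
      rw [chi_mul d (by omega) (Finset.prod_ne_zero_iff.2 fun j _ => (n j).ne_zero), Complex.cpow_neg]
      ring
    · simp [ht, hd]
  rw [h1, ← Summable.tsum_comm hts]
  refine tsum_congr fun n => ?_
  rw [discSeries, ← tsum_mul_left]

/-- Dominated convergence: each inner sum over `d` tends to the mean value of `χ_d`, so only `M n_1
⋯ n_k = □` survives. -/
theorem tendsto_mds (f : CuspForm 𝒮ℒ κ) (hκ : 0 < κ) {k M : ℕ} (hM : 1 ≤ M) {s : Fin k → ℂ}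
    (hs : ∀ j, 1 < (s j).re) :
    Tendsto (fun w : ℝ => ((w : ℂ) - 1) * mds f M s w) (𝓝[>] 1) (𝓝 (seriesH f M s)) := by
  classical
  set c : (Fin k → ℕ+) → ℂ := fun n => ∏ j, coeffA f (n j) / ((n j : ℕ) : ℂ) ^ s j with hc
  have hcs : Summable fun n => ‖c n‖ :=
    (summable_norm_pi_prod_and_tsum (fun j (n : ℕ+) => coeffA f n / ((n : ℕ) : ℂ) ^ s j)
      fun j => summable_coeffA_pnat f hκ (hs j)).1
  have h := tendsto_tsum_of_dominated_convergence (𝓕 := 𝓝[>] (1 : ℝ))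
    (f := fun (w : ℝ) n => c n * (((w : ℂ) - 1) * discSeries (M * ∏ j, (n j : ℕ)) w))
    (g := fun n => c n * (if IsSquare (M * ∏ j, (n j : ℕ)) then
      arithA (M * ∏ j, (n j : ℕ)) / (2 * riemannZeta 2) else 0))
    (bound := fun n => ‖c n‖ * 2) (hcs.mul_right 2)
    (fun n => (tendsto_discSeries (mul_ne_zero (by omega)
      (Finset.prod_ne_zero_iff.2 fun j _ => (n j).ne_zero))).const_mul _)
    (by
      filter_upwards [eventually_norm_discSeries_le] with w hw n
      rw [norm_mul]
      gcongr
      exact hw _)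
  have hlim : (∑' n, c n * (if IsSquare (M * ∏ j, (n j : ℕ)) then
      arithA (M * ∏ j, (n j : ℕ)) / (2 * riemannZeta 2) else 0)) = seriesH f M s := by
    rw [seriesH, ← tsum_mul_left]
    refine tsum_congr fun n => ?_
    split_ifs
    · simp only [hc, Finset.prod_div_distrib]; ring
    · simp
  rw [hlim] at h
  refine h.congr' ?_
  filter_upwards [self_mem_nhdsWithin] with w (hw : 1 < w)
  rw [mds_eq_tsum f hκ hM hs (by simpa using hw), ← tsum_mul_left]
  exact tsum_congr fun n => by ring

end QuadTwist
end

noncomputable section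

namespace QuadTwist

open MeasureTheory Filter Set Metric Topology

/-! ### Growth in imaginary directions -/

theorem differentiableOn_finsetProd {E ι : Type*} [NormedAddCommGroup E] [NormedSpace ℂ E] {U : Set E}
    (t : Finset ι) {g : ι → E → ℂ} (hg : ∀ i ∈ t, DifferentiableOn ℂ (g i) U) :
    DifferentiableOn ℂ (fun x => ∏ i ∈ t, g i x) U := by
  classical
  induction t using Finset.induction_on with
  | empty => simp
  | insert i t hi ih =>
    simp_rw [Finset.prod_insert hi]
    exact (hg i (by simp)).mul (ih fun j hj => hg j (by simp [hj]))

theorem one_le_prod_one_add_sq {n : ℕ} (t : Fin n → ℝ) : 1 ≤ ∏ i, (1 + t i ^ 2) :=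
  Finset.one_le_prod fun i _ => by nlinarith [sq_nonneg (t i)]

theorem one_add_sq_le_prod {n : ℕ} (t : Fin n → ℝ) (i : Fin n) : 1 + t i ^ 2 ≤ ∏ i, (1 + t i ^ 2) := by
  rw [← Finset.mul_prod_erase _ _ (Finset.mem_univ i)]
  exact le_mul_of_one_le_right (by positivity)
    (Finset.one_le_prod fun i _ => by nlinarith [sq_nonneg (t i)])

theorem exists_abs_eval_le {n : ℕ} (P : MvPolynomial (Fin n) ℝ) :
    ∃ C : ℝ, ∃ N : ℕ, 0 ≤ C ∧ ∀ t : Fin n → ℝ, |MvPolynomial.eval t P| ≤ C * (∏ i, (1 + t i ^ 2)) ^ N := by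
  induction P using MvPolynomial.induction_on with
  | C a => exact ⟨|a|, 0, abs_nonneg a, fun t => by simp⟩
  | add p q hp hq =>
    obtain ⟨C, N, hC, h⟩ := hp
    obtain ⟨C', N', hC', h'⟩ := hq
    refine ⟨C + C', N + N', by positivity, fun t => ?_⟩
    have h1 := one_le_prod_one_add_sq t
    rw [map_add, add_mul]
    refine (abs_add_le _ _).trans (add_le_add ((h t).trans ?_) ((h' t).trans ?_))
    · gcongr; omega
    · gcongr; omega
  | mul_X p i hp =>
    obtain ⟨C, N, hC, h⟩ := hp
    refine ⟨C, N + 1, hC, fun t => ?_⟩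
    rw [map_mul, MvPolynomial.eval_X, abs_mul, pow_succ, ← mul_assoc]
    have h2 : |t i| ≤ ∏ i, (1 + t i ^ 2) := by
      refine le_trans ?_ (one_add_sq_le_prod t i)
      nlinarith [sq_nonneg (|t i| - 1), sq_abs (t i), abs_nonneg (t i)]
    have := one_le_prod_one_add_sq t
    gcongr
    exact h t

variable {k : ℕ}

/-- Growth of order at most `N` in imaginary directions, up to a factor `e^{π|Im s_j|}`, locally
uniformly in the tube over `U`. -/
def LocGrowth (N : ℕ) (U : Set (Fin (k + 1) → ℝ)) (G : (Fin (k + 1) → ℂ) → ℂ) : Prop :=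
  ∀ σ ∈ U, ∃ r > 0, ∃ C, 0 ≤ C ∧ ∀ z : Fin (k + 1) → ℂ, (fun i => (z i).re) ∈ ball σ r →
    ‖G z‖ ≤ C * (∏ i, (1 + (z i).im ^ 2)) ^ N * Real.exp (Real.pi * ∑ j : Fin k, |(z j.castSucc).im|)

theorem LocGrowth.mono {N N' : ℕ} {U U' : Set (Fin (k + 1) → ℝ)} {G : (Fin (k + 1) → ℂ) → ℂ}
    (h : LocGrowth N U G) (hN : N ≤ N') (hU : U' ⊆ U) : LocGrowth N' U' G := fun σ hσ => by
  obtain ⟨r, hr, C, hC0, hC⟩ := h σ (hU hσ)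
  refine ⟨r, hr, C, hC0, fun z hz => (hC z hz).trans ?_⟩
  have := one_le_prod_one_add_sq fun i => (z i).im
  gcongr

theorem LocGrowth.mul {N N' : ℕ} {U : Set (Fin (k + 1) → ℝ)} {G H : (Fin (k + 1) → ℂ) → ℂ}
    (hH : ∀ σ ∈ U, ∃ r > 0, ∃ C, 0 ≤ C ∧ ∀ z : Fin (k + 1) → ℂ, (fun i => (z i).re) ∈ ball σ r →
      ‖H z‖ ≤ C * (∏ i, (1 + (z i).im ^ 2)) ^ N') (hG : LocGrowth N U G) :
    LocGrowth (N' + N) U fun z => H z * G z := fun σ hσ => by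
  obtain ⟨r, hr, C, hC0, hC⟩ := hG σ hσ
  obtain ⟨r', hr', C', hC0', hC'⟩ := hH σ hσ
  refine ⟨min r r', by positivity, C' * C, by positivity, fun z hz => ?_⟩
  have h1 := hC z (ball_subset_ball (min_le_left _ _) hz)
  have h2 := hC' z (ball_subset_ball (min_le_right _ _) hz)
  have := one_le_prod_one_add_sq fun i => (z i).im
  rw [norm_mul]
  refine (mul_le_mul h2 h1 (norm_nonneg _) (by positivity)).trans (le_of_eq ?_)
  ring

/-- The weight `e^{∑ s_j²} (w + m)^{-(2m+2)}`. -/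
def gaussWeight (m : ℕ) (z : Fin (k + 1) → ℂ) : ℂ :=
  Complex.exp (∑ j : Fin k, z j.castSucc ^ 2) * ((z (Fin.last k) + m) ^ (2 * m + 2))⁻¹

/-- A quarter of the Gaussian exponent absorbs the polynomial and half of it absorbs `π|t|`, leaving
the constant `π²/2 + 1/4`. -/
theorem exp_mul_pow_le (M : ℕ) (t : ℝ) :
    Real.exp (Real.pi * |t| - t ^ 2) * (1 + t ^ 2) ^ M ≤
      Real.exp (Real.pi ^ 2 / 2 + 1 / 4) * (4 ^ M * M.factorial) := by
  have h1 := Real.pow_div_factorial_le_exp (x := (1 + t ^ 2) / 4) (by positivity) M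
  rw [div_pow, div_div, div_le_iff₀ (by positivity)] at h1
  calc _ ≤ Real.exp (Real.pi * |t| - t ^ 2) * (Real.exp ((1 + t ^ 2) / 4) * (4 ^ M * M.factorial)) :=
        mul_le_mul_of_nonneg_left h1 (Real.exp_pos _).le
    _ = Real.exp (Real.pi * |t| - t ^ 2 + (1 + t ^ 2) / 4) * (4 ^ M * M.factorial) := by
        rw [Real.exp_add]; ring
    _ ≤ _ := by
        refine mul_le_mul_of_nonneg_right (Real.exp_le_exp.2 ?_) (by positivity)
        nlinarith [sq_nonneg (|t| - Real.pi), sq_abs t, sq_nonneg t]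

/-- The Gaussian beats both the polynomial and `e^{π|Im s_j|}`. In `w` only a power is spent:
modulus `(1 + t²)^{-(m+1)}` up to constants, against growth `(1 + t²)^m`. A Gaussian in `w` would,
once divided out, leave growth that the Mellin transform of a test function could not beat. -/
theorem LocGrowth.tubeDecay {m : ℕ} {U : Set (Fin (k + 1) → ℝ)} {G : (Fin (k + 1) → ℂ) → ℂ}
    (hG : LocGrowth m U G) (hU : ∀ σ ∈ U, -(m : ℝ) < σ (Fin.last k)) :
    TubeDecay U fun z => G z * gaussWeight m z := fun σ hσ => by
  obtain ⟨r, hr, C, hC0, hC⟩ := hG σ hσ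
  set η := (σ (Fin.last k) + m) / 2 with hη
  have hη0 : 0 < η := by have := hU σ hσ; rw [hη]; linarith
  set η' := min (η ^ 2) 1 with hη'
  have hη'0 : 0 < η' := lt_min (by positivity) one_pos
  set A : Fin k → ℝ := fun j => (|σ j.castSucc| + r) ^ 2 with hA
  set B := Real.exp (Real.pi ^ 2 / 2 + 1 / 4) * (4 ^ (m + 1) * (m + 1).factorial) with hB
  have hB0 : 0 ≤ B := by positivity
  refine ⟨min r η, by positivity, C * (∏ j, Real.exp (A j)) * (η' ^ (m + 1))⁻¹ * B ^ k, fun z hz => ?_⟩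
  have h1 := hC z (ball_subset_ball (min_le_left _ _) hz)
  rw [mem_ball, dist_pi_lt_iff (by positivity)] at hz
  have hw : η < (z (Fin.last k)).re + m := by
    have := (hz (Fin.last k)).trans_le (min_le_right _ _)
    rw [Real.dist_eq, abs_lt] at this
    rw [hη] at this ⊢
    linarith
  have hwn : ‖((z (Fin.last k) + m) ^ (2 * m + 2))⁻¹‖ ≤
      (η' ^ (m + 1))⁻¹ * ((1 + (z (Fin.last k)).im ^ 2) ^ (m + 1))⁻¹ := by
    rw [norm_inv, norm_pow, ← mul_inv, ← mul_pow, show 2 * m + 2 = 2 * (m + 1) by ring, pow_mul]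
    apply inv_anti₀ (by positivity)
    gcongr
    rw [Complex.sq_norm, Complex.normSq_apply]
    simp only [Complex.add_re, Complex.natCast_re, Complex.add_im, Complex.natCast_im, add_zero]
    have e1 : η' ≤ η ^ 2 := min_le_left _ _
    have e2 : η' ≤ 1 := min_le_right _ _
    nlinarith [mul_le_mul_of_nonneg_right e2 (sq_nonneg (z (Fin.last k)).im)]
  have hs : ∀ j : Fin k, ‖Complex.exp (z j.castSucc ^ 2)‖ ≤
      Real.exp (A j) * Real.exp (-(z j.castSucc).im ^ 2) := fun j => by
    rw [Complex.norm_exp, ← Real.exp_add]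
    apply Real.exp_le_exp.2
    have := (hz j.castSucc).trans_le (min_le_left _ _)
    rw [Real.dist_eq] at this
    have h3 : |(z j.castSucc).re| ≤ |σ j.castSucc| + r := by
      have := abs_sub_abs_le_abs_sub (z j.castSucc).re (σ j.castSucc)
      linarith
    have h4 : (z j.castSucc).re ^ 2 ≤ A j := by
      rw [← sq_abs]
      exact pow_le_pow_left₀ (abs_nonneg _) h3 2
    rw [sq, Complex.mul_re]
    nlinarith
  have hG' : ‖gaussWeight m z‖ ≤ (∏ j : Fin k, (Real.exp (A j) * Real.exp (-(z j.castSucc).im ^ 2))) *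
      ((η' ^ (m + 1))⁻¹ * ((1 + (z (Fin.last k)).im ^ 2) ^ (m + 1))⁻¹) := by
    rw [gaussWeight, norm_mul, Complex.exp_sum, norm_prod]
    gcongr
    exact hs _
  rw [norm_mul]
  have hP : Real.exp (Real.pi * ∑ j : Fin k, |(z j.castSucc).im|) =
      ∏ j : Fin k, Real.exp (Real.pi * |(z j.castSucc).im|) := by
    rw [Finset.mul_sum, Real.exp_sum]
  have hX : ∀ j : Fin k, Real.exp (Real.pi * |(z j.castSucc).im|) * Real.exp (-(z j.castSucc).im ^ 2) *
      (1 + (z j.castSucc).im ^ 2) ^ m ≤ B * (1 / (1 + (z j.castSucc).im ^ 2)) := fun j => by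
    have := exp_mul_pow_le (m + 1) (z j.castSucc).im
    rw [mul_one_div, le_div_iff₀ (by positivity), mul_assoc, ← pow_succ, ← Real.exp_add, ← sub_eq_add_neg]
    exact this
  have hw0 : 0 < 1 + (z (Fin.last k)).im ^ 2 := by positivity
  calc _ ≤ (C * (∏ i, (1 + (z i).im ^ 2)) ^ m * Real.exp (Real.pi * ∑ j : Fin k, |(z j.castSucc).im|)) *
        ((∏ j : Fin k, (Real.exp (A j) * Real.exp (-(z j.castSucc).im ^ 2))) *
      ((η' ^ (m + 1))⁻¹ * ((1 + (z (Fin.last k)).im ^ 2) ^ (m + 1))⁻¹)) := by gcongr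
    _ = C * (∏ j, Real.exp (A j)) * (η' ^ (m + 1))⁻¹ *
        ((∏ j : Fin k, (Real.exp (Real.pi * |(z j.castSucc).im|) * Real.exp (-(z j.castSucc).im ^ 2) *
      (1 + (z j.castSucc).im ^ 2) ^ m)) *
        ((1 + (z (Fin.last k)).im ^ 2) ^ m * ((1 + (z (Fin.last k)).im ^ 2) ^ (m + 1))⁻¹)) := by
      rw [hP, Fin.prod_univ_castSucc, Finset.prod_mul_distrib, Finset.prod_mul_distrib,
        Finset.prod_mul_distrib, mul_pow, Finset.prod_pow]
      ring
    _ ≤ C * (∏ j, Real.exp (A j)) * (η' ^ (m + 1))⁻¹ *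
        ((∏ j : Fin k, (B * (1 / (1 + (z j.castSucc).im ^ 2)))) * (1 / (1 + (z (Fin.last k)).im ^ 2))) := by
      have : (1 + (z (Fin.last k)).im ^ 2) ^ m * ((1 + (z (Fin.last k)).im ^ 2) ^ (m + 1))⁻¹ =
          1 / (1 + (z (Fin.last k)).im ^ 2) := by
        field_simp; ring
      rw [this]
      have := Finset.prod_le_prod (s := Finset.univ) (fun j _ => by positivity) fun j _ => hX j
      have hnn : 0 ≤ C * (∏ j, Real.exp (A j)) * (η' ^ (m + 1))⁻¹ := by positivity
      exact mul_le_mul_of_nonneg_left (mul_le_mul_of_nonneg_right this (by positivity)) hnn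
    _ = _ := by
      rw [Finset.prod_mul_distrib, Fin.prod_univ_castSucc]
      simp only [Finset.prod_const, Finset.card_univ, Fintype.card_fin]
      ring

/-! ### Growth of the multiple Dirichlet series -/

open Classical in
/-- The terms of the multiple Dirichlet series as functions of `(s, w)`. -/
def mdsTerm {κ : ℤ} (f : CuspForm 𝒮ℒ κ) (M : ℕ) (z : Fin (k + 1) → ℂ) (d : ℕ) : ℂ :=
  if IsPosFundDisc d then chi d M * (∏ j : Fin k, twistedL f d (z j.castSucc)) / (d : ℂ) ^ z (Fin.last k)
  else 0

/-- The region of absolute convergence. -/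
def convDomain (k : ℕ) : Set (Fin (k + 1) → ℝ) := {σ | ∀ i, 1 < σ i}

/-- The region with `s` in a vertical strip and `Re w` large. -/
def farDomain (k : ℕ) (W : ℝ) : Set (Fin (k + 1) → ℝ) :=
  {σ | (∀ j : Fin k, 0 < σ j.castSucc ∧ σ j.castSucc < 2) ∧ W < σ (Fin.last k)}

theorem isOpen_convDomain : IsOpen (convDomain k) := by
  simp only [convDomain, ofPred_forall]
  exact isOpen_iInter_of_finite fun i => isOpen_lt continuous_const (continuous_apply i)

theorem isOpen_farDomain (W : ℝ) : IsOpen (farDomain k W) := by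
  simp only [farDomain, ofPred_and, ofPred_forall]
  exact (isOpen_iInter_of_finite fun i => (isOpen_lt continuous_const (continuous_apply _)).inter
    (isOpen_lt (continuous_apply _) continuous_const)).inter
    (isOpen_lt continuous_const (continuous_apply _))

theorem convex_convDomain : Convex ℝ (convDomain k) := fun x hx y hy a b ha hb hab i => by
  have h1 := hx i
  have h2 := hy i
  simp only [Pi.add_apply, Pi.smul_apply, smul_eq_mul]
  rcases ha.eq_or_lt with rfl | ha
  · rw [zero_add] at hab; subst hab; linarith
  · nlinarith

theorem convex_farDomain (W : ℝ) : Convex ℝ (farDomain k W) := by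
  have h : farDomain k W = ((univ : Set (Fin (k + 1))).pi fun i =>
      Fin.lastCases (motive := fun _ => Set ℝ) (Ioi W) (fun _ => Ioo 0 2) i) := by
    ext σ
    simp only [farDomain, mem_ofPred_eq, Set.mem_pi, mem_univ, true_imp_iff]
    rw [Fin.forall_fin_succ']
    simp
  rw [h]
  refine convex_pi fun i _ => ?_
  refine Fin.lastCases ?_ (fun j => ?_) i
  · simpa using convex_Ioi W
  · simpa using convex_Ioo 0 2

/-- Both regions are convex, and they share the point with all `s_j = 3/2` and last coordinate `max
W 1 + 1`. -/
theorem isPreconnected_domains {W : ℝ} : IsPreconnected (convDomain k ∪ farDomain k W) := by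
  have hmem : ∀ i : Fin (k + 1), (fun i => Fin.lastCases (motive := fun _ => ℝ) (max W 1 + 1)
    (fun _ => 3 / 2) i : Fin (k + 1) → ℝ) i > 1 := fun i => by
    refine Fin.lastCases ?_ (fun j => ?_) i
    · simp
    · simp; norm_num
  refine IsPreconnected.union (fun i => Fin.lastCases (motive := fun _ => ℝ) (max W 1 + 1)
    (fun _ => 3 / 2) i) hmem ?_ convex_convDomain.isPreconnected (convex_farDomain W).isPreconnected
  refine ⟨fun j => by simp; norm_num, by simp; linarith [le_max_left W 1]⟩

theorem differentiable_mdsTerm {κ : ℤ} (f : CuspForm 𝒮ℒ κ) (hκ : 0 < κ) (M d : ℕ) :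
    Differentiable ℂ fun z : Fin (k + 1) → ℂ => mdsTerm f M z d := by
  unfold mdsTerm
  split_ifs with hd
  · have hd0 : (d : ℂ) ≠ 0 := by exact_mod_cast hd.pos.ne'
    simp_rw [div_eq_mul_inv, ← Complex.cpow_neg]
    have hprod : Differentiable ℂ fun z : Fin (k + 1) → ℂ => ∏ j : Fin k, twistedL f d (z j.castSucc) :=
      differentiableOn_univ.1 (differentiableOn_finsetProd _ fun j _ =>
        ((hd.differentiable_twistedL f hκ).comp
          (differentiable_apply (𝕜 := ℂ) j.castSucc)).differentiableOn)
    refine ((differentiable_const _).mul hprod).mul ?_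
    · exact fun z => DifferentiableAt.const_cpow (by fun_prop) (Or.inl hd0)
  · exact differentiable_const _

theorem mdsTerm_norm_le {κ : ℤ} (f : CuspForm 𝒮ℒ κ) (M : ℕ) (z : Fin (k + 1) → ℂ) {d : ℕ}
    (hd : IsPosFundDisc d) : ‖mdsTerm f M z d‖ ≤
      (∏ j : Fin k, ‖twistedL f d (z j.castSucc)‖) * (d : ℝ) ^ (-(z (Fin.last k)).re) := by
  rw [mdsTerm, if_pos hd, norm_div, norm_mul, norm_prod, Complex.norm_natCast_cpow_of_pos hd.pos,
    Real.rpow_neg (by positivity), div_eq_mul_inv]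
  gcongr
  exact mul_le_of_le_one_left (by positivity) (norm_chi_le _ _)

theorem norm_twistedL_le_of_one_lt {κ : ℤ} (f : CuspForm 𝒮ℒ κ) (hκ : 0 < κ) {d : ℕ}
    (hd : IsPosFundDisc d) {ρ : ℝ} (hρ : 1 < ρ) {s : ℂ} (hs : ρ ≤ s.re) :
    ‖twistedL f d s‖ ≤ ∑' n : ℕ, ‖coeffA f n‖ / (n : ℝ) ^ ρ := by
  rw [hd.twistedL_eq f hκ (by linarith), LSeries]
  refine tsum_of_norm_bounded (summable_coeffA f hκ hρ).hasSum fun n => ?_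
  by_cases hn : n = 0
  · subst hn; rw [LSeries.term_zero, norm_zero]; positivity
  · have hn1 : (1 : ℝ) ≤ n := by exact_mod_cast Nat.pos_of_ne_zero hn
    rw [LSeries.term_of_ne_zero hn, norm_div, norm_mul,
      Complex.norm_natCast_cpow_of_pos (Nat.pos_of_ne_zero hn)]
    refine div_le_div₀ (norm_nonneg _) (mul_le_of_le_one_right (norm_nonneg _) (norm_chi_le _ _))
      (by positivity) (Real.rpow_le_rpow_of_exponent_le hn1 hs)

/-- Summable majorants for the multiple Dirichlet series near a point. -/
def MdsMajorized {κ : ℤ} (f : CuspForm 𝒮ℒ κ) (M : ℕ) (σ : Fin (k + 1) → ℝ) : Prop :=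
  ∃ r > 0, ∃ b : ℕ → ℝ, (∀ d, 0 ≤ b d) ∧ Summable b ∧ ∀ z : Fin (k + 1) → ℂ,
    (fun i => (z i).re) ∈ ball σ r → ∀ d,
      ‖mdsTerm f M z d‖ ≤ b d * Real.exp (Real.pi * ∑ j : Fin k, |(z j.castSucc).im|)

theorem mdsMajorized_of_convDomain {κ : ℤ} (f : CuspForm 𝒮ℒ κ) (hκ : 0 < κ) (M : ℕ)
    {σ : Fin (k + 1) → ℝ} (hσ : σ ∈ convDomain k) : MdsMajorized f M σ := by
  obtain ⟨ε, hε, hball⟩ := Metric.isOpen_iff.1 isOpen_convDomain σ hσ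
  have hmem : ∀ i, 1 < σ i - ε / 2 := fun i => by
    have : σ - (fun _ => ε / 2) ∈ convDomain k := hball (by
      rw [mem_ball, dist_eq_norm, sub_sub_cancel_left, norm_neg]
      refine lt_of_le_of_lt (pi_norm_const_le _) ?_
      rw [Real.norm_of_nonneg (by positivity)]; linarith)
    exact this i
  refine ⟨ε / 2, by positivity, fun d => (∏ j : Fin k, ∑' n : ℕ, ‖coeffA f n‖ /
    (n : ℝ) ^ (σ j.castSucc - ε / 2)) * (d : ℝ) ^ (-(σ (Fin.last k) - ε / 2)), fun d => by positivity,
    (Real.summable_nat_rpow.2 (by linarith [hmem (Fin.last k)])).mul_left _, fun z hz d => ?_⟩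
  rw [mem_ball, dist_pi_lt_iff (by positivity)] at hz
  have hz' : ∀ i, σ i - ε / 2 ≤ (z i).re := fun i => by
    have := hz i
    rw [Real.dist_eq, abs_lt] at this
    linarith
  by_cases hd : IsPosFundDisc d
  · have hd1 : (1 : ℝ) ≤ d := by exact_mod_cast hd.pos
    have he : 1 ≤ Real.exp (Real.pi * ∑ j : Fin k, |(z j.castSucc).im|) :=
      Real.one_le_exp (by positivity)
    refine (mdsTerm_norm_le f M z hd).trans (le_trans ?_ (le_mul_of_one_le_right (by positivity) he))
    beta_reduce
    gcongr
    · exact norm_twistedL_le_of_one_lt f hκ hd (hmem _) (hz' _)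
    · exact hz' _
  · rw [mdsTerm, if_neg hd, norm_zero]; positivity

theorem exists_mdsMajorized_farDomain {κ : ℤ} (f : CuspForm 𝒮ℒ κ) (hκ : 0 < κ) (M k : ℕ) :
    ∃ W : ℝ, 1 ≤ W ∧ ∀ σ ∈ farDomain k W, MdsMajorized f M σ := by
  obtain ⟨C, S, hC0, hC⟩ := exists_norm_twistedL_le f hκ
  -- The product of the `k` values is `O(d^{Sk})`, so this abscissa leaves the summable `d^{-2}`.
  refine ⟨S * k + 2, by have : (0 : ℝ) ≤ S * k := by positivity
                        linarith, fun σ hσ => ?_⟩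
  obtain ⟨ε, hε, hball⟩ := Metric.isOpen_iff.1 (isOpen_farDomain _) σ hσ
  refine ⟨ε, hε, fun d => C ^ k * (d : ℝ) ^ (-2 : ℝ), fun d => by positivity,
    (Real.summable_nat_rpow.2 (by norm_num)).mul_left _, fun z hz d => ?_⟩
  obtain ⟨hz1, hz2⟩ := hball hz
  by_cases hd : IsPosFundDisc d
  · have hd1 : (1 : ℝ) ≤ d := by exact_mod_cast hd.pos
    have hd0 : (0 : ℝ) < d := by linarith
    refine (mdsTerm_norm_le f M z hd).trans ?_
    calc _ ≤ (∏ j : Fin k, (C * (d : ℝ) ^ S * Real.exp (Real.pi * |(z j.castSucc).im|))) *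
          (d : ℝ) ^ (-((S : ℝ) * k + 2)) := by
          gcongr with j
          exact hC d hd _ (hz1 j).1.le (hz1 j).2.le
      _ = C ^ k * ((d : ℝ) ^ ((S : ℝ) * k) * (d : ℝ) ^ (-((S : ℝ) * k + 2))) *
          Real.exp (Real.pi * ∑ j : Fin k, |(z j.castSucc).im|) := by
          rw [Finset.prod_mul_distrib, Finset.mul_sum, Real.exp_sum, Finset.prod_const,
            Finset.card_univ, Fintype.card_fin, mul_pow, ← pow_mul, ← Real.rpow_natCast (d : ℝ)]
          push_cast
          ring
      _ = _ := by
          rw [← Real.rpow_add hd0]; congr 3; ring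
  · rw [mdsTerm, if_neg hd, norm_zero]; positivity

theorem mds_eq_tsum_mdsTerm {κ : ℤ} (f : CuspForm 𝒮ℒ κ) (M : ℕ) (z : Fin (k + 1) → ℂ) :
    mds f M (fun j => z j.castSucc) (z (Fin.last k)) = ∑' d, mdsTerm f M z d := rfl

theorem locGrowth_mds {κ : ℤ} {f : CuspForm 𝒮ℒ κ} {M : ℕ} {U : Set (Fin (k + 1) → ℝ)}
    (h : ∀ σ ∈ U, MdsMajorized f M σ) :
    LocGrowth 0 U fun z => mds f M (fun j => z j.castSucc) (z (Fin.last k)) := fun σ hσ => by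
  obtain ⟨r, hr, b, hb0, hb, hbound⟩ := h σ hσ
  refine ⟨r, hr, ∑' d, b d, tsum_nonneg hb0, fun z hz => ?_⟩
  beta_reduce
  rw [pow_zero, mul_one, mds_eq_tsum_mdsTerm]
  exact tsum_of_norm_bounded (hb.hasSum.mul_right _) (hbound z hz)

/-- The series is an integral against counting measure, so holomorphy comes from the same lemma as
for vertical integrals. -/
theorem differentiableOn_mds {κ : ℤ} {f : CuspForm 𝒮ℒ κ} (hκ : 0 < κ) {M : ℕ}
    {U : Set (Fin (k + 1) → ℝ)} (hU : IsOpen U) (h : ∀ σ ∈ U, MdsMajorized f M σ) :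
    DifferentiableOn ℂ (fun z => mds f M (fun j => z j.castSucc) (z (Fin.last k))) (tube U) := by
  have hdom : LocallyDominated Measure.count (tube U) (mdsTerm f M) := fun z hz => by
    obtain ⟨r, hr, b, hb0, hb, hbound⟩ := h _ hz
    set E := Real.exp (Real.pi * ∑ j : Fin k, (|(z j.castSucc).im| + r)) with hE
    refine ⟨r, hr, fun d => b d * E, ?_, fun x hx _ d => ?_⟩
    · rw [integrable_count_iff]; exact (hb.mul_right E).norm
    · rw [mem_ball, dist_pi_lt_iff hr] at hx
      refine (hbound x ?_ d).trans (mul_le_mul_of_nonneg_left (Real.exp_le_exp.2 ?_) (hb0 d))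
      · rw [mem_ball, dist_pi_lt_iff hr]
        intro i
        rw [Real.dist_eq, ← Complex.sub_re]
        exact (Complex.abs_re_le_norm _).trans_lt (by rw [← dist_eq_norm]; exact hx i)
      · gcongr with j
        have h1 := hx j.castSucc
        rw [dist_eq_norm] at h1
        have h2 := Complex.abs_im_le_norm (x j.castSucc - z j.castSucc)
        rw [Complex.sub_im] at h2
        have := abs_sub_abs_le_abs_sub (x j.castSucc).im (z j.castSucc).im
        linarith
  have key := differentiableOn_integral (isOpen_tube hU)
    (fun d => (differentiable_mdsTerm f hκ M d).differentiableOn)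
    (fun z _ => (measurable_of_countable _).aestronglyMeasurable) hdom
  refine key.congr fun z hz => ?_
  obtain ⟨r, hr, b, hb, hbound⟩ := hdom z hz
  have hint : Integrable (mdsTerm f M z) Measure.count :=
    hb.mono' (measurable_of_countable _).aestronglyMeasurable
      (Eventually.of_forall fun d => hbound z (mem_ball_self hr) hz d)
  rw [mds_eq_tsum_mdsTerm, integral_countable hint]
  simp

theorem sigma_sub_one_growth (J : Finset (Fin k)) (σ : Fin (k + 1) → ℝ) :
    ∃ C : ℝ, 0 ≤ C ∧ ∀ z : Fin (k + 1) → ℂ, (fun i => (z i).re) ∈ ball σ 1 →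
      ‖sigma J (fun j => z j.castSucc) (z (Fin.last k)) - 1‖ ≤ C * ∏ i, (1 + (z i).im ^ 2) := by
  refine ⟨(∑ i, (|σ i| + 2)) * 2 + k + 1, by positivity, fun z hz => ?_⟩
  set P := ∏ i, (1 + (z i).im ^ 2)
  have hP := one_le_prod_one_add_sq fun i => (z i).im
  rw [mem_ball, dist_pi_lt_iff one_pos] at hz
  have hzi : ∀ i, ‖z i‖ ≤ (|σ i| + 2) * P := fun i => by
    have h1 := Complex.norm_le_abs_re_add_abs_im (z i)
    have h2 := hz i
    rw [Real.dist_eq] at h2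
    have h3 := abs_sub_abs_le_abs_sub (z i).re (σ i)
    have h4 : |(z i).im| ≤ P := by
      refine le_trans ?_ (one_add_sq_le_prod (fun i => (z i).im) i)
      nlinarith [sq_nonneg (|(z i).im| - 1), sq_abs (z i).im, abs_nonneg (z i).im]
    nlinarith [abs_nonneg (σ i)]
  have hJ : ‖∑ j ∈ J, z j.castSucc‖ ≤ ∑ j : Fin k, (|σ j.castSucc| + 2) * P :=
    (norm_sum_le _ _).trans ((Finset.sum_le_sum fun j _ => hzi j.castSucc).trans
      (Finset.sum_le_sum_of_subset_of_nonneg (Finset.subset_univ _) fun j _ _ => by positivity))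
  have hcard : (J.card : ℝ) ≤ k := by
    exact_mod_cast (Finset.card_le_univ J).trans (by simp)
  calc ‖sigma J (fun j => z j.castSucc) (z (Fin.last k)) - 1‖
      ≤ ‖z (Fin.last k)‖ + 2 * ‖∑ j ∈ J, z j.castSucc‖ + J.card + 1 := by
        rw [sigma]
        refine (norm_sub_le _ _).trans ?_
        rw [norm_one]
        gcongr
        refine (norm_sub_le _ _).trans ?_
        rw [Complex.norm_natCast]
        gcongr
        refine (norm_add_le _ _).trans ?_
        rw [norm_mul, Complex.norm_ofNat]
    _ ≤ (|σ (Fin.last k)| + 2) * P + 2 * ∑ j : Fin k, (|σ j.castSucc| + 2) * P + k * P + 1 * P := by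
        gcongr
        · exact hzi _
        · exact hcard.trans (le_mul_of_one_le_right (by positivity) hP)
        · rw [one_mul]; exact hP
    _ ≤ ((∑ i, (|σ i| + 2)) * 2 + k + 1) * P := by
        rw [Fin.sum_univ_castSucc, ← Finset.sum_mul]
        have : 0 ≤ (|σ (Fin.last k)| + 2) * P := by positivity
        nlinarith

theorem locGrowth_clearedMds {κ : ℤ} {f : CuspForm 𝒮ℒ κ} {M : ℕ} {U : Set (Fin (k + 1) → ℝ)}
    (h : ∀ σ ∈ U, MdsMajorized f M σ) : LocGrowth (2 ^ k) U (clearedMds f k M) := by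
  refine LocGrowth.mul (N := 0) (N' := 2 ^ k) (fun σ _ => ?_) (locGrowth_mds h)
  choose C hC0 hC using fun J : Finset (Fin k) => sigma_sub_one_growth J σ
  refine ⟨1, one_pos, ∏ J, C J, Finset.prod_nonneg fun J _ => hC0 J, fun z hz => ?_⟩
  rw [norm_prod]
  refine (Finset.prod_le_prod (fun J _ => norm_nonneg _) fun J _ => hC J z hz).trans (le_of_eq ?_)
  rw [Finset.prod_mul_distrib, Finset.prod_const, Finset.card_univ, Fintype.card_finset,
    Fintype.card_fin]

theorem differentiable_sigma (J : Finset (Fin k)) :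
    Differentiable ℂ fun z : Fin (k + 1) → ℂ => sigma J (fun j => z j.castSucc) (z (Fin.last k)) := by
  unfold sigma; fun_prop

theorem differentiableOn_clearedMds {κ : ℤ} {f : CuspForm 𝒮ℒ κ} (hκ : 0 < κ) {M : ℕ}
    {U : Set (Fin (k + 1) → ℝ)} (hU : IsOpen U) (h : ∀ σ ∈ U, MdsMajorized f M σ) :
    DifferentiableOn ℂ (clearedMds f k M) (tube U) := by
  exact (differentiableOn_finsetProd _ fun J _ =>
    ((differentiable_sigma J).sub_const 1).differentiableOn).mul (differentiableOn_mds hκ hU h)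

end QuadTwist
end

noncomputable section

namespace QuadTwist

open MeasureTheory Filter Set Metric Topology

variable {k : ℕ}

/-! ### The continuation to a convex tube -/

theorem gaussWeight_ne_zero {m : ℕ} {z : Fin (k + 1) → ℂ} (hz : -(m : ℝ) < (z (Fin.last k)).re) :
    gaussWeight m z ≠ 0 := by
  refine mul_ne_zero (Complex.exp_ne_zero _) (inv_ne_zero (pow_ne_zero _ fun h => ?_))
  have := congrArg Complex.re h
  simp at this
  linarith

theorem differentiableOn_gaussWeight {m : ℕ} {U : Set (Fin (k + 1) → ℝ)}
    (hU : ∀ σ ∈ U, -(m : ℝ) < σ (Fin.last k)) :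
    DifferentiableOn ℂ (gaussWeight (k := k) m) (tube U) := by
  unfold gaussWeight
  refine DifferentiableOn.mul (by fun_prop) (DifferentiableOn.inv (by fun_prop) fun z hz h => ?_)
  exact gaussWeight_ne_zero (hU _ hz) (by rw [gaussWeight, h, inv_zero, mul_zero])

/-- `Φ` continues `∏_J (σ_J(w) - 1) · A_{f,M}(s; w)` to the tube over the open convex set `T`, which
contains the base point, the region of absolute convergence, and the points with `Re w` large and
`s` in a strip; and `Φ` has moderate growth. -/
structure IsContinuation {κ : ℤ} (f : CuspForm 𝒮ℒ κ) (k M : ℕ) (T : Set (Fin (k + 1) → ℝ))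
    (W : ℝ) (m : ℕ) (Φ : (Fin (k + 1) → ℂ) → ℂ) : Prop where
  isOpen : IsOpen T
  convex : Convex ℝ T
  base_mem : (Fin.snoc (fun _ => 1 / 2) 1 : Fin (k + 1) → ℝ) ∈ T
  conv_subset : convDomain k ⊆ T
  far_subset : farDomain k W ⊆ T
  one_le : 1 ≤ W
  majorized : ∀ σ ∈ farDomain k W, MdsMajorized f M σ
  analytic : AnalyticOnNhd ℂ Φ (tube T)
  eq : ∀ z ∈ tube (convDomain k ∪ farDomain k W), Φ z = clearedMds f k M z
  bounded : ∀ K ⊆ T, IsCompact K → ∃ C, 0 ≤ C ∧ ∀ z : Fin (k + 1) → ℂ, (fun i => (z i).re) ∈ K →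
    ‖Φ z‖ ≤ C * Real.exp (∑ j : Fin k, (z j.castSucc).im ^ 2) *
      (1 + (z (Fin.last k)).im ^ 2) ^ (m + 1)

/-- The price of removing the weight: Gaussian growth in `Im s_j`, harmless since these stay
bounded, but only polynomial growth in `Im w`. -/
theorem norm_inv_gaussWeight_le {m : ℕ} {K : Set (Fin (k + 1) → ℝ)} (hK : IsCompact K) :
    ∃ C, 0 ≤ C ∧ ∀ z : Fin (k + 1) → ℂ, (fun i => (z i).re) ∈ K →
      ‖(gaussWeight m z)⁻¹‖ ≤ C * Real.exp (∑ j : Fin k, (z j.castSucc).im ^ 2) *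
        (1 + (z (Fin.last k)).im ^ 2) ^ (m + 1) := by
  obtain ⟨A, hA⟩ := hK.isBounded.exists_norm_le
  refine ⟨((|A| + m) ^ 2 + 1) ^ (m + 1), by positivity, fun z hz => ?_⟩
  have h1 : |(z (Fin.last k)).re| ≤ |A| :=
    (norm_le_pi_norm (fun i => (z i).re) (Fin.last k)).trans ((hA _ hz).trans (le_abs_self A))
  have h2 : ‖(z (Fin.last k) + m) ^ (2 * m + 2)‖ ≤
      ((|A| + m) ^ 2 + 1) ^ (m + 1) * (1 + (z (Fin.last k)).im ^ 2) ^ (m + 1) := by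
    rw [norm_pow, show 2 * m + 2 = 2 * (m + 1) by ring, pow_mul, ← mul_pow]
    gcongr
    rw [Complex.sq_norm, Complex.normSq_apply]
    simp only [Complex.add_re, Complex.natCast_re, Complex.add_im, Complex.natCast_im, add_zero]
    have h3 : ((z (Fin.last k)).re + m) ^ 2 ≤ (|A| + m) ^ 2 := by
      rw [sq_le_sq]
      refine (abs_add_le _ _).trans ?_
      rw [Nat.abs_cast, abs_of_nonneg (by positivity : (0 : ℝ) ≤ |A| + m)]
      linarith
    nlinarith [mul_nonneg (sq_nonneg (|A| + (m : ℝ))) (sq_nonneg (z (Fin.last k)).im)]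
  have h3 : ‖(Complex.exp (∑ j : Fin k, z j.castSucc ^ 2))⁻¹‖ ≤
      Real.exp (∑ j : Fin k, (z j.castSucc).im ^ 2) := by
    rw [← Complex.exp_neg, Complex.norm_exp, Complex.neg_re, Complex.re_sum, ← Finset.sum_neg_distrib]
    refine Real.exp_le_exp.2 (Finset.sum_le_sum fun j _ => ?_)
    rw [sq, Complex.mul_re]
    nlinarith [sq_nonneg (z j.castSucc).re]
  rw [gaussWeight, mul_inv, inv_inv, norm_mul]
  refine (mul_le_mul h3 h2 (norm_nonneg _) (Real.exp_pos _).le).trans (le_of_eq (by ring))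

theorem PolyBoundedInStrips.exists_local {n : ℕ} {V : Set (Fin n → ℝ)} (hV : IsOpen V)
    {F : (Fin n → ℂ) → ℂ} (hF : PolyBoundedInStrips V F) {σ : Fin n → ℝ} (hσ : σ ∈ V) :
    ∃ r > 0, ∃ (C : ℝ) (N : ℕ), 0 ≤ C ∧ ∀ z : Fin n → ℂ, (fun i => (z i).re) ∈ ball σ r →
      ‖F z‖ ≤ C * (∏ i, (1 + (z i).im ^ 2)) ^ N := by
  obtain ⟨r, hr, hball⟩ := Metric.isOpen_iff.1 hV σ hσ
  have hIcc : Icc (fun i => σ i - r / 2) (fun i => σ i + r / 2) = closedBall σ (r / 2) := by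
    rw [closedBall_pi _ (by positivity), ← Set.pi_univ_Icc]
    congr 1
    funext i
    rw [Real.closedBall_eq_Icc]
  obtain ⟨P, hP⟩ := hF _ _ (hIcc.subset.trans ((closedBall_subset_ball (half_lt_self hr)).trans hball))
  obtain ⟨C, N, hC, h⟩ := exists_abs_eval_le P
  exact ⟨r / 2, by positivity, C, N, hC, fun z hz => (hP z (hIcc ▸ ball_subset_closedBall hz)).trans (h _)⟩

/-- Both the given continuation and the Dirichlet series, once weighted, are Laplace transforms of
the same `u`. So the convex domain of that transform contains both real regions and carries a common
continuation. -/
theorem exists_isContinuation {κ : ℤ} (f : CuspForm 𝒮ℒ κ) (hκ : 0 < κ) {M : ℕ}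
    (h : MDSConjecture f k M) : ∃ T W m Φ, IsContinuation f k M T W m Φ := by
  obtain ⟨V, F, hVo, hVc, hp0, ⟨z₁, hz₁V, hz₁c⟩, hFd, hFeq, hpoly⟩ := h
  obtain ⟨W, hW1, hmaj⟩ := exists_mdsMajorized_farDomain f hκ M k
  set p₀ : Fin (k + 1) → ℝ := Fin.snoc (fun _ => 1 / 2) 1 with hp0def
  set p₁ : Fin (k + 1) → ℝ := fun i => (z₁ i).re with hp1def
  -- The polynomial in the hypothesis depends on the box, so `V` is exhausted by the sets where
  -- order `m` suffices locally and where the factor `w + m` of the weight does not vanish.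
  let Vm : ℕ → Set (Fin (k + 1) → ℝ) := fun m => {σ | σ ∈ V ∧ -(m : ℝ) < σ (Fin.last k) ∧
    ∃ r > 0, ∃ C : ℝ, 0 ≤ C ∧ ∀ z : Fin (k + 1) → ℂ, (fun i => (z i).re) ∈ ball σ r →
      ‖F z‖ ≤ C * (∏ i, (1 + (z i).im ^ 2)) ^ m}
  have hVmo : ∀ m, IsOpen (Vm m) := fun m => by
    have h3 : IsOpen {σ : Fin (k + 1) → ℝ | ∃ r > 0, ∃ C : ℝ, 0 ≤ C ∧ ∀ z : Fin (k + 1) → ℂ,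
        (fun i => (z i).re) ∈ ball σ r → ‖F z‖ ≤ C * (∏ i, (1 + (z i).im ^ 2)) ^ m} := by
      rw [Metric.isOpen_iff]
      rintro σ ⟨r, hr, C, hC0, hC⟩
      refine ⟨r / 2, by positivity, fun τ hτ => ⟨r / 2, by positivity, C, hC0, fun z hz => hC z ?_⟩⟩
      rw [mem_ball] at hτ hz ⊢
      linarith [dist_triangle (fun i => (z i).re) τ σ]
    exact hVo.inter ((isOpen_lt continuous_const (continuous_apply _)).inter h3)
  have hVmono : Monotone Vm := fun m m' hmm σ hσ => by
    obtain ⟨hσV, hσm, r, hr, C, hC0, hC⟩ := hσ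
    have : (m : ℝ) ≤ m' := by exact_mod_cast hmm
    refine ⟨hσV, by linarith, r, hr, C, hC0, fun z hz => (hC z hz).trans ?_⟩
    have := one_le_prod_one_add_sq fun i => (z i).im
    gcongr
  have hVcov : V ⊆ ⋃ m, Vm m := fun σ hσ => by
    obtain ⟨r, hr, C, N, hC0, hC⟩ := hpoly.exists_local hVo hσ
    obtain ⟨N', hN'⟩ := exists_nat_gt (-σ (Fin.last k))
    refine mem_iUnion.2 ⟨max N N', hσ, ?_, r, hr, C, hC0, fun z hz => (hC z hz).trans ?_⟩
    · have : (N' : ℝ) ≤ (max N N' : ℕ) := by exact_mod_cast le_max_right N N'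
      linarith
    · have := one_le_prod_one_add_sq fun i => (z i).im
      gcongr
      exact le_max_left _ _
  -- A path from the base point to a point of the convergence region is compact, hence lies in one
  -- `Vm m`. This fixes the weight once and for all.
  obtain ⟨γ, hγ⟩ := (hVo.isConnected_iff_isPathConnected.1 hVc).joinedIn p₀ hp0 p₁ hz₁V
  set K := range γ with hK
  have hKV : K ⊆ V := by rintro _ ⟨t, rfl⟩; exact hγ t
  have hKc : IsPreconnected K := isPreconnected_range γ.continuous
  obtain ⟨m₀, hm₀⟩ := (isCompact_range γ.continuous).elim_directed_cover Vm hVmo (hKV.trans hVcov)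
    hVmono.directed_le
  -- The `2^k` linear factors that clear the poles make the cleared series grow to order `2^k`.
  set m := max m₀ (2 ^ k) with hm
  have hKm : K ⊆ Vm m := hm₀.trans (hVmono (le_max_left _ _))
  have hp0K : p₀ ∈ K := ⟨0, γ.source⟩
  have hp1K : p₁ ∈ K := ⟨1, γ.target⟩
  set D := convDomain k ∪ farDomain k W with hD
  have hDo : IsOpen D := isOpen_convDomain.union (isOpen_farDomain W)
  have hDmaj : ∀ σ ∈ D, MdsMajorized f M σ := fun σ hσ =>
    hσ.elim (mdsMajorized_of_convDomain f hκ M) (hmaj σ)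
  have hDm : ∀ σ ∈ D, -(m : ℝ) < σ (Fin.last k) := fun σ hσ => by
    have : (0 : ℝ) ≤ m := Nat.cast_nonneg _
    rcases hσ with hσ | hσ
    · linarith [hσ (Fin.last k)]
    · linarith [hσ.2]
  have hVm : ∀ σ ∈ Vm m, -(m : ℝ) < σ (Fin.last k) := fun σ hσ => hσ.2.1
  set G₁ : (Fin (k + 1) → ℂ) → ℂ := fun z => clearedMds f k M z * gaussWeight m z with hG1
  set G₂ : (Fin (k + 1) → ℂ) → ℂ := fun z => F z * gaussWeight m z with hG2
  have hd1 : DifferentiableOn ℂ G₁ (tube D) :=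
    (differentiableOn_clearedMds hκ hDo hDmaj).mul (differentiableOn_gaussWeight hDm)
  have hd2 : DifferentiableOn ℂ G₂ (tube (Vm m)) :=
    (hFd.mono fun z hz => hz.1).mul (differentiableOn_gaussWeight hVm)
  have ht1 : TubeDecay D G₁ :=
    ((locGrowth_clearedMds hDmaj).mono (le_max_right _ _) subset_rfl).tubeDecay hDm
  have ht2 : TubeDecay (Vm m) G₂ := by
    refine LocGrowth.tubeDecay (fun σ hσ => ?_) hVm
    obtain ⟨-, -, r, hr, C, hC0, hC⟩ := hσ
    refine ⟨r, hr, C, hC0, fun z hz => (hC z hz).trans (le_mul_of_one_le_right ?_ ?_)⟩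
    · exact mul_nonneg hC0 (pow_nonneg (zero_le_one.trans (one_le_prod_one_add_sq _)) _)
    · exact Real.one_le_exp (by positivity)
  have hp1D : p₁ ∈ D := Or.inl hz₁c
  set u := invLaplace G₁ p₁ with hu
  -- Over `p₁` the two functions coincide, so their transforms do, and the path carries the second
  -- transform from `p₁` to `p₀`.
  have hu2 : u = invLaplace G₂ p₀ := by
    rw [TubeDecay.invLaplace_eq (hVmo m) hd2 ht2 hKm hKc hp0K hp1K, hu]
    funext v
    unfold invLaplace
    congr 1
    funext t
    have hre : ∀ i, (tubePoint p₁ t i).re = p₁ i := fun i => congrFun (tubePoint_re p₁ t) i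
    have : F (tubePoint p₁ t) = clearedMds f k M (tubePoint p₁ t) := hFeq
      ⟨by rw [tube, mem_ofPred_eq, tubePoint_re]; exact hz₁V, fun i => by rw [hre]; exact hz₁c i⟩
    simp only [hG1, hG2, this]
  have huD : ∀ σ ∈ D, u = invLaplace G₁ σ := fun σ hσ =>
    TubeDecay.invLaplace_eq hDo hd1 ht1 subset_rfl isPreconnected_domains hp1D hσ
  have huc : Continuous u := continuous_invLaplace hd1 ht1 hp1D
  have hDT : D ⊆ laplaceDomain u := fun σ hσ => by
    rw [huD σ hσ]; exact ht1.mem_laplaceDomain hDo hd1 hσ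
  set e : (Fin (k + 1) → ℂ) → ℂ := fun z =>
    Complex.exp (-∑ j : Fin k, z j.castSucc ^ 2) * (z (Fin.last k) + m) ^ (2 * m + 2) with he
  have heq : ∀ z, e z = (gaussWeight m z)⁻¹ := fun z => by
    rw [he, gaussWeight, mul_inv, inv_inv]; simp only [Complex.exp_neg]
  refine ⟨laplaceDomain u, W, m, fun z => laplace u z * e z, isOpen_laplaceDomain u,
    convex_laplaceDomain u, ?_, subset_union_left.trans hDT, subset_union_right.trans hDT, hW1, hmaj,
    fun z hz => (analyticAt_laplace huc hz).mul ?_, fun z hz => ?_, fun K hK hKc => ?_⟩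
  · rw [hu2]; exact ht2.mem_laplaceDomain (hVmo m) hd2 (hKm hp0K)
  · have ha : ∀ i, AnalyticAt ℂ (fun z : Fin (k + 1) → ℂ => z i) z := fun i =>
      (ContinuousLinearMap.proj (R := ℂ) (φ := fun _ : Fin (k + 1) => ℂ) i).analyticAt z
    refine ((Finset.analyticAt_fun_sum _ fun j _ => (ha _).pow 2).neg.cexp).mul
      (((ha _).add analyticAt_const).pow _)
  · rw [huD _ hz, ht1.laplace_invLaplace hDo hd1 hz, heq]
    exact mul_inv_cancel_right₀ (gaussWeight_ne_zero (hDm _ hz)) _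
  · obtain ⟨C, hC⟩ := laplace_bounded_on_compact u hKc hK
    obtain ⟨C', hC0', hC'⟩ := norm_inv_gaussWeight_le (m := m) hKc
    refine ⟨|C| * C', by positivity, fun z hz => ?_⟩
    rw [norm_mul, heq]
    refine (mul_le_mul ((hC z hz).trans (le_abs_self C)) (hC' z hz) (norm_nonneg _)
      (abs_nonneg C)).trans (le_of_eq (by ring))

end QuadTwist
end

noncomputable section

namespace QuadTwist

open MeasureTheory Filter Set Metric Topology

variable {k : ℕ}

/-! ### Joint variables -/

/-- The point `(s_1, …, s_k, w)`. -/
def join (s : Fin k → ℂ) (w : ℂ) : Fin (k + 1) → ℂ := Fin.snoc (α := fun _ => ℂ) s w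

@[simp] theorem join_castSucc (s : Fin k → ℂ) (w : ℂ) (j : Fin k) : join s w j.castSucc = s j := by
  simp [join]

@[simp] theorem join_last (s : Fin k → ℂ) (w : ℂ) : join s w (Fin.last k) = w := by
  simp [join]

theorem analyticAt_join (p : (Fin k → ℂ) × ℂ) :
    AnalyticAt ℂ (fun p : (Fin k → ℂ) × ℂ => join p.1 p.2) p := by
  rw [analyticAt_pi_iff]
  intro i
  refine Fin.lastCases ?_ (fun j => ?_) i
  · simpa using analyticAt_snd
  · simp only [join_castSucc]
    exact ((ContinuousLinearMap.proj (R := ℂ) (φ := fun _ : Fin k => ℂ) j).analyticAt _).comp analyticAt_fst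

theorem analyticAt_comp_join {Φ : (Fin (k + 1) → ℂ) → ℂ} {s : Fin k → ℂ} {w : ℂ}
    (h : AnalyticAt ℂ Φ (join s w)) :
    AnalyticAt ℂ (fun p : (Fin k → ℂ) × ℂ => Φ (join p.1 p.2)) (s, w) :=
  AnalyticAt.fun_comp (f := fun p : (Fin k → ℂ) × ℂ => join p.1 p.2) h (analyticAt_join (s, w))

/-- Each point of the quadrant lies on a segment from a corner `b`, just below the base point, to a
point all of whose coordinates exceed `1`. Both ends are in `T`, which is convex. -/
theorem IsContinuation.exists_quadrant {κ : ℤ} {f : CuspForm 𝒮ℒ κ} {M m : ℕ} {W : ℝ}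
    {T : Set (Fin (k + 1) → ℝ)} {Φ : (Fin (k + 1) → ℂ) → ℂ} (h : IsContinuation f k M T W m Φ) :
    ∃ ε : ℝ, 0 < ε ∧ ε ≤ 1 / 2 ∧ ∀ σ : Fin (k + 1) → ℝ, (∀ j : Fin k, 1 / 2 - ε < σ j.castSucc) →
      1 - ε < σ (Fin.last k) → σ ∈ T := by
  obtain ⟨r, hr, hball⟩ := Metric.isOpen_iff.1 h.isOpen _ h.base_mem
  set ε := min (r / 2) (1 / 2) with hε
  have hε0 : 0 < ε := by positivity
  set p : Fin (k + 1) → ℝ := Fin.snoc (fun _ => 1 / 2) 1 with hp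
  set b : Fin (k + 1) → ℝ := p - fun _ => ε with hb
  have hbT : b ∈ T := hball (by
    rw [mem_ball, dist_eq_norm, hb, sub_sub_cancel_left, norm_neg]
    refine lt_of_le_of_lt (pi_norm_const_le _) ?_
    rw [Real.norm_of_nonneg hε0.le]
    exact (min_le_left _ _).trans_lt (half_lt_self hr))
  refine ⟨ε, hε0, min_le_right _ _, fun σ h1 h2 => ?_⟩
  have hbσ : ∀ i, b i < σ i := fun i => by
    refine Fin.lastCases ?_ (fun j => ?_) i
    · simpa [hb, hp] using h2
    · simpa [hb, hp] using h1 j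
  have hb1 : ∀ i, b i < 1 := fun i => by
    refine Fin.lastCases ?_ (fun j => ?_) i
    · simpa [hb, hp] using hε0
    · simp [hb, hp]; linarith
  -- The far end is `b + (σ - b)/t`; as `t → 0` its coordinates tend to infinity because `σ > b`
  -- coordinatewise.
  obtain ⟨t, ht0, ht1, ht⟩ : ∃ t : ℝ, 0 < t ∧ t < 1 ∧ ∀ i, 1 < b i + (σ i - b i) / t := by
    have : ∀ᶠ t in 𝓝[>] (0 : ℝ), t < 1 ∧ ∀ i, 1 < b i + (σ i - b i) / t := by
      refine (eventually_nhdsWithin_of_eventually_nhds (eventually_lt_nhds one_pos)).and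
        (eventually_all.2 fun i => ?_)
      have hpos : 0 < (σ i - b i) / (1 - b i) := div_pos (sub_pos.2 (hbσ i)) (sub_pos.2 (hb1 i))
      filter_upwards [self_mem_nhdsWithin, eventually_nhdsWithin_of_eventually_nhds
        (eventually_lt_nhds hpos)] with t ht0 ht
      have ht0' : 0 < t := ht0
      rw [lt_div_iff₀ (sub_pos.2 (hb1 i)), mul_comm, ← lt_div_iff₀ ht0'] at ht
      linarith
    obtain ⟨t, ht, ht0⟩ := (this.and self_mem_nhdsWithin).exists
    exact ⟨t, ht0, ht.1, ht.2⟩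
  have hq : (fun i => b i + (σ i - b i) / t) ∈ T := h.conv_subset ht
  have := h.convex hbT hq (sub_nonneg.2 ht1.le) ht0.le (by ring : (1 - t) + t = 1)
  convert this using 1
  funext i
  simp only [Pi.add_apply, Pi.smul_apply, smul_eq_mul]
  field_simp
  ring

/-! ### The polar divisors and their reflections -/

/-- The value of `w` at which `σ_J(w) = 1`. -/
def pole (J : Finset (Fin k)) (s : Fin k → ℂ) : ℂ := 1 + (J.card : ℂ) - 2 * ∑ j ∈ J, s j

theorem sigma_sub_one (J : Finset (Fin k)) (s : Fin k → ℂ) (w : ℂ) :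
    sigma J s w - 1 = w - pole J s := by
  rw [sigma, pole]; ring

theorem sigma_pole (J : Finset (Fin k)) (s : Fin k → ℂ) : sigma J s (pole J s) = 1 := by
  rw [← sub_eq_zero, sigma_sub_one, sub_self]

theorem sigma_eq_add_sum (J : Finset (Fin k)) (s : Fin k → ℂ) (w : ℂ) :
    sigma J s w = w + ∑ j, if j ∈ J then 2 * s j - 1 else 0 := by
  rw [sigma, Finset.sum_ite_mem, Finset.univ_inter, Finset.sum_sub_distrib, Finset.mul_sum]
  simp
  ring

/-- Reflections permute the polar divisors: a variable reflected twice returns to itself, so the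
index sets combine by symmetric difference. -/
theorem sigma_reflect (J K : Finset (Fin k)) (s : Fin k → ℂ) (w : ℂ) :
    sigma K (reflect J s) (sigma J s w) = sigma (symmDiff K J) s w := by
  simp only [sigma_eq_add_sum, add_assoc, ← Finset.sum_add_distrib]
  congr 1
  refine Finset.sum_congr rfl fun j _ => ?_
  by_cases hJ : j ∈ J <;> by_cases hK : j ∈ K <;> simp [hJ, hK, reflect, Finset.mem_symmDiff]
  ring

theorem abs_re_sum_le {ε : ℝ} {s : Fin k → ℂ} (hs : ∀ j, |(s j).re - 1 / 2| ≤ ε)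
    (J : Finset (Fin k)) (w : ℂ) : |(sigma J s w).re - w.re| ≤ 2 * k * ε := by
  rw [sigma_eq_add_sum, Complex.add_re, add_sub_cancel_left, Complex.re_sum]
  refine (Finset.abs_sum_le_sum_abs _ _).trans ?_
  have : ∀ j ∈ Finset.univ, |(if j ∈ J then 2 * s j - 1 else 0 : ℂ).re| ≤ 2 * ε := fun j _ => by
    have h0 : 0 ≤ ε := (abs_nonneg _).trans (hs j)
    split_ifs
    · have : (2 * s j - 1).re = 2 * ((s j).re - 1 / 2) := by simp; ring
      rw [this, abs_mul, abs_two]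
      linarith [hs j]
    · simpa using h0
  refine (Finset.sum_le_sum this).trans (le_of_eq ?_)
  simp
  ring

theorem abs_pole_re_le {ε : ℝ} {s : Fin k → ℂ} (hs : ∀ j, |(s j).re - 1 / 2| ≤ ε)
    (J : Finset (Fin k)) : |(pole J s).re - 1| ≤ 2 * k * ε := by
  have h := abs_re_sum_le hs J (pole J s)
  rw [sigma_pole, Complex.one_re, abs_sub_comm] at h
  exact h

theorem abs_reflect_re_sub_half (J : Finset (Fin k)) (s : Fin k → ℂ) (j : Fin k) :
    |(reflect J s j).re - 1 / 2| = |(s j).re - 1 / 2| := by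
  unfold reflect
  split_ifs
  · rw [Complex.sub_re, Complex.one_re, abs_sub_comm]; congr 1; ring
  · rfl

/-! ### The functional equations -/

theorem prod_natCast_cpow {d : ℕ} (hd : 0 < d) (J : Finset (Fin k)) (a : Fin k → ℂ) :
    ∏ j ∈ J, (d : ℂ) ^ a j = (d : ℂ) ^ ∑ j ∈ J, a j := by
  have hd0 : (d : ℂ) ≠ 0 := by exact_mod_cast hd.ne'
  simp_rw [Complex.cpow_def_of_ne_zero hd0, ← Complex.exp_sum, Finset.mul_sum]

theorem prod_twistedL_reflect {κ : ℤ} (f : CuspForm 𝒮ℒ κ) (hκ : 12 ≤ κ) (hev : Even κ) {d : ℕ}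
    (hd : IsPosFundDisc d) (J : Finset (Fin k)) {s : Fin k → ℂ} (hs : ∀ j, (s j).re < 1) :
    ∏ j, twistedL f d (s j) = (∏ j ∈ J, gammaX κ (s j)) * (d : ℂ) ^ (∑ j ∈ J, (1 - 2 * s j)) *
      ∏ j, twistedL f d (reflect J s j) := by
  have hκ' : (12 : ℝ) ≤ κ := by exact_mod_cast hκ
  have h : ∀ j, twistedL f d (s j) =
      (if j ∈ J then gammaX κ (s j) * (d : ℂ) ^ (1 - 2 * s j) else 1) *
        twistedL f d (reflect J s j) := fun j => by
    unfold reflect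
    split_ifs
    · exact hd.twistedL_functional f (by omega) hev (by linarith [hs j])
    · rw [one_mul]
  rw [Finset.prod_congr rfl fun j _ => h j, Finset.prod_mul_distrib, Finset.prod_ite_mem,
    Finset.univ_inter, Finset.prod_mul_distrib, prod_natCast_cpow hd.pos]

/-- The functional equation is applied to each `d`, and the power `d^{1 - 2s_j}` is moved into `w`.
The identity is termwise and needs no convergence. -/
theorem mds_reflect {κ : ℤ} (f : CuspForm 𝒮ℒ κ) (hκ : 12 ≤ κ) (hev : Even κ) (M : ℕ)
    (J : Finset (Fin k)) {s : Fin k → ℂ} (hs : ∀ j, (s j).re < 1) (w : ℂ) :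
    mds f M s w = (∏ j ∈ J, gammaX κ (s j)) * mds f M (reflect J s) (sigma J s w) := by
  unfold mds
  rw [← tsum_mul_left]
  refine tsum_congr fun d => ?_
  split_ifs with hd
  · have hd0 : (d : ℂ) ≠ 0 := by exact_mod_cast hd.pos.ne'
    have hw : sigma J s w = w - ∑ j ∈ J, (1 - 2 * s j) := by
      rw [sigma, Finset.sum_sub_distrib, Finset.mul_sum]; simp; ring
    rw [prod_twistedL_reflect f hκ hev hd J hs, hw, Complex.cpow_sub _ _ hd0]
    have h1 : (d : ℂ) ^ w ≠ 0 := by simp [Complex.cpow_eq_zero_iff, hd0]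
    have h2 : (d : ℂ) ^ (∑ j ∈ J, (1 - 2 * s j)) ≠ 0 := by simp [Complex.cpow_eq_zero_iff, hd0]
    field_simp
  · rw [mul_zero]

theorem clearedMds_join {κ : ℤ} (f : CuspForm 𝒮ℒ κ) (M : ℕ) (s : Fin k → ℂ) (w : ℂ) :
    clearedMds f k M (join s w) = (∏ J : Finset (Fin k), (sigma J s w - 1)) * mds f M s w := by
  simp [clearedMds]

theorem prod_symmDiff {A : Type*} [CommMonoid A] (J : Finset (Fin k)) (F : Finset (Fin k) → A) :
    ∏ K, F (symmDiff K J) = ∏ K, F K :=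
  Equiv.prod_comp (Function.Involutive.toPerm (fun K => symmDiff K J)
    (symmDiff_symmDiff_cancel_right J)) F

theorem clearedMds_reflect {κ : ℤ} (f : CuspForm 𝒮ℒ κ) (hκ : 12 ≤ κ) (hev : Even κ) (M : ℕ)
    (J : Finset (Fin k)) {s : Fin k → ℂ} (hs : ∀ j, (s j).re < 1) (w : ℂ) :
    clearedMds f k M (join s w) =
      (∏ j ∈ J, gammaX κ (s j)) * clearedMds f k M (join (reflect J s) (sigma J s w)) := by
  rw [clearedMds_join, clearedMds_join, mds_reflect f hκ hev M J hs w]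
  simp_rw [sigma_reflect]
  rw [prod_symmDiff J fun K => sigma K s w - 1]
  ring

/-- A continuation of `∏_J (σ_J(w) - 1) · A_{f,M}(s; w)` to `Re s_j > 1/2 - ε`, `Re w > 1 - ε`. -/
structure IsQuadrantContinuation {κ : ℤ} (f : CuspForm 𝒮ℒ κ) (k M : ℕ) (ε W : ℝ) (m : ℕ)
    (Φ : (Fin (k + 1) → ℂ) → ℂ) : Prop where
  pos : 0 < ε
  le_half : ε ≤ 1 / 2
  one_le : 1 ≤ W
  majorized : ∀ σ ∈ farDomain k W, MdsMajorized f M σ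
  analytic : ∀ (s : Fin k → ℂ) (w : ℂ), (∀ j, 1 / 2 - ε < (s j).re) → 1 - ε < w.re →
    AnalyticAt ℂ Φ (join s w)
  eq_conv : ∀ (s : Fin k → ℂ) (w : ℂ), (∀ j, 1 < (s j).re) → 1 < w.re →
    Φ (join s w) = clearedMds f k M (join s w)
  eq_far : ∀ (s : Fin k → ℂ) (w : ℂ), (∀ j, 0 < (s j).re ∧ (s j).re < 2) → W < w.re →
    Φ (join s w) = clearedMds f k M (join s w)
  bounded : ∀ ε' < ε, ∀ x y : ℝ, 1 - ε < x → ∃ C, 0 ≤ C ∧ ∀ (s : Fin k → ℂ) (w : ℂ),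
    (∀ j, |(s j).re - 1 / 2| ≤ ε') → x ≤ w.re → w.re ≤ y →
      ‖Φ (join s w)‖ ≤ C * Real.exp (∑ j, (s j).im ^ 2) * (1 + w.im ^ 2) ^ (m + 1)

theorem IsContinuation.exists_isQuadrantContinuation {κ : ℤ} {f : CuspForm 𝒮ℒ κ} {M m : ℕ} {W : ℝ}
    {T : Set (Fin (k + 1) → ℝ)} {Φ : (Fin (k + 1) → ℂ) → ℂ} (h : IsContinuation f k M T W m Φ) :
    ∃ ε, IsQuadrantContinuation f k M ε W m Φ := by
  obtain ⟨ε, hε0, hε, hT⟩ := h.exists_quadrant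
  refine ⟨ε, hε0, hε, h.one_le, h.majorized, fun s w hs hw => h.analytic _ (hT _ ?_ ?_),
    fun s w hs hw => h.eq _ (Or.inl fun i => ?_), fun s w hs hw => h.eq _ (Or.inr ⟨?_, ?_⟩),
    fun ε' hε' x y hx => ?_⟩
  · simpa using hs
  · simpa using hw
  · refine Fin.lastCases ?_ (fun j => ?_) i
    · simpa using hw
    · simpa using hs j
  · simpa using hs
  · simpa using hw
  · set a : Fin (k + 1) → ℝ := Fin.snoc (fun _ => 1 / 2 - ε') x with ha
    set b : Fin (k + 1) → ℝ := Fin.snoc (fun _ => 1 / 2 + ε') y with hb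
    have hK : Icc a b ⊆ T := fun σ hσ => hT σ
      (fun j => by have := hσ.1 j.castSucc; simp [ha] at this; linarith)
      (by have := hσ.1 (Fin.last k); simp [ha] at this; linarith)
    obtain ⟨C, hC0, hC⟩ := h.bounded _ hK isCompact_Icc
    refine ⟨C, hC0, fun s w hs h1 h2 => ?_⟩
    have := hC (join s w) ⟨fun i => ?_, fun i => ?_⟩
    · simpa using this
    · refine Fin.lastCases ?_ (fun j => ?_) i
      · simpa [ha] using h1
      · have := abs_le.1 (hs j); simp [ha]; linarith
    · refine Fin.lastCases ?_ (fun j => ?_) i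
      · simpa [hb] using h2
      · have := abs_le.1 (hs j); simp [hb]; linarith

/-- For fixed `s` both sides are analytic in `w` on a half-plane and agree where `Re w` and `Re
σ_J(w)` both exceed `W`, so the identity theorem applies. The condition on `ε'` keeps the reflected
point inside the quadrant. -/
theorem IsQuadrantContinuation.functional {κ : ℤ} {f : CuspForm 𝒮ℒ κ} {M m : ℕ} {ε W : ℝ}
    {Φ : (Fin (k + 1) → ℂ) → ℂ} (h : IsQuadrantContinuation f k M ε W m Φ) (hκ : 12 ≤ κ)
    (hev : Even κ) {ε' : ℝ} (hε' : 4 * (k + 1) * ε' ≤ ε) (J : Finset (Fin k)) {s : Fin k → ℂ}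
    (hs : ∀ j, |(s j).re - 1 / 2| < ε') {w : ℂ} (hw : 1 - 2 * (k + 1) * ε' < w.re) :
    Φ (join s w) = (∏ j ∈ J, gammaX κ (s j)) * Φ (join (reflect J s) (sigma J s w)) := by
  have hpos := h.pos
  have hhalf := h.le_half
  have hkε : ∀ j : Fin k, 0 < ε' := fun j => (abs_nonneg _).trans_lt (hs j)
  have hk0 : (0 : ℝ) ≤ k := Nat.cast_nonneg k
  have hε4 : ∀ j : Fin k, 4 * ε' ≤ ε := fun j => by nlinarith [hkε j]
  have hsr : ∀ j, |(reflect J s j).re - 1 / 2| < ε' := fun j => by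
    rw [abs_reflect_re_sub_half]; exact hs j
  have hre : ∀ w : ℂ, w.re - 2 * k * ε' ≤ (sigma J s w).re := fun w => by
    have := abs_le.1 (abs_re_sum_le (fun j => (hs j).le) J w)
    linarith
  set H : Set ℂ := {w : ℂ | 1 - 2 * (k + 1) * ε' < w.re} with hH
  have hHo : IsPreconnected H := (convex_halfSpace_re_gt _).isPreconnected
  -- Positivity of `ε'` is read off from some variable `s_j`; with no variables the identity is
  -- trivial.
  by_cases hk : k = 0
  · subst hk
    have : J = ∅ := Finset.eq_empty_of_isEmpty J
    subst this
    have h1 : reflect ∅ s = s := by funext j; exact j.elim0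
    simp [h1, sigma]
  obtain ⟨j₀⟩ : Nonempty (Fin k) := ⟨⟨0, Nat.pos_of_ne_zero hk⟩⟩
  have hε0 := hkε j₀
  have hka : 0 ≤ k * ε' := by positivity
  have hA : AnalyticOnNhd ℂ (fun w => Φ (join s w)) H := fun w hw => by
    have hw' : 1 - 2 * (k + 1) * ε' < w.re := hw
    exact (analyticAt_comp_join (h.analytic s w (fun j => by
      have := (abs_lt.1 (hs j)).1; linarith [hε4 j]) (by nlinarith))).curry_right
  have hB : AnalyticOnNhd ℂ (fun w => (∏ j ∈ J, gammaX κ (s j)) *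
      Φ (join (reflect J s) (sigma J s w))) H := fun w hw => by
    have hw' : 1 - 2 * (k + 1) * ε' < w.re := hw
    refine analyticAt_const.mul ?_
    have h1 := (analyticAt_comp_join (h.analytic (reflect J s) (sigma J s w) (fun j => by
      have := (abs_lt.1 (hsr j)).1; linarith [hε4 j]) (by nlinarith [hre w]))).curry_right
    refine h1.fun_comp (f := fun w => sigma J s w) ?_
    unfold sigma
    exact (analyticAt_id.add analyticAt_const).sub analyticAt_const
  set w₀ : ℂ := ((W + 2 * (k + 1) * ε' + 1 : ℝ) : ℂ) with hw0
  have hw0H : w₀ ∈ H := by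
    simp only [hH, hw0, mem_ofPred_eq, Complex.ofReal_re]
    nlinarith [h.one_le]
  refine hA.eqOn_of_preconnected_of_eventuallyEq hB hHo hw0H ?_ hw
  have hnear : ∀ᶠ w : ℂ in 𝓝 w₀, W + 2 * (k + 1) * ε' < w.re := by
    refine Complex.continuous_re.continuousAt.eventually_const_lt ?_
    simp [hw0]
  filter_upwards [hnear] with w hw
  rw [h.eq_far s w (fun j => ?_) (by nlinarith), h.eq_far (reflect J s) _ (fun j => ?_) (by nlinarith [hre w]),
    clearedMds_reflect f hκ hev M J fun j => ?_]
  · have := (abs_lt.1 (hs j)).2; linarith [hε4 j]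
  · have := (abs_lt.1 (hsr j)); constructor <;> linarith [hε4 j]
  · have := (abs_lt.1 (hs j)); constructor <;> linarith [hε4 j]

end QuadTwist
end

noncomputable section

namespace QuadTwist

open MeasureTheory Filter Set Metric Topology

/-! ### Mellin transforms of test functions -/

theorem eventually_atTop_eq_zero {g : ℝ → ℂ} (hs : HasCompactSupport g) : ∀ᶠ x in atTop, g x = 0 := by
  obtain ⟨A, hA⟩ := hs.isCompact.bddAbove
  filter_upwards [eventually_gt_atTop A] with x hx
  exact image_eq_zero_of_notMem_tsupport fun h => absurd (hA h) (not_le.2 hx)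

theorem isBigO_atTop_test {g : ℝ → ℂ} (hs : HasCompactSupport g) (a : ℝ) :
    g =O[atTop] fun x => x ^ (-a) := by
  have h : g =ᶠ[atTop] fun _ => (0 : ℂ) := eventually_atTop_eq_zero hs
  exact h.trans_isBigO (Asymptotics.isBigO_zero _ _)

/-- Test functions need not vanish near `0`, so the Mellin transform is controlled only in `Re w >
0`. That suffices, all lines having `Re w > 1/2`. -/
theorem isBigO_zero_test {g : ℝ → ℂ} (hc : Continuous g) :
    g =O[𝓝[>] 0] fun x : ℝ => x ^ (-(0 : ℝ)) := by
  simp only [neg_zero, Real.rpow_zero]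
  exact (hc.tendsto 0).isBigO_one ℝ |>.mono nhdsWithin_le_nhds

theorem mellinConvergent_test {g : ℝ → ℂ} (hc : Continuous g) (hs : HasCompactSupport g) {w : ℂ}
    (hw : 0 < w.re) : MellinConvergent g w :=
  mellinConvergent_of_isBigO_rpow (hc.locallyIntegrable.locallyIntegrableOn _)
    (isBigO_atTop_test hs (w.re + 1)) (by linarith) (isBigO_zero_test hc) hw

theorem differentiableAt_mellin_test {g : ℝ → ℂ} (hc : Continuous g) (hs : HasCompactSupport g) {w : ℂ}
    (hw : 0 < w.re) : DifferentiableAt ℂ (mellin g) w :=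
  mellin_differentiableAt_of_isBigO_rpow (hc.locallyIntegrable.locallyIntegrableOn _)
    (isBigO_atTop_test hs (w.re + 1)) (by linarith) (isBigO_zero_test hc) hw

/-- For `a ≤ Re w ≤ b` the integrand is dominated by the sum of those at the two ends, one for `t ≤
1` and the other for `t ≥ 1`. -/
theorem exists_norm_mellin_le {g : ℝ → ℂ} (hc : Continuous g) (hs : HasCompactSupport g) {a : ℝ}
    (ha : 0 < a) (b : ℝ) : ∃ C, 0 ≤ C ∧ ∀ w : ℂ, a ≤ w.re → w.re ≤ b → ‖mellin g w‖ ≤ C := by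
  rcases lt_or_ge b a with hab | hab
  · exact ⟨0, le_rfl, fun w h1 h2 => absurd (h1.trans h2) (not_le.2 hab)⟩
  have hint : ∀ c : ℝ, 0 < c → IntegrableOn (fun t : ℝ => ‖(t : ℂ) ^ ((c : ℂ) - 1) • g t‖) (Ioi 0) :=
    fun c hc' => (mellinConvergent_test hc hs (w := (c : ℂ)) (by simpa using hc')).norm
  have hI := (hint a ha).add (hint b (ha.trans_le hab))
  refine ⟨_, integral_nonneg (f := (fun t : ℝ => ‖(t : ℂ) ^ ((a : ℂ) - 1) • g t‖) +
    fun t : ℝ => ‖(t : ℂ) ^ ((b : ℂ) - 1) • g t‖) (μ := volume.restrict (Ioi 0))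
    (fun t => by simp only [Pi.add_apply, Pi.zero_apply]; positivity), fun w h1 h2 => ?_⟩
  refine norm_integral_le_of_norm_le hI ?_
  filter_upwards [self_mem_ae_restrict measurableSet_Ioi] with t ht
  have ht0 : (0 : ℝ) < t := ht
  simp only [Pi.add_apply, norm_smul, Complex.norm_cpow_eq_rpow_re_of_pos ht0, Complex.sub_re,
    Complex.ofReal_re, Complex.one_re, ← add_mul]
  refine mul_le_mul_of_nonneg_right ?_ (norm_nonneg _)
  rcases le_total t 1 with h | h
  · exact (Real.rpow_le_rpow_of_exponent_ge ht0 h (by linarith)).trans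
      (le_add_of_nonneg_right (by positivity))
  · exact (Real.rpow_le_rpow_of_exponent_le h (by linarith)).trans
      (le_add_of_nonneg_left (by positivity))

/-- Integration by parts; the boundary terms vanish by `Re w > 0` at `0` and by compact support at
infinity. Iterating it gives decay of every polynomial order on vertical lines. -/
theorem mellin_deriv_test {g : ℝ → ℂ} (hg : ContDiff ℝ ∞ g) (hs : HasCompactSupport g) {w : ℂ}
    (hw : 0 < w.re) : mellin (deriv g) (w + 1) = -w * mellin g w := by
  have hg' : Continuous (deriv g) := (contDiff_infty_iff_deriv.1 hg).2.continuous
  have h1 := mellinConvergent_test hg' hs.deriv (w := w + 1) (by simp; linarith)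
  have h2 := mellinConvergent_test hg.continuous hs hw
  have hw0 : w ≠ 0 := fun h => by simp [h] at hw
  have key := integral_Ioi_mul_deriv_eq_deriv_mul (a := 0) (a' := (0 : ℂ)) (b' := 0)
    (u := fun x : ℝ => (x : ℂ) ^ w) (u' := fun x : ℝ => w * (x : ℂ) ^ (w - 1)) (v := g) (v' := deriv g)
    (fun x hx => hasDerivAt_ofReal_cpow_const (ne_of_gt hx) hw0)
    (fun x _ => (hg.differentiable (by simp)).differentiableAt.hasDerivAt)
    (by simpa [MellinConvergent, smul_eq_mul, Pi.mul_def] using h1)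
    (by
      have := h2.const_mul w
      simpa [MellinConvergent, IntegrableOn, smul_eq_mul, Pi.mul_def, mul_assoc] using this)
    (by
      have h3 : Tendsto (fun x : ℝ => (x : ℂ) ^ w * g x) (𝓝[>] 0) (𝓝 ((0 : ℂ) ^ w * g 0)) := by
        refine (((Complex.continuousAt_ofReal_cpow_const 0 w (Or.inl hw)).mul
          hg.continuous.continuousAt).tendsto.mono_left nhdsWithin_le_nhds).trans ?_
        simp
      rw [Complex.zero_cpow hw0, zero_mul] at h3
      exact h3)
    (tendsto_const_nhds.congr' ((eventually_atTop_eq_zero hs).mono fun x hx => by simp [hx]))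
  unfold mellin
  simp only [add_sub_cancel_right, smul_eq_mul]
  rw [key, sub_zero, zero_sub, ← integral_const_mul, ← integral_neg]
  exact integral_congr_ae (Eventually.of_forall fun x => by simp [mul_assoc])

theorem exists_pow_mul_norm_mellin_le (N : ℕ) : ∀ {g : ℝ → ℂ}, ContDiff ℝ ∞ g → HasCompactSupport g →
    ∀ {a : ℝ}, 0 < a → ∀ b : ℝ, ∃ C, 0 ≤ C ∧ ∀ w : ℂ, a ≤ w.re → w.re ≤ b →
      ‖w‖ ^ N * ‖mellin g w‖ ≤ C := by
  induction N with
  | zero =>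
    intro g hg hs a ha b
    simpa using exists_norm_mellin_le hg.continuous hs ha b
  | succ N ih =>
    intro g hg hs a ha b
    obtain ⟨C, hC0, hC⟩ := ih (contDiff_infty_iff_deriv.1 hg).2 hs.deriv (a := a + 1) (by linarith) (b + 1)
    refine ⟨C, hC0, fun w h1 h2 => le_trans ?_ (hC (w + 1) (by simpa using h1) (by simpa using h2))⟩
    rw [mellin_deriv_test hg hs (by linarith), norm_mul, norm_neg, pow_succ, mul_assoc]
    have : ‖w‖ ≤ ‖w + 1‖ := by
      rw [← sq_le_sq₀ (norm_nonneg _) (norm_nonneg _), Complex.sq_norm, Complex.sq_norm,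
        Complex.normSq_apply, Complex.normSq_apply]
      simp
      nlinarith
    gcongr

theorem exists_norm_mellin_le_inv {g : ℝ → ℂ} (hg : ContDiff ℝ ∞ g) (hs : HasCompactSupport g)
    (N : ℕ) {a : ℝ} (ha : 0 < a) (b : ℝ) : ∃ C, 0 ≤ C ∧ ∀ w : ℂ, a ≤ w.re → w.re ≤ b →
      ‖mellin g w‖ ≤ C * ((1 + w.im ^ 2) ^ N)⁻¹ := by
  obtain ⟨C, hC0, hC⟩ := exists_pow_mul_norm_mellin_le (2 * N) hg hs ha b
  refine ⟨(1 + (a ^ 2)⁻¹) ^ N * C, by positivity, fun w h1 h2 => ?_⟩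
  rw [← div_eq_mul_inv, le_div_iff₀ (by positivity)]
  have h3 : 1 + w.im ^ 2 ≤ (1 + (a ^ 2)⁻¹) * ‖w‖ ^ 2 := by
    rw [Complex.sq_norm, Complex.normSq_apply]
    have h4 : a ^ 2 ≤ w.re * w.re := by nlinarith
    have h5 : 1 ≤ (a ^ 2)⁻¹ * (w.re * w.re) := by
      rw [← div_eq_inv_mul, one_le_div (by positivity)]; exact h4
    nlinarith [mul_nonneg (inv_nonneg.2 (sq_nonneg a)) (mul_self_nonneg w.im), mul_self_nonneg w.re]
  calc ‖mellin g w‖ * (1 + w.im ^ 2) ^ N ≤ ‖mellin g w‖ * ((1 + (a ^ 2)⁻¹) * ‖w‖ ^ 2) ^ N := by gcongr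
    _ = (1 + (a ^ 2)⁻¹) ^ N * (‖w‖ ^ (2 * N) * ‖mellin g w‖) := by rw [mul_pow, ← pow_mul]; ring
    _ ≤ _ := by gcongr; exact hC w h1 h2

theorem continuous_mellin_vertical {g : ℝ → ℂ} (hc : Continuous g) (hs : HasCompactSupport g) {c : ℝ}
    (hcp : 0 < c) : Continuous fun t : ℝ => mellin g (c + t * Complex.I) :=
  continuous_iff_continuousAt.2 fun t => ContinuousAt.comp (f := fun t : ℝ => (c : ℂ) + t * Complex.I)
    (differentiableAt_mellin_test hc hs (by simpa using hcp)).continuousAt (by fun_prop)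

theorem integrable_mellin_vertical {g : ℝ → ℂ} (hg : ContDiff ℝ ∞ g) (hs : HasCompactSupport g) {c : ℝ}
    (hcp : 0 < c) : Integrable fun t : ℝ => mellin g (c + t * Complex.I) := by
  obtain ⟨C, hC0, hC⟩ := exists_norm_mellin_le_inv hg hs 1 hcp c
  refine (integrable_one_div_one_add_sq.const_mul C).mono'
    (continuous_mellin_vertical hg.continuous hs hcp).aestronglyMeasurable (Eventually.of_forall fun t => ?_)
  simpa using hC (c + t * Complex.I) (by simp) (by simp)

/-! ### The moment as a vertical integral -/

variable {k : ℕ}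

/-- Mellin inversion for each `d`, summed; the exchange is justified by the majorant of the
Dirichlet series on the line and the integrability of `g̃`. -/
theorem moment_eq_integral {κ : ℤ} {f : CuspForm 𝒮ℒ κ} {M : ℕ} {W : ℝ} (hW : 1 ≤ W)
    (hmaj : ∀ σ ∈ farDomain k W, MdsMajorized f M σ) {g : ℝ → ℂ} (hg : ContDiff ℝ ∞ g)
    (hgs : HasCompactSupport g) {X : ℝ} (hX : 0 < X) {s : Fin k → ℂ}
    (hs : ∀ j, 0 < (s j).re ∧ (s j).re < 2) {c : ℝ} (hc : W < c) :
    moment f M g X s = 1 / (2 * Real.pi) * ∫ t : ℝ, mds f M s (c + t * Complex.I) *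
      (X : ℂ) ^ ((c : ℂ) + t * Complex.I) * mellin g (c + t * Complex.I) := by
  have hc0 : 0 < c := by linarith
  have hσ : (fun i => (join s (c : ℂ) i).re) ∈ farDomain k W := ⟨by simpa using hs, by simpa using hc⟩
  obtain ⟨r, hr, b, hb0, hb, hbound⟩ := hmaj _ hσ
  set E := Real.exp (Real.pi * ∑ j : Fin k, |(s j).im|) with hE
  have hterm : ∀ (t : ℝ) d, ‖mdsTerm f M (join s (c + t * Complex.I)) d‖ ≤ b d * E := fun t d => by
    have := hbound (join s (c + t * Complex.I)) (by
      rw [mem_ball, dist_eq_norm]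
      convert hr
      rw [norm_eq_zero]
      funext i
      refine Fin.lastCases ?_ (fun j => ?_) i <;> simp) d
    simpa using this
  have hXn : ∀ t : ℝ, ‖(X : ℂ) ^ ((c : ℂ) + t * Complex.I)‖ = X ^ c := fun t => by
    rw [Complex.norm_cpow_eq_rpow_re_of_pos hX]; simp
  have hX0 : (X : ℂ) ≠ 0 := by exact_mod_cast hX.ne'
  have hGi := integrable_mellin_vertical hg hgs hc0
  have hGc := continuous_mellin_vertical hg.continuous hgs hc0
  have hXc : Continuous fun t : ℝ => (X : ℂ) ^ ((c : ℂ) + t * Complex.I) :=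
    Continuous.const_cpow (by fun_prop) (Or.inl hX0)
  set F : ℕ → ℝ → ℂ := fun d t => mdsTerm f M (join s (c + t * Complex.I)) d *
    (X : ℂ) ^ ((c : ℂ) + t * Complex.I) * mellin g (c + t * Complex.I) with hF
  have hFc : ∀ d, Continuous (F d) := fun d => by
    refine (Continuous.mul ?_ hXc).mul hGc
    by_cases hd : IsPosFundDisc d
    · have hd0 : (d : ℂ) ≠ 0 := by exact_mod_cast hd.pos.ne'
      simp only [mdsTerm, if_pos hd, join_castSucc, join_last]
      exact continuous_const.div (Continuous.const_cpow (by fun_prop) (Or.inl hd0))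
        fun t => by simp [Complex.cpow_eq_zero_iff, hd0]
    · simp only [mdsTerm, if_neg hd]; exact continuous_const
  have hFb : ∀ d t, ‖F d t‖ ≤ b d * E * X ^ c * ‖mellin g (c + t * Complex.I)‖ := fun d t => by
    rw [hF]
    simp only [norm_mul, hXn]
    gcongr
    exact hterm t d
  have hFi : ∀ d, Integrable (F d) := fun d =>
    (hGi.norm.const_mul _).mono' (hFc d).aestronglyMeasurable (Eventually.of_forall (hFb d))
  have key := hasSum_integral_of_summable_integral_norm hFi
    (Summable.of_nonneg_of_le (fun d => integral_nonneg fun t => norm_nonneg _) (fun d => by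
      refine (integral_mono (hFi d).norm (hGi.norm.const_mul _) (hFb d)).trans_eq ?_
      rw [integral_const_mul])
      (((hb.mul_right E).mul_right (X ^ c)).mul_right _))
  have hsum : ∀ t : ℝ, ∑' d, F d t = mds f M s (c + t * Complex.I) *
      (X : ℂ) ^ ((c : ℂ) + t * Complex.I) * mellin g (c + t * Complex.I) := fun t => by
    have := mds_eq_tsum_mdsTerm f M (join s (c + t * Complex.I))
    simp only [join_castSucc, join_last] at this
    rw [this, ← tsum_mul_right, ← tsum_mul_right]
  simp_rw [hsum] at key
  rw [← key.tsum_eq, ← tsum_mul_left, moment]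
  refine tsum_congr fun d => ?_
  split_ifs with hd
  · have hd0 : (0 : ℝ) < d := by exact_mod_cast hd.pos
    have hdc : (d : ℂ) ≠ 0 := by exact_mod_cast hd.pos.ne'
    have hinv := mellinInv_mellin_eq c g (div_pos hd0 hX)
      (mellinConvergent_test hg.continuous hgs (by simpa using hc0)) hGi hg.continuous.continuousAt
    rw [← hinv, mellinInv, Complex.real_smul, mul_assoc, mul_assoc, mul_comm (∫ _, _), ← integral_const_mul]
    push_cast
    congr 2
    funext t
    simp only [hF, mdsTerm, if_pos hd, join_castSucc, join_last, smul_eq_mul]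
    set w := (c : ℂ) + t * Complex.I
    have h1 : (d : ℂ) ^ w = ((d : ℂ) / X) ^ w * (X : ℂ) ^ w := by
      have := Complex.mul_cpow_ofReal_nonneg (div_pos hd0 hX).le hX.le w
      push_cast at this
      rw [← this, div_mul_cancel₀ _ hX0]
    have h2 : (X : ℂ) ^ w ≠ 0 := by simp [Complex.cpow_eq_zero_iff, hX0]
    have h3 : ((d : ℂ) / X) ^ w ≠ 0 := by simp [Complex.cpow_eq_zero_iff, hX0, hdc]
    rw [h1, Complex.cpow_neg]
    field_simp
  · simp [hF, mdsTerm, if_neg hd]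

end QuadTwist
end

noncomputable section

namespace QuadTwist

open MeasureTheory Filter Set Metric Topology

variable {k : ℕ}

/-! ### The integrand of the Perron-type integrals -/

/-- `Φ(s, w) X^w g̃(w)`. -/
def mellinWeighted (Φ : (Fin (k + 1) → ℂ) → ℂ) (g : ℝ → ℂ) (X : ℝ) (s : Fin k → ℂ) (w : ℂ) : ℂ :=
  Φ (join s w) * (X : ℂ) ^ w * mellin g w

/-- `Φ(s, w) X^w g̃(w) / ∏_J (σ_J(w) - 1)`. -/
def perronIntegrand (Φ : (Fin (k + 1) → ℂ) → ℂ) (g : ℝ → ℂ) (X : ℝ) (s : Fin k → ℂ) (w : ℂ) : ℂ :=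
  mellinWeighted Φ g X s w / ∏ J : Finset (Fin k), (w - pole J s)

/-- The integral of the Perron integrand over `Re w = ℓ`, divided by `2πi`. -/
def perron (Φ : (Fin (k + 1) → ℂ) → ℂ) (g : ℝ → ℂ) (X ℓ : ℝ) (s : Fin k → ℂ) : ℂ :=
  1 / (2 * Real.pi) * ∫ t : ℝ, perronIntegrand Φ g X s (ℓ + t * Complex.I)

theorem differentiable_pole (J : Finset (Fin k)) : Differentiable ℂ (pole J) := by
  unfold pole; fun_prop

section

variable {κ : ℤ} {f : CuspForm 𝒮ℒ κ} {M m : ℕ} {ε W : ℝ} {Φ : (Fin (k + 1) → ℂ) → ℂ}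

/-- With this choice every pole stays within `ε/4` of `Re w = 1`, while the lines used are at
distance at least `ε/2`. -/
theorem IsQuadrantContinuation.four_mul_le (h : IsQuadrantContinuation f k M ε W m Φ) {ε' : ℝ}
    (hε' : 8 * (k + 1) * ε' ≤ ε) : 8 * ε' ≤ ε ∧ 2 * k * ε' ≤ ε / 4 ∧ ε' < ε := by
  have hpos := h.pos
  have hk0 : (0 : ℝ) ≤ k := Nat.cast_nonneg k
  rcases le_total ε' 0 with h0 | h0
  · have : k * ε' ≤ 0 := mul_nonpos_of_nonneg_of_nonpos hk0 h0
    refine ⟨?_, ?_, ?_⟩ <;> nlinarith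
  · have : 0 ≤ k * ε' := by positivity
    refine ⟨?_, ?_, ?_⟩ <;> nlinarith

theorem IsQuadrantContinuation.mellinWeighted_bound (h : IsQuadrantContinuation f k M ε W m Φ)
    {ε' : ℝ} (hε' : ε' < ε) {g : ℝ → ℂ} (hg : ContDiff ℝ ∞ g) (hs : HasCompactSupport g) {x : ℝ}
    (hx : 1 - ε < x) (y : ℝ) : ∃ C, 0 ≤ C ∧ ∀ X : ℝ, 0 < X → ∀ (s : Fin k → ℂ) (w : ℂ),
      (∀ j, |(s j).re - 1 / 2| ≤ ε') → x ≤ w.re → w.re ≤ y →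
        ‖mellinWeighted Φ g X s w‖ ≤ C * Real.exp (∑ j, (s j).im ^ 2) * X ^ w.re * (1 / (1 + w.im ^ 2)) := by
  obtain ⟨C, hC0, hC⟩ := h.bounded ε' hε' x y hx
  -- Order `m + 2` exceeds the growth `m + 1` of `Φ` by exactly the factor needed for integrability.
  obtain ⟨D, hD0, hD⟩ := exists_norm_mellin_le_inv hg hs (m + 2) (a := x)
    (by linarith [h.le_half]) y
  refine ⟨C * D, by positivity, fun X hX s w h1 h2 h3 => ?_⟩
  rw [mellinWeighted, norm_mul, norm_mul, Complex.norm_cpow_eq_rpow_re_of_pos hX]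
  have h4 := hC s w h1 h2 h3
  have h5 := hD w h2 h3
  have h6 : 0 < 1 + w.im ^ 2 := by positivity
  calc _ ≤ C * Real.exp (∑ j, (s j).im ^ 2) * (1 + w.im ^ 2) ^ (m + 1) * X ^ w.re *
        (D * ((1 + w.im ^ 2) ^ (m + 2))⁻¹) := by gcongr
    _ = _ := by
        rw [pow_succ (1 + w.im ^ 2) (m + 1)]
        field_simp

theorem IsQuadrantContinuation.perronIntegrand_bound (h : IsQuadrantContinuation f k M ε W m Φ)
    {ε' : ℝ} (hε' : 8 * (k + 1) * ε' ≤ ε) {g : ℝ → ℂ} (hg : ContDiff ℝ ∞ g) (hs : HasCompactSupport g)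
    {ℓ : ℝ} (hℓ : 1 - ε < ℓ) (hgap : ε / 2 ≤ |ℓ - 1|) :
    ∃ C, 0 ≤ C ∧ ∀ X : ℝ, 0 < X → ∀ (s : Fin k → ℂ) (t : ℝ),
      (∀ j, |(s j).re - 1 / 2| ≤ ε') →
        ‖perronIntegrand Φ g X s (ℓ + t * Complex.I)‖ ≤
          C * Real.exp (∑ j, (s j).im ^ 2) * X ^ ℓ * (1 / (1 + t ^ 2)) := by
  obtain ⟨h8, h2k, hlt⟩ := h.four_mul_le hε'
  have hpos := h.pos
  obtain ⟨C, hC0, hC⟩ := h.mellinWeighted_bound hlt hg hs hℓ ℓ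
  refine ⟨C * ((ε / 4) ^ 2 ^ k)⁻¹, by positivity, fun X hX s t h1 => ?_⟩
  have h2 := hC X hX s (ℓ + t * Complex.I) h1 (by simp) (by simp)
  have h3 : (ε / 4) ^ 2 ^ k ≤ ‖∏ J : Finset (Fin k), ((ℓ : ℂ) + t * Complex.I - pole J s)‖ := by
    rw [norm_prod]
    have : (ε / 4) ^ 2 ^ k = ∏ _J : Finset (Fin k), ε / 4 := by
      rw [Finset.prod_const, Finset.card_univ, Fintype.card_finset, Fintype.card_fin]
    rw [this]
    refine Finset.prod_le_prod (fun _ _ => by positivity) fun J _ => ?_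
    refine le_trans ?_ (Complex.abs_re_le_norm _)
    have h4 := abs_pole_re_le h1 J
    have h5 := abs_sub_abs_le_abs_sub (ℓ - 1) ((pole J s).re - 1)
    rw [show ℓ - 1 - ((pole J s).re - 1) = ℓ - (pole J s).re by ring] at h5
    simp
    linarith
  rw [perronIntegrand, norm_div, div_eq_mul_inv]
  have h5 : ‖∏ J : Finset (Fin k), ((ℓ : ℂ) + t * Complex.I - pole J s)‖⁻¹ ≤ ((ε / 4) ^ 2 ^ k)⁻¹ :=
    inv_anti₀ (by positivity) h3
  have h2' : ‖mellinWeighted Φ g X s (ℓ + t * Complex.I)‖ ≤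
      C * Real.exp (∑ j, (s j).im ^ 2) * X ^ ℓ * (1 / (1 + t ^ 2)) := by simpa using h2
  refine (mul_le_mul h2' h5 (by positivity) (by positivity)).trans (le_of_eq (by ring))

theorem line_sub_pole_ne_zero (hpos : 0 < ε) {ε' : ℝ} (hε' : 2 * k * ε' ≤ ε / 4) {ℓ : ℝ}
    (hgap : ε / 2 ≤ |ℓ - 1|) {s : Fin k → ℂ} (hs : ∀ j, |(s j).re - 1 / 2| ≤ ε')
    (J : Finset (Fin k)) (t : ℝ) : (ℓ : ℂ) + t * Complex.I - pole J s ≠ 0 := fun h => by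
  have h4 := abs_pole_re_le hs J
  have h5 := congrArg Complex.re h
  simp [sub_eq_zero] at h5
  rw [← h5] at h4
  linarith

theorem IsQuadrantContinuation.differentiableOn_mellinWeighted
    (h : IsQuadrantContinuation f k M ε W m Φ) {ε' : ℝ} (hε' : ε' < ε) {g : ℝ → ℂ}
    (hg : Continuous g) (hgs : HasCompactSupport g) {X : ℝ} (hX : 0 < X) {s : Fin k → ℂ}
    (hs : ∀ j, |(s j).re - 1 / 2| ≤ ε') (q : ℝ) :
    DifferentiableOn ℂ (mellinWeighted Φ g X s) {w | 1 - ε < w.re ∧ w.re < q} := fun w hw => by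
  have hX0 : (X : ℂ) ≠ 0 := by exact_mod_cast hX.ne'
  refine DifferentiableAt.differentiableWithinAt ((DifferentiableAt.mul ?_ ?_).mul
    (differentiableAt_mellin_test hg hgs (by linarith [hw.1, h.le_half])))
  · exact ((analyticAt_comp_join (h.analytic s w (fun j => by
      have := (abs_le.1 (hs j)).1; linarith) hw.1)).curry_right).differentiableAt
  · exact DifferentiableAt.const_cpow differentiableAt_id (Or.inl hX0)

/-- No pole meets the line for `s` in this polystrip, so the integral is holomorphic in `s` even
where poles collide. This makes `R_X` holomorphic. -/
theorem IsQuadrantContinuation.differentiableOn_perron (h : IsQuadrantContinuation f k M ε W m Φ)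
    {ε' : ℝ} (hε' : 8 * (k + 1) * ε' ≤ ε) {g : ℝ → ℂ} (hg : ContDiff ℝ ∞ g) (hgs : HasCompactSupport g)
    {ℓ : ℝ} (hℓ : 1 - ε < ℓ) (hgap : ε / 2 ≤ |ℓ - 1|) {X : ℝ} (hX : 0 < X) :
    DifferentiableOn ℂ (perron Φ g X ℓ) {s | ∀ j, |(s j).re - 1 / 2| < ε'} := by
  obtain ⟨h8, h2k, hlt⟩ := h.four_mul_le hε'
  obtain ⟨C, hC0, hC⟩ := h.perronIntegrand_bound hε' hg hgs hℓ hgap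
  have hU : IsOpen {s : Fin k → ℂ | ∀ j, |(s j).re - 1 / 2| < ε'} := by
    simp only [ofPred_forall]
    exact isOpen_iInter_of_finite fun j => isOpen_lt (by fun_prop) continuous_const
  unfold perron
  refine DifferentiableOn.const_mul (differentiableOn_integral hU
    (Φ := fun s (t : ℝ) => perronIntegrand Φ g X s (ℓ + t * Complex.I)) (fun t => ?_) (fun s hs => ?_)
    (fun s hs => ?_)) _
  · intro s hs
    simp only [perronIntegrand, mellinWeighted, div_eq_mul_inv]
    refine DifferentiableAt.differentiableWithinAt (DifferentiableAt.mul ?_ (DifferentiableAt.inv ?_ ?_))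
    · refine DifferentiableAt.mul_const (DifferentiableAt.mul_const ?_ _) _
      exact ((analyticAt_comp_join (h.analytic s _ (fun j => by
        have := (abs_lt.1 (hs j)).1; linarith) (by simpa using hℓ))).curry_left).differentiableAt
    · exact (differentiableOn_univ.1 (differentiableOn_finsetProd _ fun J _ =>
        ((differentiable_pole J).const_sub _).differentiableOn)).differentiableAt
    · exact Finset.prod_ne_zero_iff.2 fun J _ =>
        line_sub_pole_ne_zero h.pos h2k hgap (fun j => (hs j).le) J t
  · have h1 := continuous_vertical (h.differentiableOn_mellinWeighted hlt hg.continuous hgs hX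
      (fun j => (hs j).le) (ℓ + 1)) (z := (ℓ : ℂ)) (by simpa using hℓ)
    refine Continuous.aestronglyMeasurable (h1.div (by fun_prop) fun t => ?_)
    exact Finset.prod_ne_zero_iff.2 fun J _ =>
        line_sub_pole_ne_zero h.pos h2k hgap (fun j => (hs j).le) J t
  · refine ⟨1, one_pos, fun t => C * Real.exp (∑ j, (|(s j).im| + 1) ^ 2) * X ^ ℓ * (1 / (1 + t ^ 2)),
      integrable_one_div_one_add_sq.const_mul _, fun x hx hxU t =>
        (hC X hX x t fun j => (hxU j).le).trans ?_⟩
    rw [mem_ball, dist_pi_lt_iff one_pos] at hx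
    have : ∀ j, (x j).im ^ 2 ≤ (|(s j).im| + 1) ^ 2 := fun j => by
      rw [← sq_abs]
      refine pow_le_pow_left₀ (abs_nonneg _) ?_ 2
      have h1 := hx j
      rw [dist_eq_norm] at h1
      have h2 := Complex.abs_im_le_norm (x j - s j)
      rw [Complex.sub_im] at h2
      have := abs_sub_abs_le_abs_sub (x j).im (s j).im
      linarith
    beta_reduce
    gcongr C * Real.exp (∑ j, ?_) * _ * _
    exact this _

theorem IsQuadrantContinuation.norm_perron_le (h : IsQuadrantContinuation f k M ε W m Φ)
    {ε' : ℝ} (hε' : 8 * (k + 1) * ε' ≤ ε) {g : ℝ → ℂ} (hg : ContDiff ℝ ∞ g) (hgs : HasCompactSupport g)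
    {ℓ : ℝ} (hℓ : 1 - ε < ℓ) (hgap : ε / 2 ≤ |ℓ - 1|) (B : ℝ) :
    ∃ K, ∀ X : ℝ, 0 < X → ∀ s : Fin k → ℂ, (∀ j, |(s j).re - 1 / 2| ≤ ε') → (∀ j, |(s j).im| ≤ B) →
      ‖perron Φ g X ℓ s‖ ≤ K * X ^ ℓ := by
  obtain ⟨C, hC0, hC⟩ := h.perronIntegrand_bound hε' hg hgs hℓ hgap
  refine ⟨1 / (2 * Real.pi) * (C * Real.exp (k * B ^ 2) * ∫ t : ℝ, 1 / (1 + t ^ 2)),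
    fun X hX s hs hB => ?_⟩
  have h1 : ∀ t : ℝ, ‖perronIntegrand Φ g X s (ℓ + t * Complex.I)‖ ≤
      C * Real.exp (k * B ^ 2) * X ^ ℓ * (1 / (1 + t ^ 2)) := fun t => (hC X hX s t hs).trans (by
    have : ∑ j, (s j).im ^ 2 ≤ k * B ^ 2 := by
      refine (Finset.sum_le_sum (g := fun _ => B ^ 2) fun j _ => ?_).trans_eq (by simp)
      rw [← sq_abs]
      exact pow_le_pow_left₀ (abs_nonneg _) (hB j) 2
    gcongr)
  have h2 := norm_integral_le_of_norm_le (integrable_one_div_one_add_sq.const_mul _)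
    (Eventually.of_forall h1)
  rw [integral_const_mul] at h2
  rw [perron, norm_mul]
  have h3 : ‖(1 / (2 * Real.pi) : ℂ)‖ = 1 / (2 * Real.pi) := by
    rw [norm_div, norm_mul, norm_one, Complex.norm_ofNat, Complex.norm_real,
      Real.norm_of_nonneg Real.pi_pos.le]
  rw [h3]
  refine (mul_le_mul_of_nonneg_left h2 (by positivity)).trans_eq (by ring)

/-- On the line `Re w = W + 1` the continuation is the Dirichlet series itself, and the cleared
factors cancel against the denominator. -/
theorem IsQuadrantContinuation.moment_eq_perron (h : IsQuadrantContinuation f k M ε W m Φ)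
    {ε' : ℝ} (hε' : 8 * (k + 1) * ε' ≤ ε) {g : ℝ → ℂ} (hg : ContDiff ℝ ∞ g) (hgs : HasCompactSupport g)
    {X : ℝ} (hX : 0 < X) {s : Fin k → ℂ} (hs : ∀ j, |(s j).re - 1 / 2| ≤ ε') :
    moment f M g X s = perron Φ g X (W + 1) s := by
  obtain ⟨h8, h2k, hlt⟩ := h.four_mul_le hε'
  have hW := h.one_le
  have hhalf := h.le_half
  have hstrip : ∀ j, 0 < (s j).re ∧ (s j).re < 2 := fun j => by
    have := abs_le.1 (hs j); constructor <;> linarith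
  rw [moment_eq_integral h.one_le h.majorized hg hgs hX hstrip (lt_add_one W), perron]
  congr 1
  refine integral_congr_ae (Eventually.of_forall fun t => ?_)
  beta_reduce
  rw [perronIntegrand, mellinWeighted, h.eq_far s _ hstrip (by simp), clearedMds_join]
  simp_rw [sigma_sub_one]
  have h0 : ∏ J : Finset (Fin k), (((W + 1 : ℝ) : ℂ) + t * Complex.I - pole J s) ≠ 0 :=
    Finset.prod_ne_zero_iff.2 fun J _ => line_sub_pole_ne_zero h.pos h2k
      (by rw [add_sub_cancel_right, abs_of_nonneg (by linarith)]; linarith) hs J t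
  field_simp

end

end QuadTwist
end

noncomputable section

namespace QuadTwist

open MeasureTheory Filter Set Metric Topology

variable {k : ℕ}

/-! ### Residues and the recipe sum -/

/-- The continuation of `H_{f,M}`: the residue of the multiple Dirichlet series at `w = 1`. -/
def continuedH (Φ : (Fin (k + 1) → ℂ) → ℂ) (s : Fin k → ℂ) : ℂ :=
  Φ (join s 1) / ∏ J ∈ Finset.univ.erase (∅ : Finset (Fin k)), (1 - pole J s)

/-- Reflecting in `J` moves the pole `w = 1` to the pole attached to `J`, so the differences of
poles correspond under symmetric difference with `J`. -/
theorem prod_erase_reflect (J : Finset (Fin k)) (s : Fin k → ℂ) :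
    ∏ K ∈ Finset.univ.erase (∅ : Finset (Fin k)), (1 - pole K (reflect J s)) =
      ∏ K ∈ Finset.univ.erase J, (pole J s - pole K s) := by
  refine Finset.prod_bij' (fun K _ => symmDiff K J) (fun K _ => symmDiff K J) (fun K hK => ?_)
    (fun K hK => ?_) (fun K _ => symmDiff_symmDiff_cancel_right J K)
    (fun K _ => symmDiff_symmDiff_cancel_right J K) fun K _ => ?_
  · refine Finset.mem_erase.2 ⟨fun h => (Finset.mem_erase.1 hK).1 ?_, Finset.mem_univ _⟩
    rwa [symmDiff_eq_right] at h
  · refine Finset.mem_erase.2 ⟨fun h => (Finset.mem_erase.1 hK).1 ?_, Finset.mem_univ _⟩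
    exact symmDiff_eq_bot.1 h
  · rw [← sigma_sub_one, ← sigma_sub_one, ← sigma_reflect, sigma_pole]

/-- Partial fractions, read off from Lagrange interpolation of the constant `1` at the nodes `p i`.
-/
theorem inv_prod_sub_eq_sum {ι : Type*} [Fintype ι] [DecidableEq ι] [Nonempty ι] {p : ι → ℂ}
    (hp : Function.Injective p) {w : ℂ} (hw : ∀ i, w - p i ≠ 0) :
    (∏ i, (w - p i))⁻¹ = ∑ i, (∏ j ∈ Finset.univ.erase i, (p i - p j))⁻¹ * (w - p i)⁻¹ := by
  have h := Lagrange.eval_interpolate_not_at_node (s := Finset.univ) (v := p) (x := w) (1 : ι → ℂ)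
    (fun i _ => sub_ne_zero.1 (hw i))
  rw [Lagrange.interpolate_one hp.injOn Finset.univ_nonempty, Polynomial.eval_one,
    Lagrange.eval_nodal] at h
  rw [← eq_inv_of_mul_eq_one_right h.symm]
  simp only [Lagrange.nodalWeight, Finset.prod_inv_distrib, Pi.one_apply, mul_one]

variable {κ : ℤ} {f : CuspForm 𝒮ℒ κ} {M m : ℕ} {ε W : ℝ} {Φ : (Fin (k + 1) → ℂ) → ℂ}

theorem IsQuadrantContinuation.stripDecay (h : IsQuadrantContinuation f k M ε W m Φ)
    {ε' : ℝ} (hε' : ε' < ε) {g : ℝ → ℂ} (hg : ContDiff ℝ ∞ g) (hgs : HasCompactSupport g) {X : ℝ}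
    (hX : 0 < X) {s : Fin k → ℂ} (hs : ∀ j, |(s j).re - 1 / 2| ≤ ε') (q : ℝ) :
    StripDecay (1 - ε) q (mellinWeighted Φ g X s) := fun x y hx _ => by
  obtain ⟨C, hC0, hC⟩ := h.mellinWeighted_bound hε' hg hgs hx y
  refine ⟨C * Real.exp (∑ j, (s j).im ^ 2) * (X ^ x + X ^ y), fun w h1 h2 =>
    (hC X hX s w hs h1 h2).trans ?_⟩
  have : X ^ w.re ≤ X ^ x + X ^ y := by
    rcases le_total X 1 with h | h
    · exact (Real.rpow_le_rpow_of_exponent_ge hX h h1).trans (le_add_of_nonneg_right (by positivity))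
    · exact (Real.rpow_le_rpow_of_exponent_le h h2).trans (le_add_of_nonneg_left (by positivity))
  gcongr

theorem perron_eq_sum {ε' : ℝ} (h : IsQuadrantContinuation f k M ε W m Φ)
    (hε' : 8 * (k + 1) * ε' ≤ ε) {g : ℝ → ℂ} (hg : ContDiff ℝ ∞ g) (hgs : HasCompactSupport g)
    {ℓ : ℝ} (hℓ : 1 - ε < ℓ) (hgap : ε / 2 ≤ |ℓ - 1|) {X : ℝ} (hX : 0 < X) {s : Fin k → ℂ}
    (hs : ∀ j, |(s j).re - 1 / 2| ≤ ε') (hp : Function.Injective fun J => pole J s) :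
    perron Φ g X ℓ s = 1 / (2 * Real.pi) * ∑ J : Finset (Fin k),
      (∏ K ∈ Finset.univ.erase J, (pole J s - pole K s))⁻¹ *
        ∫ t : ℝ, mellinWeighted Φ g X s (ℓ + t * Complex.I) / (ℓ + t * Complex.I - pole J s) := by
  obtain ⟨h8, h2k, hlt⟩ := h.four_mul_le hε'
  have hne : ∀ (J : Finset (Fin k)) (t : ℝ), (ℓ : ℂ) + t * Complex.I - pole J s ≠ 0 := fun J t =>
    line_sub_pole_ne_zero h.pos h2k hgap hs J t
  have hQ := h.differentiableOn_mellinWeighted hlt hg.continuous hgs hX hs (ℓ + 1)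
  have hI := (h.stripDecay hlt hg hgs hX hs (ℓ + 1)).integrable hQ hℓ (lt_add_one ℓ)
  have hint : ∀ J : Finset (Fin k), Integrable fun t : ℝ =>
      mellinWeighted Φ g X s (ℓ + t * Complex.I) / (ℓ + t * Complex.I - pole J s) := fun J => by
    have hpos := h.pos
    refine (hI.norm.const_mul (ε / 4)⁻¹).mono' ?_ (Eventually.of_forall fun t => ?_)
    · have h1 := continuous_vertical hQ (z := (ℓ : ℂ)) (by simpa using hℓ)
      exact (h1.div (by fun_prop) (hne J)).aestronglyMeasurable
    · rw [norm_div, div_eq_inv_mul]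
      refine mul_le_mul_of_nonneg_right (inv_anti₀ (by positivity) ?_) (norm_nonneg _)
      refine le_trans ?_ (Complex.abs_re_le_norm _)
      have h4 := abs_pole_re_le hs J
      have h5 := abs_sub_abs_le_abs_sub (ℓ - 1) ((pole J s).re - 1)
      rw [show ℓ - 1 - ((pole J s).re - 1) = ℓ - (pole J s).re by ring] at h5
      simp
      linarith
  rw [perron]
  simp_rw [← integral_const_mul]
  rw [← integral_finsetSum _ fun J _ => (hint J).const_mul _, integral_const_mul]
  congr 1
  refine integral_congr_ae (Eventually.of_forall fun t => ?_)
  beta_reduce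
  rw [perronIntegrand, div_eq_mul_inv, inv_prod_sub_eq_sum hp fun J => hne J t, Finset.mul_sum]
  exact Finset.sum_congr rfl fun J _ => by rw [div_eq_mul_inv]; ring

/-- With distinct poles each partial fraction contributes one residue. The functional equation for
`Φ` at `σ_J(w) = 1` rewrites it through `Φ(s^J, 1)`, that is, through the continued `H` at `s^J`. -/
theorem IsQuadrantContinuation.perron_sub_eq_recipeSum (h : IsQuadrantContinuation f k M ε W m Φ)
    (hκ : 12 ≤ κ) (hev : Even κ) {ε' : ℝ} (hε'0 : 0 < ε') (hε' : 8 * (k + 1) * ε' ≤ ε) {g : ℝ → ℂ}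
    (hg : ContDiff ℝ ∞ g) (hgs : HasCompactSupport g) {X : ℝ} (hX : 0 < X) {s : Fin k → ℂ}
    (hs : ∀ j, |(s j).re - 1 / 2| < ε') (hp : Function.Injective fun J => pole J s) :
    perron Φ g X (W + 1) s - perron Φ g X (1 - ε / 2) s = recipeSum κ (continuedH Φ) g X s := by
  obtain ⟨h8, h2k, hlt⟩ := h.four_mul_le hε'
  have hpos := h.pos
  have hhalf := h.le_half
  have hW := h.one_le
  have hs' : ∀ j, |(s j).re - 1 / 2| ≤ ε' := fun j => (hs j).le
  rw [perron_eq_sum h hε' hg hgs (by linarith)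
      (by rw [add_sub_cancel_right, abs_of_nonneg (by linarith)]; linarith) hX hs' hp,
    perron_eq_sum h hε' hg hgs (by linarith)
      (by rw [sub_sub_cancel_left, abs_neg, abs_of_pos (by positivity)]) hX hs' hp,
    ← mul_sub, ← Finset.sum_sub_distrib, Finset.mul_sum, recipeSum]
  refine Finset.sum_congr rfl fun J _ => ?_
  have h4 := abs_le.1 (abs_pole_re_le hs' J)
  rw [← mul_sub, StripDecay.integral_div_sub (p := 1 - ε) (q := W + 2)
    (h.differentiableOn_mellinWeighted hlt hg.continuous hgs hX hs' (W + 2))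
    (h.stripDecay hlt hg hgs hX hs' (W + 2)) (by linarith) (by linarith) (by linarith) (by linarith)]
  have hπ : (2 * Real.pi : ℂ) ≠ 0 := by simp [Real.pi_ne_zero]
  have hfun : Φ (join s (pole J s)) = (∏ j ∈ J, gammaX κ (s j)) * Φ (join (reflect J s) 1) := by
    rw [h.functional hκ hev (by linarith) J hs (by linarith), sigma_pole]
  rw [mellinWeighted, hfun, continuedH, prod_erase_reflect, div_eq_mul_inv (Φ _),
    show 1 + (J.card : ℂ) - 2 * ∑ j ∈ J, s j = pole J s from rfl]
  generalize (∏ K ∈ Finset.univ.erase J, (pole J s - pole K s))⁻¹ = I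
  field_simp

/-! ### Removing the genericity condition -/

/-- A direction in which no two polar divisors remain together. -/
def genericDirection (k : ℕ) : Fin k → ℂ := fun j => 2 ^ (j : ℕ)

/-- Uniqueness of binary expansions. -/
theorem sum_genericDirection_injective :
    Function.Injective fun J : Finset (Fin k) => ∑ j ∈ J, genericDirection k j := fun J K h => by
  have h1 : ∀ L : Finset (Fin k), ∑ j ∈ L, genericDirection k j =
      ((∑ i ∈ L.map Fin.valEmbedding, 2 ^ i : ℕ) : ℂ) := fun L => by
    rw [Finset.sum_map]
    push_cast
    rfl
  simp only [h1, Nat.cast_inj] at h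
  exact Finset.map_injective _ (Finset.geomSum_injective le_rfl h)

theorem pole_add_smul (J : Finset (Fin k)) (s v : Fin k → ℂ) (t : ℂ) :
    pole J (s + t • v) = pole J s - 2 * t * ∑ j ∈ J, v j := by
  simp only [pole, Pi.add_apply, Pi.smul_apply, smul_eq_mul, Finset.sum_add_distrib, ← Finset.mul_sum]
  ring

/-- Along this line the difference of two poles is affine in `t` with non-zero slope, so each pair
meets for at most one `t`. -/
theorem eventually_injective_pole (s : Fin k → ℂ) :
    ∀ᶠ t in 𝓝[≠] (0 : ℂ), Function.Injective fun J => pole J (s + t • genericDirection k) := by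
  have h : ∀ J K : Finset (Fin k), J ≠ K → ∀ᶠ t in 𝓝[≠] (0 : ℂ),
      pole J (s + t • genericDirection k) ≠ pole K (s + t • genericDirection k) := fun J K hJK => by
    have hD : ∑ j ∈ J, genericDirection k j - ∑ j ∈ K, genericDirection k j ≠ 0 :=
      sub_ne_zero.2 fun h => hJK (sum_genericDirection_injective h)
    set D := ∑ j ∈ J, genericDirection k j - ∑ j ∈ K, genericDirection k j with hDdef
    set b := (pole J s - pole K s) / (2 * D) with hb
    have hne : ∀ᶠ t in 𝓝[≠] (0 : ℂ), t ≠ b := by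
      by_cases hb0 : b = 0
      · rw [hb0]; exact self_mem_nhdsWithin
      · exact eventually_ne_nhdsWithin (Ne.symm hb0)
    filter_upwards [hne] with t ht h
    apply ht
    rw [pole_add_smul, pole_add_smul] at h
    rw [hb, eq_div_iff (mul_ne_zero two_ne_zero hD), hDdef]
    linear_combination -h
  have h2 : ∀ᶠ t in 𝓝[≠] (0 : ℂ), ∀ J K : Finset (Fin k), J ≠ K →
      pole J (s + t • genericDirection k) ≠ pole K (s + t • genericDirection k) :=
    eventually_all.2 fun J => eventually_all.2 fun K => by
      by_cases hJK : J = K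
      · exact Eventually.of_forall fun t hne => absurd hJK hne
      · filter_upwards [h J K hJK] with t ht _ using ht
  filter_upwards [h2] with t ht J K hJK
  by_contra hne
  exact ht J K hne hJK

theorem differentiableAt_gammaX {κ : ℤ} (hκ : 12 ≤ κ) {s : ℂ} (h0 : 0 < s.re) (h1 : s.re < 1) :
    DifferentiableAt ℂ (gammaX κ) s := by
  have hκ' : (12 : ℝ) ≤ κ := by exact_mod_cast hκ
  have hre : (((κ : ℂ) - 1) / 2).re = ((κ : ℝ) - 1) / 2 := by
    rw [show ((κ : ℂ) - 1) / 2 = (((κ : ℝ) - 1) / 2 : ℝ) by push_cast; ring, Complex.ofReal_re]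
  have hpos : ∀ z : ℂ, 0 < z.re → ∀ m : ℕ, z ≠ -m := fun z hz m h => by
    rw [h] at hz
    simp at hz
    linarith [Nat.cast_nonneg (α := ℝ) m]
  have hp1 : 0 < (1 - s + ((κ : ℂ) - 1) / 2).re := by
    rw [Complex.add_re, hre]; simp; linarith
  have hp2 : 0 < (s + ((κ : ℂ) - 1) / 2).re := by
    rw [Complex.add_re, hre]; linarith
  have hπ : (2 * (Real.pi : ℂ)) ≠ 0 := by simp [Real.pi_ne_zero]
  unfold gammaX
  refine DifferentiableAt.div (((differentiableAt_const _).mul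
    (DifferentiableAt.const_cpow (by fun_prop) (Or.inl hπ))).mul ?_) ?_
    (Complex.Gamma_ne_zero (hpos _ hp2))
  · exact DifferentiableAt.comp (f := fun s : ℂ => 1 - s + ((κ : ℂ) - 1) / 2) s
      (Complex.differentiableAt_Gamma _ (hpos _ hp1)) (by fun_prop)
  · exact DifferentiableAt.comp (f := fun s : ℂ => s + ((κ : ℂ) - 1) / 2) s
      (Complex.differentiableAt_Gamma _ (hpos _ hp2)) (by fun_prop)

theorem continuous_reflect (J : Finset (Fin k)) : Continuous (reflect J) :=
  continuous_pi fun j => by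
    unfold reflect
    split_ifs <;> fun_prop

theorem continuousAt_recipeSum {κ : ℤ} (hκ : 12 ≤ κ) {h : (Fin k → ℂ) → ℂ} {g : ℝ → ℂ}
    (hg : Continuous g) (hgs : HasCompactSupport g) {X : ℝ} (hX : 0 < X) {s : Fin k → ℂ}
    (hs : ∀ j, 0 < (s j).re ∧ (s j).re < 1) (hpole : ∀ J, 0 < (pole J s).re)
    (hh : ∀ J, ContinuousAt h (reflect J s)) : ContinuousAt (recipeSum κ h g X) s := by
  have hX0 : (X : ℂ) ≠ 0 := by exact_mod_cast hX.ne'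
  have hp : ∀ J : Finset (Fin k), ContinuousAt (pole J) s := fun J =>
    (differentiable_pole J).continuous.continuousAt
  have : recipeSum κ h g X = fun s => ∑ J : Finset (Fin k), (∏ j ∈ J, gammaX κ (s j)) *
    (X : ℂ) ^ pole J s * mellin g (pole J s) * h (reflect J s) := rfl
  rw [this]
  refine tendsto_finsetSum _ fun J _ => ContinuousAt.mul (ContinuousAt.mul (ContinuousAt.mul ?_ ?_) ?_) ?_
  · refine tendsto_finsetProd _ fun j _ => ?_
    exact ContinuousAt.comp (f := fun s : Fin k → ℂ => s j)
      (differentiableAt_gammaX hκ (hs j).1 (hs j).2).continuousAt (continuous_apply j).continuousAt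
  · exact (hp J).const_cpow (Or.inl hX0)
  · exact ContinuousAt.comp (f := pole J) (differentiableAt_mellin_test hg hgs (hpole J)).continuousAt (hp J)
  · exact ContinuousAt.comp (f := reflect J) (hh J) (continuous_reflect J).continuousAt

/-- Both sides are continuous at `s` and agree along the generic line for small `t ≠ 0`. -/
theorem IsQuadrantContinuation.perron_sub_eq_recipeSum_of_continuousAt
    (h : IsQuadrantContinuation f k M ε W m Φ) (hκ : 12 ≤ κ) (hev : Even κ) {ε' : ℝ} (hε'0 : 0 < ε')
    (hε' : 8 * (k + 1) * ε' ≤ ε) {g : ℝ → ℂ} (hg : ContDiff ℝ ∞ g) (hgs : HasCompactSupport g) {X : ℝ}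
    (hX : 0 < X) {s : Fin k → ℂ} (hs : ∀ j, |(s j).re - 1 / 2| < ε')
    (hh : ∀ J, ContinuousAt (continuedH Φ) (reflect J s)) :
    perron Φ g X (W + 1) s - perron Φ g X (1 - ε / 2) s = recipeSum κ (continuedH Φ) g X s := by
  obtain ⟨h8, h2k, hlt⟩ := h.four_mul_le hε'
  have hpos := h.pos
  have hhalf := h.le_half
  have hW := h.one_le
  have hU : IsOpen {s : Fin k → ℂ | ∀ j, |(s j).re - 1 / 2| < ε'} := by
    simp only [ofPred_forall]
    exact isOpen_iInter_of_finite fun j => isOpen_lt (by fun_prop) continuous_const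
  have hU' : {s : Fin k → ℂ | ∀ j, |(s j).re - 1 / 2| < ε'} ∈ 𝓝 s := hU.mem_nhds hs
  have hline : Tendsto (fun t : ℂ => s + t • genericDirection k) (𝓝[≠] 0) (𝓝 s) := by
    have : Continuous fun t : ℂ => s + t • genericDirection k := by fun_prop
    refine (this.tendsto' 0 s (by simp)).mono_left nhdsWithin_le_nhds
  have hL : ContinuousAt (fun s => perron Φ g X (W + 1) s - perron Φ g X (1 - ε / 2) s) s :=
    ((h.differentiableOn_perron hε' hg hgs (by linarith)
      (by rw [add_sub_cancel_right, abs_of_nonneg (by linarith)]; linarith) hX).continuousOn.continuousAt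
      hU').sub
    ((h.differentiableOn_perron hε' hg hgs (by linarith)
      (by rw [sub_sub_cancel_left, abs_neg, abs_of_pos (by positivity)]) hX).continuousOn.continuousAt hU')
  have hR : ContinuousAt (recipeSum κ (continuedH Φ) g X) s :=
    continuousAt_recipeSum hκ hg.continuous hgs hX
      (fun j => by have := abs_lt.1 (hs j); constructor <;> linarith)
      (fun J => by have := abs_le.1 (abs_pole_re_le (fun j => (hs j).le) J); linarith) hh
  refine tendsto_nhds_unique ((hL.tendsto.comp hline).congr' ?_) (hR.tendsto.comp hline)
  filter_upwards [eventually_injective_pole s, hline.eventually hU'] with t ht1 ht2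
  exact h.perron_sub_eq_recipeSum hκ hev hε'0 hε' hg hgs hX ht2 ht1

/-! ### The continuation of the series `H` -/

theorem analyticAt_join_left (s : Fin k → ℂ) (w : ℂ) : AnalyticAt ℂ (fun s => join s w) s :=
  (analyticAt_join (s, w)).curry_left

theorem analyticAt_pole (J : Finset (Fin k)) (s : Fin k → ℂ) : AnalyticAt ℂ (pole J) s := by
  unfold pole
  refine analyticAt_const.sub (analyticAt_const.mul (Finset.analyticAt_fun_sum _ fun j _ => ?_))
  exact (ContinuousLinearMap.proj (R := ℂ) (φ := fun _ : Fin k => ℂ) j).analyticAt s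

theorem pole_empty (s : Fin k → ℂ) : pole ∅ s = 1 := by simp [pole]

theorem not_eventually_prod_eq_zero (s : Fin k → ℂ) :
    ¬ ∀ᶠ x in 𝓝 s, ∏ J ∈ Finset.univ.erase (∅ : Finset (Fin k)), (1 - pole J x) = 0 := fun h => by
  have hline : Tendsto (fun t : ℂ => s + t • genericDirection k) (𝓝[≠] 0) (𝓝 s) := by
    have : Continuous fun t : ℂ => s + t • genericDirection k := by fun_prop
    refine (this.tendsto' 0 s (by simp)).mono_left nhdsWithin_le_nhds
  obtain ⟨t, ht1, ht2⟩ := ((hline.eventually h).and (eventually_injective_pole s)).exists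
  obtain ⟨J, hJ, hJ0⟩ := Finset.prod_eq_zero_iff.1 ht1
  refine (Finset.mem_erase.1 hJ).1 (ht2 ?_)
  beta_reduce
  rw [pole_empty, ← sub_eq_zero.1 hJ0]

theorem IsQuadrantContinuation.isMeromorphicOn (h : IsQuadrantContinuation f k M ε W m Φ) {ε' : ℝ}
    (hε' : ε' ≤ ε) : IsMeromorphicOn (continuedH Φ) {s | ∀ j, 1 / 2 - ε' < (s j).re} := fun s hs => by
  refine ⟨fun s => Φ (join s 1), fun s => ∏ J ∈ Finset.univ.erase (∅ : Finset (Fin k)), (1 - pole J s),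
    ?_, ?_, not_eventually_prod_eq_zero s, Eventually.of_forall fun x _ => rfl⟩
  · exact AnalyticAt.fun_comp (f := fun s : Fin k → ℂ => join s 1)
      (h.analytic s 1 (fun j => by linarith [hs j]) (by simpa using h.pos)) (analyticAt_join_left s 1)
  · exact Finset.analyticAt_fun_prod _ fun J _ => analyticAt_const.sub (analyticAt_pole J s)

/-- For `Re s_j > 1` the other poles lie strictly left of `Re w = 1`, so letting `w → 1⁺` isolates
the factor `(w - 1) A`, whose limit is `H`. -/
theorem IsQuadrantContinuation.continuedH_eq (h : IsQuadrantContinuation f k M ε W m Φ) (hκ : 0 < κ)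
    (hM : 1 ≤ M) {s : Fin k → ℂ} (hs : ∀ j, 1 < (s j).re) : continuedH Φ s = seriesH f M s := by
  have hpole : ∀ J ∈ Finset.univ.erase (∅ : Finset (Fin k)), 1 - pole J s ≠ 0 := fun J hJ h0 => by
    have hne : J.Nonempty := Finset.nonempty_iff_ne_empty.2 (Finset.mem_erase.1 hJ).1
    have h1 := congrArg Complex.re h0
    have h2 : (J.card : ℝ) < ∑ j ∈ J, (s j).re := by
      have := Finset.sum_lt_sum_of_nonempty hne fun j _ => hs j
      simpa using this
    have h3 : (0 : ℝ) < J.card := by exact_mod_cast hne.card_pos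
    simp [pole] at h1
    linarith
  have hpos := h.pos
  have hhalf := h.le_half
  have hcont : ContinuousAt (fun w : ℂ => Φ (join s w)) 1 :=
    ((analyticAt_comp_join (h.analytic s 1 (fun j => by linarith [hs j])
      (by simpa using h.pos))).curry_right).continuousAt
  have hto : Tendsto (fun w : ℝ => (w : ℂ)) (𝓝[>] 1) (𝓝 1) :=
    (Complex.continuous_ofReal.tendsto' 1 1 (by simp)).mono_left nhdsWithin_le_nhds
  have h1 := hcont.tendsto.comp hto
  have h2 : Tendsto (fun w : ℝ => (∏ J ∈ Finset.univ.erase (∅ : Finset (Fin k)), ((w : ℂ) - pole J s)) *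
      (((w : ℂ) - 1) * mds f M s w)) (𝓝[>] 1)
      (𝓝 ((∏ J ∈ Finset.univ.erase (∅ : Finset (Fin k)), (1 - pole J s)) * seriesH f M s)) :=
    (tendsto_finsetProd _ fun J _ => hto.sub_const _).mul (tendsto_mds f hκ hM hs)
  have h3 := tendsto_nhds_unique (h1.congr' ?_) h2
  · rw [continuedH, h3, mul_div_cancel_left₀ _ (Finset.prod_ne_zero_iff.2 hpole)]
  · filter_upwards [self_mem_nhdsWithin] with w hw
    have hw1 : 1 < w := hw
    simp only [Function.comp_apply]
    rw [h.eq_conv s w hs (by simpa using hw1), clearedMds_join,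
      ← Finset.prod_erase_mul _ _ (Finset.mem_univ (∅ : Finset (Fin k)))]
    simp_rw [sigma_sub_one]
    rw [pole_empty, mul_assoc]

theorem IsQuadrantContinuation.recipeWithPowerSaving (h : IsQuadrantContinuation f k M ε W m Φ)
    (hκ : 12 ≤ κ) (hev : Even κ) (hM : 1 ≤ M) : RecipeWithPowerSaving f k M := by
  have hpos := h.pos
  have hW := h.one_le
  have hhalf := h.le_half
  -- Small enough that reflections stay in the quadrant and the poles stay within `ε/4` of `1`. The
  -- saving is `δ = ε/2`, from the left line `Re w = 1 - ε/2`.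
  set ε' := ε / (8 * (k + 1)) with hε'
  have hε'0 : 0 < ε' := by positivity
  have hle : 8 * (k + 1) * ε' ≤ ε := by rw [hε']; field_simp; rfl
  obtain ⟨h8, h2k, hlt⟩ := h.four_mul_le hle
  have hgapc : ε / 2 ≤ |W + 1 - 1| := by
    rw [add_sub_cancel_right, abs_of_nonneg (by linarith)]; linarith
  have hgapa : ε / 2 ≤ |1 - ε / 2 - 1| := by
    rw [sub_sub_cancel_left, abs_neg, abs_of_pos (by positivity)]
  refine ⟨ε', continuedH Φ, hε'0, h.isMeromorphicOn hlt.le,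
    fun s hs => h.continuedH_eq (by linarith) hM hs, ε / 2, by positivity, fun g hg hgs =>
    ⟨fun X s => perron Φ g X (W + 1) s - perron Φ g X (1 - ε / 2) s, fun X hX => ⟨?_, fun s hs hh => ?_⟩,
      fun C B => ?_⟩⟩
  · exact (h.differentiableOn_perron hle hg hgs (by linarith) hgapc hX).sub
      (h.differentiableOn_perron hle hg hgs (by linarith) hgapa hX)
  · exact h.perron_sub_eq_recipeSum_of_continuousAt hκ hev hε'0 hle hg hgs hX hs
      fun J => (hh J).continuousAt
  · obtain ⟨K, hK⟩ := h.norm_perron_le hle hg hgs (ℓ := 1 - ε / 2) (by linarith) hgapa B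
    -- The shrinking strip `C / log X` eventually lies in the fixed strip of width `ε'`, where the
    -- error bound is uniform.
    obtain ⟨X₀, hX₀⟩ := eventually_atTop.1
      ((Real.tendsto_log_atTop.const_div_atTop C).eventually_le_const hε'0)
    refine ⟨K, max X₀ 1, fun X hX s hs hB => ?_⟩
    have hX0 : 0 < X := by linarith [le_max_right X₀ 1]
    have hs' : ∀ j, |(s j).re - 1 / 2| ≤ ε' := fun j =>
      (hs j).trans (hX₀ X ((le_max_left _ _).trans hX))
    rw [h.moment_eq_perron hle hg hgs hX0 hs', sub_sub_cancel]
    exact hK X hX0 s hs' hB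

end QuadTwist
end

/-! ### Conclusion -/

theorem mainTheorem3 {κ : ℤ} (f : CuspForm 𝒮ℒ κ) (hf : QuadTwist.IsHeckeEigenform f)
    (k M : ℕ) (hk : 1 ≤ k) (hM : 1 ≤ M) (hMDS : QuadTwist.MDSConjecture f k M) :
    QuadTwist.RecipeWithPowerSaving f k M := by
  obtain ⟨hκ, hev⟩ := QuadTwist.cuspForm_weight hf.1
  obtain ⟨T, W, m, Φ, hΦ⟩ := QuadTwist.exists_isContinuation f (by omega) hMDS
  obtain ⟨ε, hε⟩ := hΦ.exists_isQuadrantContinuation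
  exact hε.recipeWithPowerSaving hκ hev hM
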